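/- Let $A$ be a countable alphabet with a fixed enumeration, and let $A^{-\mathbb N}$ be the set of infinite pasts $\underline z=\ldots z_{-2}z_{-1}$. Let $P:A\times A^{-\mathbb N}\to[0,1]$ satisfy $\sum_{a\in A}P(a|\underline z)=1$ for every $\underline z$. Strings inside $P(a|\cdot)$ are written with the most recent symbols first, and $\inf_{\underline z}$ runs over all pasts. Put $\alpha(a)=\inf_{\underline z}P(a|\underline z)$, assume that $\mathcal E=\{a\in A:\alpha(a)>0\}$ is not empty, and let $w$ be a finite string of symbols of $\mathcal E$. For a finite string $v$ let $m^w(v)$ be the distance from the present back to the most recent occurrence of $w$ in $v$ ($+\infty$ if there is none). Put $$\alpha_{-1}=\sum_{a\in A}\alpha(a),\qquad \alpha_k=\inf_{b}\ \inf_{c\in A^k}\ \sum_{a\in A}\inf_{\underline z}P(a|b\,w\,c\,\underline z)\quad(k\ge0),$$ where $b$ runs over the finite strings such that the most recent occurrence of $w$ in the string $b\,w$ (most recent symbols first) is the displayed one. Assume that $\sum_{k\ge0}(1-\alpha_k)<\infty$. *Update function.* Glue from $0$ on, in the order of the enumeration, half-open intervals $I(a)$ of lengths $\alpha(a)$, $a\in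 A$. For a finite string $v$ with $m^w(v)<\infty$ let $\alpha(a,v,k)=\inf_{\underline z}P(a|v^{(k)}\underline z)$, where $v^{(k)}$ consists of the $m^w(v)+|w|+k$ most recent symbols of $v$, put $\alpha(a,v,-1)=\alpha(a)$, and continue the gluing with intervals $I(a,v,k)$ of lengths $\alpha(a,v,k)-\alpha(a,v,k-1)$, $a\in A$, for $k=0,1,2,\ldots$ successively. For $u\in[0,1[$ put $F(u,v)=a$ if $u\in I(a)$, and also if $u\in[\alpha_{l-1},\alpha_l[$ for some $l\ge0$ with $m^w(v)+|w|+l\le|v|$ and $u\in\bigcup_{k=0}^{l}I(a,v,k)$; put $F(u,v)=\star$ otherwise. *Algorithm 1.* Let ${\bf U}=(U_i)_{i\in\mathbb Z}$ be i.i.d. and uniform on $[0,1[$. On input $m\le n$ in $\mathbb Z$, start with $B=\{m,\ldots,n\}$, the set of sites still to be constructed. (Forward part) For $i=m,m+1,\ldots$, as long as $B\ne\emptyset$ and $F(U_i,X_m^{i-1})\in A$, put $X_i=F(U_i,X_m^{i-1})$ and remove $i$ from $B$. Then put $i=m$. (Backward part) While $B\neq\emptyset$: replace $i$ by $i-1$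 and add it to $B$; while $U_i\in[\alpha_{-1},1[$, replace $i$ by $i-1$ and add it to $B$; put $X_i=F(U_i,\emptyset)$ and remove $i$ from $B$; then, as long as $B\ne\emptyset$ and, for $t=\min B$, $F(U_t,X_i^{t-1})\in A$, put $X_t=F(U_t,X_i^{t-1})$ and remove $t$ from $B$. When $B=\emptyset$, stop and return $\theta[m,n]=i$ and $(X_{\theta[m,n]},\ldots,X_n)$. A stationary chain on $A$ with law $\mu$ is compatible with $P$ if, for every $a\in A$, $\mu(X_0=a|X_{-\infty}^{-1})=P(a|X_{-\infty}^{-1})$ $\mu$-almost surely. Then there is a measurable function ${\bf U}\mapsto X({\bf U})\in A^{\mathbb Z}$ such that: 1. the law of $X({\bf U})$ is the law of a stationary chain compatible with $P$, and it is the only such law; 2. for all integers $m\le n$, almost surely Algorithm 1 stops after finitely many steps, and its output is a time $\theta[m,n]\le m$ together with $([X({\bf U})]_{\theta[m,n]},\ldots,[X({\bf U})]_n)$. Thus the output is a sample of the unique stationary chain compatible with $P$; 3. there are random times $T_i=T_i({\bf U})\in\mathbb Z$, $i\in\mathbb Z$ (measurable functions of ${\bf U}$), with almost surely $T_i<T_{i+1}$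 for all $i$ and $T_0\le0<T_1$, such that the random strings $([X({\bf U})]_{T_i},\ldots,[X({\bf U})]_{T_{i+1}-1})$, $i\neq0$, are i.i.d. and have finite expected length. -/

import Mathlib

open MeasureTheory ProbabilityTheory

namespace InfiniteMemory

/-! Strings and pasts are written with the most recent symbol first: the infinite past
`… z₋₂ z₋₁` is the function `z : ℕ → A` with `z n = z₋₍ₙ₊₁₎`, and the finite string
`a₋ₘ … a₋₁` is the list `[a₋₁, …, a₋ₘ]`. -/

variable {A : Type*}

/-- The infinite past whose most recent symbols are those of `s`, preceded by the past `z`. -/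
def concat (s : List A) (z : ℕ → A) : ℕ → A := fun n => s.getD n (z (n - s.length))

/-- `P a z = P(a | z)` is a transition probability kernel on `A`. -/
structure IsKernel (P : A → (ℕ → A) → ℝ) : Prop where
  nonneg : ∀ a z, 0 ≤ P a z
  hasSum_one : ∀ z, HasSum (fun a => P a z) 1

/-- `inf_z P(a | s z)`, the infimum over all pasts whose most recent symbols are those of `s`. -/
noncomputable def lowerProb (P : A → (ℕ → A) → ℝ) (a : A) (s : List A) : ℝ :=
  ⨅ z : ℕ → A, P a (concat s z)

/-- The symbols `a` with `inf_z P(a | z) > 0`. -/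
def spontaneousSymbols (P : A → (ℕ → A) → ℝ) : Set A := {a | 0 < lowerProb P a []}

/-- The distance `m^w(v)` to the most recent occurrence of `w` in `v`, and `⊤` if there is none. -/
noncomputable def distOcc (w v : List A) : ℕ∞ :=
  sInf ((fun k : ℕ => (k : ℕ∞)) '' {k : ℕ | w <+: v.drop k})

/-- `α^w_k`: the infimum of `∑_a inf_z P(a | b w c z)` over all finite strings `b` such that in
`b w` (most recent symbol first) the most recent occurrence of `w` is the displayed one, and over
all strings `c` of length `k`. -/
noncomputable def alphaW (P : A → (ℕ → A) → ℝ) (w : List A) (k : ℕ) : ℝ :=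
  sInf {x : ℝ | ∃ b c : List A, distOcc w (b ++ w) = (b.length : ℕ∞) ∧ c.length = k ∧
    x = ∑' a, lowerProb P a (b ++ w ++ c)}

/-- The thresholds, with the index shifted by one: `threshold P w 0 = α₋₁ = ∑_a inf_z P(a | z)`
and `threshold P w (k + 1) = α^w_k`. -/
noncomputable def threshold (P : A → (ℕ → A) → ℝ) (w : List A) : ℕ → ℝ
  | 0 => ∑' a, lowerProb P a []
  | k + 1 => alphaW P w k

/-- `α^w(a, v, k)`, again with the index shifted by one:
`alphaAt P w v 0 a = inf_z P(a | z)`, and `alphaAt P w v (k + 1) a` is `inf_z P(a | s z)`, where `s`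
is the part of `v` that reaches `k` symbols beyond the most recent occurrence of `w`. -/
noncomputable def alphaAt (P : A → (ℕ → A) → ℝ) (w v : List A) : ℕ → A → ℝ
  | 0, a => lowerProb P a []
  | k + 1, a => lowerProb P a (v.take ((distOcc w v).toNat + w.length + k))

/-- Starting at the point `base`, glue half-open intervals of lengths `f a`, `a ∈ A`, one after the
other in the order of the enumeration `e`; this is the interval that belongs to `a`. -/
noncomputable def glued (e : A ↪ ℕ) (base : ℝ) (f : A → ℝ) (a : A) : Set ℝ :=
  Set.Ico (base + ∑' b, if e b < e a then f b else 0)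
    (base + (∑' b, if e b < e a then f b else 0) + f a)

/-- The interval `I(a)`. -/
noncomputable def intervalI (e : A ↪ ℕ) (P : A → (ℕ → A) → ℝ) (a : A) : Set ℝ :=
  glued e 0 (fun b => lowerProb P b []) a

/-- The interval `I^w(a, v, k)`: the `k`-th layer is glued to the right of the preceding ones,
which together have length `∑_b α^w(b, v, k - 1)`. -/
noncomputable def intervalIw (e : A ↪ ℕ) (P : A → (ℕ → A) → ℝ) (w v : List A) (a : A) (k : ℕ) :
    Set ℝ :=
  glued e (∑' b, alphaAt P w v k b) (fun b => alphaAt P w v (k + 1) b - alphaAt P w v k b) a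

/-- The uniform variable `u` and the known part `v` of the past determine the present symbol, and
it is `a`: either `u ∈ I(a)`, or `u ∈ [α_{l-1}, α_l[` for some `l ≥ 0`, the string `v` is long
enough to contain its context in the `l`-th context tree, and `u ∈ ⋃_{k ≤ l} I^w(a, v, k)`. -/
def Determines (e : A ↪ ℕ) (P : A → (ℕ → A) → ℝ) (w : List A) (u : ℝ) (v : List A) (a : A) :
    Prop :=
  u ∈ intervalI e P a ∨
    ∃ l : ℕ, u ∈ Set.Ico (threshold P w l) (threshold P w (l + 1)) ∧
      distOcc w v + (w.length : ℕ∞) + (l : ℕ∞) ≤ (v.length : ℕ∞) ∧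
      ∃ k ≤ l, u ∈ intervalIw e P w v a k

open Classical in
/-- The update function `F`, with `none` in the role of the symbol `⋆`. -/
noncomputable def update (e : A ↪ ℕ) (P : A → (ℕ → A) → ℝ) (w : List A) (u : ℝ) (v : List A) :
    Option A :=
  if h : ∃ a, Determines e P w u v a then some h.choose else none

/-! ### The perfect simulation algorithm -/

/-- The control points of the algorithm: its four `while` loops and the final `return`. -/
inductive Loc
  | forward
  | outer
  | search
  | fill
  | halted

/-- The variables of the algorithm. -/
structure State (A : Type*) where
  loc : Loc
  i : ℤ
  t : ℤ
  B : Finset ℤ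
  X : ℤ → Option A
  theta : ℤ

/-- The string `X_i … X_{t-1}` (most recent symbol first). -/
def segment (X : ℤ → Option A) (i t : ℤ) : List A :=
  (List.range (t - i).toNat).filterMap fun j => X (t - 1 - (j : ℤ))

/-- The initial assignments of the algorithm on the window `[m, n]`. -/
noncomputable def initState (A : Type*) (m n : ℤ) : State A where
  loc := Loc.forward
  i := m
  t := m
  B := Finset.Icc m n
  X := fun _ => none
  theta := m

/-- `min B` (only used when `B` is not empty). -/
def minB (B : Finset ℤ) : ℤ := B.min.untopD 0

open Classical in
/-- One step of the algorithm with input `m`: one test of the loop condition at the current control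
point, followed by the corresponding assignments. `U i` is the uniform variable sampled for the
site `i`. -/
noncomputable def step (e : A ↪ ℕ) (P : A → (ℕ → A) → ℝ) (w : List A) (U : ℤ → ℝ) (m : ℤ)
    (s : State A) : State A :=
  match s.loc with
  | Loc.forward =>
      if update e P w (U s.i) (segment s.X m s.i) ≠ none ∧ s.B.Nonempty then
        { s with
          X := Function.update s.X s.i (update e P w (U s.i) (segment s.X m s.i))
          B := s.B.erase s.i
          i := s.i + 1 }
      else { s with loc := Loc.outer, i := m }
  | Loc.outer =>
      if s.B.Nonempty then
        { s with loc := Loc.search, i := s.i - 1, B := insert (s.i - 1) s.B }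
      else { s with loc := Loc.halted, theta := s.i }
  | Loc.search =>
      if U s.i ∈ Set.Ico (threshold P w 0) 1 then
        { s with i := s.i - 1, B := insert (s.i - 1) s.B }
      else
        { s with
          loc := Loc.fill
          X := Function.update s.X s.i (update e P w (U s.i) [])
          B := s.B.erase s.i
          t := minB (s.B.erase s.i) }
  | Loc.fill =>
      if update e P w (U s.t) (segment s.X s.i s.t) ≠ none ∧ s.B.Nonempty then
        { s with
          X := Function.update s.X s.t (update e P w (U s.t) (segment s.X s.i s.t))
          B := s.B.erase s.t
          t := minB (s.B.erase s.t) }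
      else { s with loc := Loc.outer }
  | Loc.halted => s

/-- On the window `[m, n]` and with the uniform variables `U`, the algorithm stops after finitely
many steps and returns the time `θ` and the string `x_θ … x_n`. -/
def Outputs (e : A ↪ ℕ) (P : A → (ℕ → A) → ℝ) (w : List A) (U : ℤ → ℝ) (m n : ℤ)
    (θ : ℤ) (x : ℤ → A) : Prop :=
  ∃ N : ℕ, ((step e P w U m)^[N] (initState A m n)).loc = Loc.halted ∧
    ((step e P w U m)^[N] (initState A m n)).theta = θ ∧
    ∀ j ∈ Set.Icc θ n, ((step e P w U m)^[N] (initState A m n)).X j = some (x j)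

/-! ### The probabilistic side -/

/-- The uniform distribution on `[0, 1[`. -/
noncomputable def unif : Measure ℝ := volume.restrict (Set.Ico 0 1)

instance : IsProbabilityMeasure unif := ⟨by simp [unif]⟩

/-- The law of a family `(U_i)`, `i ∈ ℤ`, of independent variables that are uniform on `[0, 1[`. -/
noncomputable def lawU : Measure (ℤ → ℝ) := Measure.infinitePi fun _ : ℤ => unif

/-- The past of time `0`, as an element of `A^{-ℕ}`. -/
def pastOf (x : ℤ → A) : ℕ → A := fun n => x (-((n : ℤ) + 1))

/-- `μ` is the law of a stationary chain on `A` that is compatible with `P`: for every `a`, a version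
of the conditional probability of `X₀ = a` given the past of time `0` is `P(a | past)`. -/
structure IsStationaryCompatible [MeasurableSpace A] (P : A → (ℕ → A) → ℝ) (μ : Measure (ℤ → A)) :
    Prop where
  isProbabilityMeasure : IsProbabilityMeasure μ
  stationary : MeasurePreserving (fun (x : ℤ → A) (n : ℤ) => x (n + 1)) μ μ
  compatible : ∀ a : A,
    μ[Set.indicator {x : ℤ → A | x 0 = a} (fun _ => (1 : ℝ)) |
      MeasurableSpace.comap (pastOf (A := A)) MeasurableSpace.pi] =ᵐ[μ] fun x => P a (pastOf x)

/-- The string `x_s … x_{t-1}` (in the order of time). -/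
def block (x : ℤ → A) (s t : ℤ) : List A :=
  (List.range (t - s).toNat).map fun j => x (s + (j : ℤ))

/-- The discrete σ-algebra on the set of finite strings. -/
instance : MeasurableSpace (List A) := ⊤

end InfiniteMemory

/-! Say that a site regenerates if the construction that starts there, with an empty past, never
gets stuck; the symbols from that site on are then functions of the later uniform variables. After
a spontaneous occurrence of `w`, getting stuck means that a uniform variable needs a context longer
than what has been constructed. Occurrences of `w` recur at a linear rate, so by the summability of
`1 - α_k` and a Borel-Cantelli estimate a site regenerates with positive probability. By
stationarity and the zero-one law, regenerations then occur in both directions of time. They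
determine the chain, and the backward part of the algorithm goes on at most until it meets one.

The update function, fed with a compatible past and fresh uniform variables, reproduces a
compatible chain, and its output forgets the past at the first regeneration. Hence the law is
unique.

Whether a cycle that starts at `s` produces a given string of length `L`, provided that `s + L`
regenerates, depends only on the uniform variables of the sites `s, …, s + L - 1`. The probabilities
of successive cycles therefore factorize, and the sum of the probabilities of all cycles that cover
the site `0`, times the probability of a regeneration, is `1`; this sum is the expected length of a
block. -/

namespace InfiniteMemory

open scoped ENNReal

variable {A : Type*}

section Layers

variable {e : A ↪ ℕ} {P : A → (ℕ → A) → ℝ} {w : List A}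

/-! ### Lower probabilities -/

lemma concat_append (s t : List A) (z : ℕ → A) : concat (s ++ t) z = concat s (concat t z) := by
  ext n
  simp only [concat]
  rcases lt_or_ge n s.length with h | h
  · rw [List.getD_append _ _ _ _ h, List.getD_eq_getElem _ _ h, List.getD_eq_getElem _ _ h]
  · rw [List.getD_append_right _ _ _ _ h, List.getD_eq_default _ _ h, List.length_append,
      Nat.sub_add_eq]

lemma lowerProb_nonneg (hP : IsKernel P) (a : A) (s : List A) : 0 ≤ lowerProb P a s :=
  Real.iInf_nonneg fun _ => hP.nonneg _ _

lemma lowerProb_le (hP : IsKernel P) (a : A) (s : List A) (z : ℕ → A) :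
    lowerProb P a s ≤ P a (concat s z) :=
  ciInf_le ⟨0, Set.forall_mem_range.2 fun _ => hP.nonneg _ _⟩ z

lemma lowerProb_le_of_isPrefix [Nonempty A] (hP : IsKernel P) (a : A) {s t : List A}
    (h : s <+: t) : lowerProb P a s ≤ lowerProb P a t := by
  obtain ⟨r, rfl⟩ := h
  exact le_ciInf fun z => by rw [concat_append]; exact lowerProb_le hP _ _ _

lemma summable_lowerProb [Nonempty A] (hP : IsKernel P) (s : List A) :
    Summable fun a => lowerProb P a s :=
  Summable.of_nonneg_of_le (fun a => lowerProb_nonneg hP a s)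
    (fun a => lowerProb_le hP a s (Classical.arbitrary _)) (hP.hasSum_one _).summable

lemma tsum_lowerProb_nonneg (hP : IsKernel P) (s : List A) : 0 ≤ ∑' a, lowerProb P a s :=
  tsum_nonneg fun _ => lowerProb_nonneg hP _ _

lemma tsum_lowerProb_le_one [Nonempty A] (hP : IsKernel P) (s : List A) :
    ∑' a, lowerProb P a s ≤ 1 := by
  rw [← (hP.hasSum_one (concat s (Classical.arbitrary _))).tsum_eq]
  exact (summable_lowerProb hP s).tsum_le_tsum (fun a => lowerProb_le hP a s _)
    (hP.hasSum_one _).summable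

lemma tsum_lowerProb_le_of_isPrefix [Nonempty A] (hP : IsKernel P) {s t : List A}
    (h : s <+: t) : ∑' a, lowerProb P a s ≤ ∑' a, lowerProb P a t :=
  (summable_lowerProb hP s).tsum_le_tsum (fun a => lowerProb_le_of_isPrefix hP a h)
    (summable_lowerProb hP t)

/-! ### Occurrences of the word -/

lemma distOcc_eq_coe_iff {v : List A} {m : ℕ} :
    distOcc w v = m ↔ w <+: v.drop m ∧ ∀ k < m, ¬ w <+: v.drop k := by
  constructor
  · intro h
    have hne : ((fun k : ℕ => (k : ℕ∞)) '' {k : ℕ | w <+: v.drop k}).Nonempty := by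
      rw [Set.nonempty_iff_ne_empty]
      intro hempty
      rw [distOcc, hempty, sInf_empty] at h
      exact ENat.natCast_ne_top m h.symm
    obtain ⟨k, hk, hkm⟩ := csInf_mem hne
    obtain rfl : k = m := ENat.natCast_inj.1 (hkm.trans h)
    refine ⟨hk, fun j hj hjw => hj.not_ge ?_⟩
    have hle : distOcc w v ≤ j := sInf_le ⟨j, hjw, rfl⟩
    exact_mod_cast h.symm.trans_le hle
  · rintro ⟨hm, hlt⟩
    refine IsLeast.csInf_eq ⟨⟨m, hm, rfl⟩, ?_⟩
    rintro _ ⟨k, hk, rfl⟩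
    exact Nat.cast_le.2 (not_lt.1 fun h => hlt k h hk)

lemma distOcc_append {v : List A} {m : ℕ} (h : distOcc w v = m) (hm : m + w.length ≤ v.length)
    (t : List A) : distOcc w (v ++ t) = m := by
  rw [distOcc_eq_coe_iff] at h ⊢
  refine ⟨?_, fun k hk hw => h.2 k hk ?_⟩
  · rw [List.drop_append_of_le_length (by lia)]
    exact h.1.trans (List.prefix_append _ _)
  · rw [List.drop_append_of_le_length (by lia)] at hw
    exact List.prefix_of_prefix_length_le hw (List.prefix_append _ _)
      (by rw [List.length_drop]; lia)

lemma exists_append_of_distOcc {v : List A} {m k : ℕ} (h : distOcc w v = m)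
    (hk : m + w.length + k ≤ v.length) :
    ∃ b c : List A, distOcc w (b ++ w) = (b.length : ℕ∞) ∧ c.length = k ∧
      v.take (m + w.length + k) = b ++ w ++ c := by
  rw [distOcc_eq_coe_iff] at h
  obtain ⟨⟨r, hr⟩, hbefore⟩ := h
  obtain ⟨b, rfl, hv⟩ : ∃ b : List A, b.length = m ∧ v = b ++ w ++ r :=
    ⟨v.take m, by rw [List.length_take]; lia,
      by rw [List.append_assoc, hr, List.take_append_drop]⟩
  refine ⟨b, r.take k, distOcc_eq_coe_iff.2 ⟨?_, fun j hj hw => hbefore j hj ?_⟩, ?_, ?_⟩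
  · rw [List.drop_left]
  · rw [hv, List.drop_append_of_le_length (by rw [List.length_append]; lia)]
    exact hw.trans (List.prefix_append _ _)
  · rw [hv, List.length_append, List.length_append] at hk
    rw [List.length_take]
    lia
  · rw [hv, ← List.length_append, List.take_length_add_append]

lemma exists_distOcc_eq_of_add_le {v : List A} {c : ℕ}
    (h : distOcc w v + (w.length : ℕ∞) + (c : ℕ∞) ≤ (v.length : ℕ∞)) :
    ∃ m : ℕ, distOcc w v = m ∧ m + w.length + c ≤ v.length := by
  cases hm : distOcc w v with
  | top => simp [hm] at h
  | coe m => exact ⟨m, rfl, by rw [hm] at h; exact_mod_cast h⟩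

/-! ### Thresholds -/

/-- The set of the sums `∑_a inf_z P(a | b w c z)`, `c ∈ A^k`, whose infimum is `α_k`. -/
def contextSums (P : A → (ℕ → A) → ℝ) (w : List A) (k : ℕ) : Set ℝ :=
  {x : ℝ | ∃ b c : List A, distOcc w (b ++ w) = (b.length : ℕ∞) ∧ c.length = k ∧
    x = ∑' a, lowerProb P a (b ++ w ++ c)}

lemma bddBelow_contextSums (hP : IsKernel P) (k : ℕ) : BddBelow (contextSums P w k) :=
  ⟨0, by rintro _ ⟨b, c, -, -, rfl⟩; exact tsum_lowerProb_nonneg hP _⟩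

lemma contextSums_nonempty [Nonempty A] (k : ℕ) : (contextSums P w k).Nonempty :=
  ⟨_, [], List.replicate k (Classical.arbitrary A),
    distOcc_eq_coe_iff.2 ⟨List.prefix_rfl, fun _ hk => absurd hk (Nat.not_lt_zero _)⟩,
    List.length_replicate, rfl⟩

lemma alphaW_le_tsum_lowerProb_take (hP : IsKernel P) {v : List A} {m k : ℕ}
    (h : distOcc w v = m) (hk : m + w.length + k ≤ v.length) :
    alphaW P w k ≤ ∑' a, lowerProb P a (v.take (m + w.length + k)) := by
  obtain ⟨b, c, hb, hc, hv⟩ := exists_append_of_distOcc h hk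
  exact csInf_le (bddBelow_contextSums hP k) ⟨b, c, hb, hc, by rw [hv]⟩

lemma monotone_threshold [Nonempty A] (hP : IsKernel P) : Monotone (threshold P w) := by
  refine monotone_nat_of_le_succ fun k => le_csInf (contextSums_nonempty k) ?_
  rintro _ ⟨b, c, hb, hc, rfl⟩
  cases k with
  | zero => exact tsum_lowerProb_le_of_isPrefix hP ⟨_, rfl⟩
  | succ k =>
    have hk : (c.take k).length = k := by rw [List.length_take, hc]; lia
    refine (csInf_le (bddBelow_contextSums hP k) ⟨b, c.take k, hb, hk, rfl⟩).trans ?_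
    exact tsum_lowerProb_le_of_isPrefix hP ((List.prefix_append_right_inj _).2
      (List.take_prefix k c))

lemma tendsto_alphaW (hsum : Summable fun k : ℕ => 1 - alphaW P w k) :
    Filter.Tendsto (alphaW P w) Filter.atTop (nhds 1) := by
  simpa only [sub_sub_cancel, sub_zero] using
    (tendsto_const_nhds (x := (1 : ℝ))).sub hsum.tendsto_atTop_zero

lemma exists_mem_Ico_succ {α : Type*} [LinearOrder α] {f : ℕ → α} {n : ℕ} {u : α}
    (h0 : f 0 ≤ u) (hn : u < f n) : ∃ k < n, u ∈ Set.Ico (f k) (f (k + 1)) := by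
  induction n with
  | zero => exact absurd hn h0.not_gt
  | succ n ih =>
    rcases lt_or_ge u (f n) with h | h
    · obtain ⟨k, hk, hu⟩ := ih h
      exact ⟨k, hk.trans n.lt_succ_self, hu⟩
    · exact ⟨n, n.lt_succ_self, h, hn⟩

lemma exists_mem_Ico_threshold (hsum : Summable fun k : ℕ => 1 - alphaW P w k) {u : ℝ}
    (h0 : threshold P w 0 ≤ u) (h1 : u < 1) :
    ∃ l, u ∈ Set.Ico (threshold P w l) (threshold P w (l + 1)) := by
  obtain ⟨l, hl⟩ := ((tendsto_alphaW hsum).eventually (lt_mem_nhds h1)).exists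
  obtain ⟨k, -, hk⟩ := exists_mem_Ico_succ (f := threshold P w) (n := l + 1) h0 hl
  exact ⟨k, hk⟩

/-! ### Gluing -/

/-- The total length of the glued intervals that belong to the symbols of rank less than `n`. -/
noncomputable def gluedBefore (e : A ↪ ℕ) (f : A → ℝ) (n : ℕ) : ℝ :=
  ∑' b, if e b < n then f b else 0

section Gluing

variable {f : A → ℝ}

lemma summable_ite (hf : Summable f) (h0 : ∀ a, 0 ≤ f a) (p : A → Prop)
    [DecidablePred p] : Summable fun b => if p b then f b else 0 :=
  Summable.of_nonneg_of_le (fun b => by split_ifs; exacts [h0 b, le_rfl])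
    (fun b => by split_ifs; exacts [le_rfl, h0 b]) hf

lemma gluedBefore_nonneg (h0 : ∀ a, 0 ≤ f a) (n : ℕ) : 0 ≤ gluedBefore e f n :=
  tsum_nonneg fun b => by split_ifs; exacts [h0 b, le_rfl]

lemma gluedBefore_zero : gluedBefore e f 0 = 0 := by
  simp only [gluedBefore, Nat.not_lt_zero, if_false, tsum_zero]

lemma gluedBefore_succ (hf : Summable f) (h0 : ∀ a, 0 ≤ f a) (a : A) :
    gluedBefore e f (e a + 1) = gluedBefore e f (e a) + f a := by
  classical
  rw [gluedBefore, gluedBefore, ← tsum_ite_eq a fun _ => f a,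
    ← (summable_ite hf h0 _).tsum_add (hasSum_ite_eq a (f a)).summable]
  refine tsum_congr fun b => ?_
  rcases eq_or_ne b a with rfl | hb
  · simp
  · have hne : e b ≠ e a := fun h => hb (e.injective h)
    simp only [Nat.lt_succ_iff_lt_or_eq, hne, or_false, hb, if_false, add_zero]

lemma gluedBefore_succ_of_notMem_range {n : ℕ} (hn : n ∉ Set.range e) :
    gluedBefore e f (n + 1) = gluedBefore e f n := by
  refine tsum_congr fun b => ?_
  have hne : e b ≠ n := fun h => hn ⟨b, h⟩
  simp only [Nat.lt_succ_iff_lt_or_eq, hne, or_false]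

lemma monotone_gluedBefore (hf : Summable f) (h0 : ∀ a, 0 ≤ f a) :
    Monotone (gluedBefore e f) := by
  refine fun m n hmn => (summable_ite hf h0 _).tsum_le_tsum (fun b => ?_) (summable_ite hf h0 _)
  split_ifs with hm hn hn
  · exact le_rfl
  · exact absurd (hm.trans_le hmn) hn
  · exact h0 b
  · exact le_rfl

lemma gluedBefore_le_tsum (hf : Summable f) (h0 : ∀ a, 0 ≤ f a) (n : ℕ) :
    gluedBefore e f n ≤ ∑' b, f b :=
  (summable_ite hf h0 _).tsum_le_tsum (fun b => by split_ifs; exacts [le_rfl, h0 b]) hf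

lemma exists_lt_gluedBefore (hf : Summable f) (h0 : ∀ a, 0 ≤ f a) {y : ℝ}
    (hy : y < ∑' b, f b) : ∃ n, y < gluedBefore e f n := by
  obtain ⟨s, hs⟩ := (hf.hasSum.eventually (lt_mem_nhds hy)).exists
  refine ⟨s.sup e + 1, hs.trans_le ?_⟩
  calc ∑ b ∈ s, f b = ∑ b ∈ s, (if e b < s.sup e + 1 then f b else 0) :=
        Finset.sum_congr rfl fun b hb =>
          (if_pos (Nat.lt_succ_of_le (Finset.le_sup (f := e) hb))).symm
    _ ≤ gluedBefore e f (s.sup e + 1) :=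
        (summable_ite hf h0 _).sum_le_tsum s fun b _ => by split_ifs; exacts [h0 b, le_rfl]

lemma glued_eq_Ico (base : ℝ) (hf : Summable f) (h0 : ∀ a, 0 ≤ f a) (a : A) :
    glued e base f a =
      Set.Ico (base + gluedBefore e f (e a)) (base + gluedBefore e f (e a + 1)) := by
  rw [gluedBefore_succ hf h0, ← add_assoc]; rfl

lemma glued_subset_Ico (base : ℝ) (hf : Summable f) (h0 : ∀ a, 0 ≤ f a) (a : A) :
    glued e base f a ⊆ Set.Ico base (base + ∑' b, f b) := by
  rw [glued_eq_Ico base hf h0]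
  exact Set.Ico_subset_Ico (le_add_of_nonneg_right (gluedBefore_nonneg h0 _))
    (add_le_add_right (gluedBefore_le_tsum hf h0 _) base)

lemma eq_of_mem_glued {base : ℝ} (hf : Summable f) (h0 : ∀ a, 0 ≤ f a) {a b : A}
    {u : ℝ} (ha : u ∈ glued e base f a) (hb : u ∈ glued e base f b) : a = b := by
  rw [glued_eq_Ico base hf h0] at ha hb
  by_contra hab
  have hdisj := ((monotone_gluedBefore (e := e) hf h0).const_add base).pairwise_disjoint_on_Ico_succ
    (e.injective.ne hab)
  exact Set.disjoint_left.1 hdisj ha hb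

lemma exists_mem_glued {base : ℝ} (hf : Summable f) (h0 : ∀ a, 0 ≤ f a)
    {u : ℝ} (hu : u ∈ Set.Ico base (base + ∑' b, f b)) : ∃ a, u ∈ glued e base f a := by
  obtain ⟨n, hn⟩ := exists_lt_gluedBefore (e := e) hf h0 (sub_lt_iff_lt_add'.2 hu.2)
  obtain ⟨k, -, hk⟩ := exists_mem_Ico_succ (f := gluedBefore e f)
    (by rw [gluedBefore_zero]; exact sub_nonneg.2 hu.1) hn
  by_cases hrange : k ∈ Set.range e
  · obtain ⟨a, rfl⟩ := hrange
    refine ⟨a, ?_⟩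
    rw [glued_eq_Ico base hf h0]
    exact ⟨le_sub_iff_add_le'.1 hk.1, sub_lt_iff_lt_add'.1 hk.2⟩
  · rw [gluedBefore_succ_of_notMem_range hrange, Set.Ico_self] at hk
    exact absurd hk (Set.notMem_empty _)

lemma volume_glued (base : ℝ) (f : A → ℝ) (a : A) :
    volume (glued e base f a) = ENNReal.ofReal (f a) := by
  rw [glued, Real.volume_Ico, add_sub_cancel_left]

end Gluing

/-! ### The layers -/

/-- The total length `∑_b α(b, v, k - 1)` of the intervals `I(b)` and of the layers `0, …, k - 1`
above the string `v`. -/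
noncomputable def cover (P : A → (ℕ → A) → ℝ) (w v : List A) (k : ℕ) : ℝ :=
  ∑' b, alphaAt P w v k b

lemma threshold_le_cover (hP : IsKernel P) {v : List A} {m l : ℕ} (h : distOcc w v = m)
    (hl : m + w.length + l ≤ v.length) : threshold P w (l + 1) ≤ cover P w v (l + 1) := by
  have hle := alphaW_le_tsum_lowerProb_take (P := P) hP h hl
  simpa only [cover, alphaAt, h, ENat.toNat_natCast, threshold] using hle

lemma alphaAt_append {v : List A} {m l : ℕ} (h : distOcc w v = m)
    (hl : m + w.length + l ≤ v.length) (t : List A) {j : ℕ} (hj : j ≤ l + 1) :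
    alphaAt P w (v ++ t) j = alphaAt P w v j := by
  funext a
  cases j with
  | zero => rfl
  | succ j =>
    simp only [alphaAt, h, distOcc_append h (by lia) t, ENat.toNat_natCast]
    rw [List.take_append_of_le_length (by lia)]

lemma intervalIw_congr {v v' : List A} {k : ℕ}
    (h : ∀ j ≤ k + 1, alphaAt P w v j = alphaAt P w v' j) (a : A) :
    intervalIw e P w v a k = intervalIw e P w v' a k := by
  simp only [intervalIw, h k k.le_succ, h (k + 1) le_rfl]

lemma Determines.of_isPrefix {u : ℝ} {v v' : List A} {a : A}
    (h : Determines e P w u v a) (hv : v <+: v') : Determines e P w u v' a := by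
  obtain ⟨t, rfl⟩ := hv
  refine h.imp_right ?_
  rintro ⟨l, hl, hlen, k, hk, hu⟩
  obtain ⟨m, hm, hlen'⟩ := exists_distOcc_eq_of_add_le hlen
  refine ⟨l, hl, ?_, k, hk, ?_⟩
  · rw [distOcc_append hm (by lia) t, ← hm, List.length_append]
    exact hlen.trans (by exact_mod_cast Nat.le_add_right _ _)
  · rwa [intervalIw_congr fun j hj => alphaAt_append hm hlen' t (by lia)]

lemma measurableSet_determines (v : List A) (a : A) :
    MeasurableSet {u | Determines e P w u v a} := by
  simp only [Determines, Set.ofPred_or, Set.ofPred_exists, Set.ofPred_and]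
  exact measurableSet_Ico.union <| .iUnion fun l => measurableSet_Ico.inter <|
    (MeasurableSet.const _).inter <| .iUnion fun k =>
      (MeasurableSet.const _).inter measurableSet_Ico

variable [Nonempty A]

lemma summable_alphaAt (hP : IsKernel P) (v : List A) (k : ℕ) : Summable (alphaAt P w v k) := by
  cases k <;> exact summable_lowerProb hP _

lemma alphaAt_le_succ (hP : IsKernel P) (v : List A) (k : ℕ) (a : A) :
    alphaAt P w v k a ≤ alphaAt P w v (k + 1) a := by
  cases k with
  | zero => exact lowerProb_le_of_isPrefix hP a List.nil_prefix
  | succ k => exact lowerProb_le_of_isPrefix hP a (List.take_prefix_take_left (by lia))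

lemma summable_layer (hP : IsKernel P) (v : List A) (k : ℕ) :
    Summable fun b => alphaAt P w v (k + 1) b - alphaAt P w v k b :=
  (summable_alphaAt hP v (k + 1)).sub (summable_alphaAt hP v k)

lemma layer_nonneg (hP : IsKernel P) (v : List A) (k : ℕ) (b : A) :
    0 ≤ alphaAt P w v (k + 1) b - alphaAt P w v k b :=
  sub_nonneg.2 (alphaAt_le_succ hP v k b)

lemma cover_add_tsum_layer (hP : IsKernel P) (v : List A) (k : ℕ) :
    cover P w v k + ∑' b, (alphaAt P w v (k + 1) b - alphaAt P w v k b) = cover P w v (k + 1) := by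
  rw [(summable_alphaAt hP v (k + 1)).tsum_sub (summable_alphaAt hP v k)]
  exact add_sub_cancel _ _

lemma monotone_cover (hP : IsKernel P) (v : List A) : Monotone (cover P w v) :=
  monotone_nat_of_le_succ fun k => (summable_alphaAt hP v k).tsum_le_tsum
    (fun a => alphaAt_le_succ hP v k a) (summable_alphaAt hP v (k + 1))

lemma cover_le_one (hP : IsKernel P) (v : List A) (k : ℕ) : cover P w v k ≤ 1 := by
  cases k <;> exact tsum_lowerProb_le_one hP _

lemma intervalI_subset_Ico (hP : IsKernel P) (a : A) :
    intervalI e P a ⊆ Set.Ico 0 (threshold P w 0) := by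
  have hsub := glued_subset_Ico (e := e) 0 (summable_lowerProb hP [])
    (fun b => lowerProb_nonneg hP b []) a
  rwa [zero_add] at hsub

lemma intervalIw_subset_Ico (hP : IsKernel P) (v : List A) (a : A) (k : ℕ) :
    intervalIw e P w v a k ⊆ Set.Ico (cover P w v k) (cover P w v (k + 1)) := by
  rw [← cover_add_tsum_layer hP]
  exact glued_subset_Ico _ (summable_layer hP v k) (layer_nonneg hP v k) a

lemma exists_mem_intervalI (hP : IsKernel P) {u : ℝ} (hu : u ∈ Set.Ico 0 (threshold P w 0)) :
    ∃ a, u ∈ intervalI e P a :=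
  exists_mem_glued (summable_lowerProb hP []) (fun b => lowerProb_nonneg hP b [])
    (by rwa [zero_add])

lemma exists_mem_intervalIw (hP : IsKernel P) {v : List A} {k : ℕ} {u : ℝ}
    (hu : u ∈ Set.Ico (cover P w v k) (cover P w v (k + 1))) : ∃ a, u ∈ intervalIw e P w v a k :=
  exists_mem_glued (summable_layer hP v k) (layer_nonneg hP v k)
    (by rwa [← cover_add_tsum_layer hP] at hu)

/-! ### Determination of a symbol -/

lemma notMem_Ico_threshold_of_mem_intervalI (hP : IsKernel P) {u : ℝ} {a : A}
    (hu : u ∈ intervalI e P a) (l : ℕ) :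
    u ∉ Set.Ico (threshold P w l) (threshold P w (l + 1)) := fun hl =>
  ((intervalI_subset_Ico hP a hu).2.trans_le
    ((monotone_threshold hP l.zero_le).trans hl.1)).false

lemma eq_of_mem_intervalIw (hP : IsKernel P) {u : ℝ} {v : List A} {a b : A} {k j : ℕ}
    (hk : u ∈ intervalIw e P w v a k) (hj : u ∈ intervalIw e P w v b j) : a = b := by
  obtain rfl : k = j := by
    by_contra hne
    exact Set.disjoint_left.1 ((monotone_cover hP v).pairwise_disjoint_on_Ico_succ hne)
      (intervalIw_subset_Ico hP v a k hk) (intervalIw_subset_Ico hP v b j hj)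
  exact eq_of_mem_glued (summable_layer hP v k) (layer_nonneg hP v k) hk hj

lemma Determines.unique (hP : IsKernel P) {u : ℝ} {v : List A} {a b : A}
    (ha : Determines e P w u v a) (hb : Determines e P w u v b) : a = b := by
  rcases ha with ha | ⟨l, hl, -, k, -, hk⟩ <;> rcases hb with hb | ⟨l', hl', -, k', -, hk'⟩
  · exact eq_of_mem_glued (summable_lowerProb hP []) (fun b => lowerProb_nonneg hP b []) ha hb
  · exact absurd hl' (notMem_Ico_threshold_of_mem_intervalI hP ha l')
  · exact absurd hl (notMem_Ico_threshold_of_mem_intervalI hP hb l)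
  · exact eq_of_mem_intervalIw hP hk hk'

lemma exists_determines_of_lt_threshold_zero (hP : IsKernel P) {u : ℝ} (h0 : 0 ≤ u)
    (h : u < threshold P w 0) (v : List A) : ∃ a, Determines e P w u v a := by
  obtain ⟨a, ha⟩ := exists_mem_intervalI (e := e) (w := w) hP ⟨h0, h⟩
  exact ⟨a, Or.inl ha⟩

lemma exists_determines (hP : IsKernel P) {u : ℝ} (h0 : 0 ≤ u) {v : List A}
    {m l : ℕ} (hm : distOcc w v = m) (hl : m + w.length + l ≤ v.length)
    (h : u < threshold P w (l + 1)) : ∃ a, Determines e P w u v a := by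
  rcases lt_or_ge u (threshold P w 0) with hu | hu
  · exact exists_determines_of_lt_threshold_zero hP h0 hu v
  obtain ⟨l', hl', hmem⟩ := exists_mem_Ico_succ hu h
  have hlt : u < cover P w v (l' + 1) := hmem.2.trans_le (threshold_le_cover hP hm (by lia))
  obtain ⟨k, hk, hmem'⟩ := exists_mem_Ico_succ (f := cover P w v) hu hlt
  obtain ⟨a, ha⟩ := exists_mem_intervalIw (e := e) hP hmem'
  refine ⟨a, Or.inr ⟨l', hmem, ?_, k, Nat.le_of_lt_succ hk, ha⟩⟩
  rw [hm]
  exact_mod_cast (by lia : m + w.length + l' ≤ v.length)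

lemma Determines.mem_Ico_of_nil (hP : IsKernel P) {u : ℝ} {a : A}
    (h : Determines e P w u [] a) : u ∈ Set.Ico 0 (threshold P w 0) := by
  rcases h with h | ⟨l, hl, -, k, -, hu⟩
  · exact intervalI_subset_Ico hP a h
  · have hcover : cover P w [] (k + 1) = threshold P w 0 := by
      simp only [cover, alphaAt, threshold, List.take_nil]
    have hlt := (intervalIw_subset_Ico hP [] a k hu).2
    rw [hcover] at hlt
    exact absurd ((monotone_threshold hP l.zero_le).trans hl.1) hlt.not_ge

lemma update_eq_some_iff (hP : IsKernel P) {u : ℝ} {v : List A} {a : A} :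
    update e P w u v = some a ↔ Determines e P w u v a := by
  unfold update
  refine ⟨fun h => ?_, fun h => ?_⟩
  · split_ifs at h with hex
    rw [← Option.some.inj h]
    exact hex.choose_spec
  · rw [dif_pos ⟨a, h⟩]
    exact congrArg some (Determines.unique hP (Exists.choose_spec ⟨a, h⟩) h)

lemma update_ne_none_iff (hP : IsKernel P) {u : ℝ} {v : List A} :
    update e P w u v ≠ none ↔ ∃ a, Determines e P w u v a := by
  simp only [Option.ne_none_iff_exists', update_eq_some_iff hP]

end Layers

section Pasts

variable {e : A ↪ ℕ} {P : A → (ℕ → A) → ℝ} {w : List A}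

/-! ### Pasts -/

/-- The string of the `n` most recent symbols of a past. -/
def pre (z : ℕ → A) (n : ℕ) : List A := (List.range n).map z

/-- The past obtained from `z` when the symbol `a` comes next. -/
def extend (a : A) (z : ℕ → A) : ℕ → A := fun n => Nat.casesOn n a z

lemma measurable_extend [MeasurableSpace A] : Measurable fun p : A × (ℕ → A) => extend p.1 p.2 := by
  refine measurable_pi_lambda _ fun n => ?_
  cases n with
  | zero => exact measurable_fst
  | succ n => exact (measurable_pi_apply n).comp measurable_snd

@[simp] lemma length_pre (z : ℕ → A) (n : ℕ) : (pre z n).length = n := by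
  rw [pre, List.length_map, List.length_range]

@[simp] lemma pre_zero (z : ℕ → A) : pre z 0 = [] := rfl

lemma pre_succ (z : ℕ → A) (n : ℕ) : pre z (n + 1) = pre z n ++ [z n] := by
  rw [pre, List.range_succ, List.map_append]; rfl

lemma pre_succ_eq_cons (z : ℕ → A) (n : ℕ) :
    pre z (n + 1) = z 0 :: pre (fun k => z (k + 1)) n := by
  rw [pre, List.range_succ_eq_map, List.map_cons, List.map_map]; rfl

lemma pre_extend_succ (a : A) (z : ℕ → A) (n : ℕ) : pre (extend a z) (n + 1) = a :: pre z n :=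
  pre_succ_eq_cons _ _

lemma pre_add (z : ℕ → A) (n k : ℕ) : pre z (n + k) = pre z n ++ pre (fun j => z (j + n)) k := by
  induction k with
  | zero => rw [add_zero, pre_zero, List.append_nil]
  | succ k ih => rw [← add_assoc, pre_succ, ih, pre_succ, List.append_assoc, add_comm n k]

lemma pre_isPrefix (z : ℕ → A) {n k : ℕ} (h : n ≤ k) : pre z n <+: pre z k := by
  obtain ⟨j, rfl⟩ := Nat.exists_eq_add_of_le h
  rw [pre_add]; exact List.prefix_append _ _

lemma take_pre (z : ℕ → A) {n k : ℕ} (h : k ≤ n) : (pre z n).take k = pre z k := by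
  obtain ⟨j, rfl⟩ := Nat.exists_eq_add_of_le h
  rw [pre_add, List.take_left' (length_pre _ _)]

lemma drop_pre (z : ℕ → A) {n k : ℕ} (h : k ≤ n) :
    (pre z n).drop k = pre (fun j => z (j + k)) (n - k) := by
  obtain ⟨j, rfl⟩ := Nat.exists_eq_add_of_le h
  rw [pre_add, List.drop_left' (length_pre _ _), Nat.add_sub_cancel_left]

lemma isPrefix_pre_iff {z : ℕ → A} {n : ℕ} (h : w.length ≤ n) :
    w <+: pre z n ↔ pre z w.length = w := by
  rw [List.prefix_iff_eq_take, take_pre z h, eq_comm]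

lemma concat_pre (z : ℕ → A) (n : ℕ) : concat (pre z n) (fun j => z (j + n)) = z := by
  ext k
  simp only [concat, length_pre]
  rcases lt_or_ge k n with h | h
  · rw [List.getD_eq_getElem _ _ (by rwa [length_pre])]
    simp only [pre, List.getElem_map, List.getElem_range]
  · rw [List.getD_eq_default _ _ (by rwa [length_pre]), Nat.sub_add_cancel h]

lemma lowerProb_pre_le (hP : IsKernel P) (a : A) (z : ℕ → A) (n : ℕ) :
    lowerProb P a (pre z n) ≤ P a z := by
  conv_rhs => rw [← concat_pre z n]
  exact lowerProb_le hP _ _ _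

/-- The word `w` occurs in the past `z`. -/
def HasWord (w : List A) (z : ℕ → A) : Prop :=
  ∃ k : ℕ, pre (fun n => z (n + k)) w.length = w

lemma HasWord.of_tail {z : ℕ → A} {k : ℕ} (h : HasWord w fun n => z (n + k)) : HasWord w z := by
  obtain ⟨j, hj⟩ := h
  exact ⟨j + k, by simpa only [add_assoc] using hj⟩

lemma HasWord.exists_distOcc_pre_eq {z : ℕ → A} (hz : HasWord w z) :
    ∃ m : ℕ, distOcc w (pre z (m + w.length)) = m := by
  classical
  refine ⟨Nat.find hz, distOcc_eq_coe_iff.2 ⟨?_, fun k hk hw => Nat.find_min hz hk ?_⟩⟩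
  · rw [drop_pre z (Nat.le_add_right _ _), Nat.add_sub_cancel_left, isPrefix_pre_iff le_rfl]
    exact Nat.find_spec hz
  · rwa [drop_pre z (by lia), isPrefix_pre_iff (by lia)] at hw

lemma distOcc_pre {z : ℕ → A} {m n : ℕ} (hm : distOcc w (pre z (m + w.length)) = m)
    (hn : m + w.length ≤ n) : distOcc w (pre z n) = m := by
  obtain ⟨t, ht⟩ := pre_isPrefix z hn
  rw [← ht]
  exact distOcc_append hm (length_pre _ _).ge t

/-- The values of `u` with which the past `z` produces the symbol `a`. -/
def hitSet (e : A ↪ ℕ) (P : A → (ℕ → A) → ℝ) (w : List A) (z : ℕ → A) (a : A) : Set ℝ :=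
  {u | ∃ n, Determines e P w u (pre z n) a}

/-- The symbol that comes after the past `z`, when the uniform variable is `u`; it is arbitrary
if `u` and `z` determine no symbol. -/
noncomputable def nextSymbol [Nonempty A] (e : A ↪ ℕ) (P : A → (ℕ → A) → ℝ) (w : List A)
    (z : ℕ → A) (u : ℝ) : A :=
  Classical.epsilon fun a => u ∈ hitSet e P w z a

lemma measurableSet_hitSet (z : ℕ → A) (a : A) : MeasurableSet (hitSet e P w z a) := by
  simp only [hitSet, Set.ofPred_exists]
  exact .iUnion fun n => measurableSet_determines _ _

lemma eq_of_mem_hitSet [Nonempty A] (hP : IsKernel P) {z : ℕ → A} {u : ℝ} {a b : A}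
    (ha : u ∈ hitSet e P w z a) (hb : u ∈ hitSet e P w z b) : a = b := by
  obtain ⟨n, hn⟩ := ha
  obtain ⟨k, hk⟩ := hb
  exact Determines.unique hP (hn.of_isPrefix (pre_isPrefix z (le_max_left n k)))
    (hk.of_isPrefix (pre_isPrefix z (le_max_right n k)))

lemma nextSymbol_eq [Nonempty A] (hP : IsKernel P) {z : ℕ → A} {u : ℝ} {a : A}
    (ha : u ∈ hitSet e P w z a) : nextSymbol e P w z u = a :=
  eq_of_mem_hitSet hP
    (Classical.epsilon_spec (p := fun b => u ∈ hitSet e P w z b) ⟨a, ha⟩) ha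

/-! ### The update function has the law of the kernel -/

/-- The union of `I(a)` and of the intervals of `a` in the layers `0, …, k - 1` above `v`. -/
def layerUnion (e : A ↪ ℕ) (P : A → (ℕ → A) → ℝ) (w v : List A) (a : A) : ℕ → Set ℝ
  | 0 => intervalI e P a
  | k + 1 => layerUnion e P w v a k ∪ intervalIw e P w v a k

lemma mem_layerUnion_iff {v : List A} {a : A} {k : ℕ} {u : ℝ} :
    u ∈ layerUnion e P w v a k ↔ u ∈ intervalI e P a ∨ ∃ j < k, u ∈ intervalIw e P w v a j := by
  induction k with
  | zero => simp only [layerUnion, Nat.not_lt_zero, false_and, exists_false, or_false]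
  | succ k ih =>
    rw [layerUnion, Set.mem_union, ih, or_assoc, Nat.exists_lt_succ_right]

lemma layerUnion_subset_Ico [Nonempty A] (hP : IsKernel P) (v : List A) (a : A) (k : ℕ) :
    layerUnion e P w v a k ⊆ Set.Ico 0 (cover P w v k) := by
  induction k with
  | zero => exact intervalI_subset_Ico (w := w) hP a
  | succ k ih =>
    have hcover : 0 ≤ cover P w v k :=
      (tsum_lowerProb_nonneg hP []).trans (monotone_cover hP v k.zero_le)
    exact Set.union_subset
      (ih.trans (Set.Ico_subset_Ico_right (monotone_cover hP v k.le_succ)))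
      ((intervalIw_subset_Ico hP v a k).trans (Set.Ico_subset_Ico_left hcover))

lemma volume_layerUnion [Nonempty A] (hP : IsKernel P) (v : List A) (a : A) (k : ℕ) :
    volume (layerUnion e P w v a k) = ENNReal.ofReal (alphaAt P w v k a) := by
  induction k with
  | zero => exact volume_glued _ _ _
  | succ k ih =>
    have hdisj : Disjoint (layerUnion e P w v a k) (intervalIw e P w v a k) :=
      Set.disjoint_left.2 fun u hu hu' =>
        ((layerUnion_subset_Ico hP v a k hu).2.trans_le
          (intervalIw_subset_Ico hP v a k hu').1).false
    have hnonneg : 0 ≤ alphaAt P w v k a := by cases k <;> exact lowerProb_nonneg hP _ _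
    rw [layerUnion, measure_union hdisj measurableSet_Ico, ih, intervalIw, volume_glued,
      ← ENNReal.ofReal_add hnonneg (layer_nonneg hP _ _ _), add_sub_cancel]

lemma alphaAt_pre_succ {z : ℕ → A} {m k n : ℕ} (hm : distOcc w (pre z (m + w.length)) = m)
    (hn : m + w.length + k ≤ n) (a : A) :
    alphaAt P w (pre z n) (k + 1) a = lowerProb P a (pre z (m + w.length + k)) := by
  rw [alphaAt, distOcc_pre hm (by lia), ENat.toNat_natCast, take_pre z hn]

lemma intervalIw_pre_congr {z : ℕ → A} {m k n n' : ℕ}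
    (hm : distOcc w (pre z (m + w.length)) = m) (hn : m + w.length + k ≤ n)
    (hn' : m + w.length + k ≤ n') (a : A) :
    intervalIw e P w (pre z n) a k = intervalIw e P w (pre z n') a k := by
  refine intervalIw_congr (fun j hj => funext fun b => ?_) a
  cases j with
  | zero => rfl
  | succ j => rw [alphaAt_pre_succ hm (by lia), alphaAt_pre_succ hm (by lia)]

lemma layerUnion_pre_subset_hitSet [Nonempty A] (hP : IsKernel P)
    (hsum : Summable fun k : ℕ => 1 - alphaW P w k) {z : ℕ → A} {m : ℕ}
    (hm : distOcc w (pre z (m + w.length)) = m) (a : A) (k : ℕ) :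
    layerUnion e P w (pre z (m + w.length + k)) a (k + 1) ⊆ hitSet e P w z a := by
  intro u hu
  rcases mem_layerUnion_iff.1 hu with hu | ⟨j, hj, hu⟩
  · exact ⟨0, Or.inl hu⟩
  have hcover := intervalIw_subset_Ico hP _ a j hu
  obtain ⟨l, hl⟩ := exists_mem_Ico_threshold hsum
    ((monotone_cover hP _ j.zero_le).trans hcover.1) (hcover.2.trans_le (cover_le_one hP _ _))
  have hjl : j ≤ l := by
    by_contra! hlj
    have hle : threshold P w (l + 1) ≤ cover P w (pre z (m + w.length + k)) (l + 1) :=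
      threshold_le_cover hP (distOcc_pre hm (by lia)) (by rw [length_pre]; lia)
    exact (hl.2.trans_le (hle.trans ((monotone_cover hP _ hlj).trans hcover.1))).false
  refine ⟨m + w.length + l, Or.inr ⟨l, hl, ?_, j, hjl, ?_⟩⟩
  · rw [distOcc_pre hm (by lia), length_pre]
    exact_mod_cast le_rfl
  · rwa [intervalIw_pre_congr hm (by lia) (n' := m + w.length + k) (by lia)]

lemma ofReal_lowerProb_pre_le_unif_hitSet [Nonempty A] (hP : IsKernel P)
    (hsum : Summable fun k : ℕ => 1 - alphaW P w k) {z : ℕ → A} {m : ℕ}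
    (hm : distOcc w (pre z (m + w.length)) = m) (a : A) (k : ℕ) :
    ENNReal.ofReal (lowerProb P a (pre z (m + w.length + k))) ≤ unif (hitSet e P w z a) := by
  rw [← alphaAt_pre_succ hm le_rfl, ← volume_layerUnion (e := e) hP,
    ← Measure.restrict_eq_self volume ((layerUnion_subset_Ico hP _ a _).trans
      (Set.Ico_subset_Ico_right (cover_le_one hP _ _)))]
  exact measure_mono (layerUnion_pre_subset_hitSet hP hsum hm a k)

lemma tendsto_of_le_of_tendsto_tsum {ι : Type*} {p : ℕ → ι → ℝ} {f : ι → ℝ} {c : ℝ}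
    (hp : ∀ k, Summable (p k)) (hf : Summable f) (hfc : ∑' i, f i ≤ c) (hpf : ∀ k i, p k i ≤ f i)
    (hlim : Filter.Tendsto (fun k => ∑' i, p k i) Filter.atTop (nhds c)) (i : ι) :
    Filter.Tendsto (fun k => p k i) Filter.atTop (nhds (f i)) := by
  have hgap : ∀ k, f i - (c - ∑' i, p k i) ≤ p k i := by
    intro k
    have hle := (hf.sub (hp k)).le_tsum i fun j _ => sub_nonneg.2 (hpf k j)
    rw [hf.tsum_sub (hp k)] at hle
    linarith
  have hlim' : Filter.Tendsto (fun k => f i - (c - ∑' i, p k i)) Filter.atTop (nhds (f i)) := by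
    simpa only [sub_self, sub_zero] using (hlim.const_sub c).const_sub (f i)
  exact tendsto_of_tendsto_of_tendsto_of_le_of_le hlim' tendsto_const_nhds hgap fun k => hpf k i

lemma tendsto_tsum_lowerProb_pre [Nonempty A] (hP : IsKernel P)
    (hsum : Summable fun k : ℕ => 1 - alphaW P w k) {z : ℕ → A} {m : ℕ}
    (hm : distOcc w (pre z (m + w.length)) = m) :
    Filter.Tendsto (fun k => ∑' a, lowerProb P a (pre z (m + w.length + k))) Filter.atTop
      (nhds 1) := by
  refine tendsto_of_tendsto_of_tendsto_of_le_of_le (tendsto_alphaW hsum) tendsto_const_nhds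
    (fun k => ?_) fun k => tsum_lowerProb_le_one hP _
  have hle := alphaW_le_tsum_lowerProb_take (P := P) (k := k) hP
    (distOcc_pre hm (Nat.le_add_right _ k)) (length_pre _ _).ge
  rwa [take_pre z le_rfl] at hle

variable [Countable A]

lemma tsum_unif_hitSet [Nonempty A] (hP : IsKernel P) (z : ℕ → A) :
    ∑' a, unif (hitSet e P w z a) = unif (⋃ a, hitSet e P w z a) :=
  (measure_iUnion
    (fun _ _ hbc => Set.disjoint_left.2 fun _ hb hc => hbc (eq_of_mem_hitSet hP hb hc))
    fun a => measurableSet_hitSet z a).symm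

lemma unif_hitSet [Nonempty A] (hP : IsKernel P)
    (hsum : Summable fun k : ℕ => 1 - alphaW P w k) {z : ℕ → A} (hz : HasWord w z) (a : A) :
    unif (hitSet e P w z a) = ENNReal.ofReal (P a z) := by
  obtain ⟨m, hm⟩ := hz.exists_distOcc_pre_eq
  have htop : ∑' b, unif (hitSet e P w z b) ≠ ∞ := by
    rw [tsum_unif_hitSet hP]
    exact measure_ne_top _ _
  have hone : ∑' b, (unif (hitSet e P w z b)).toReal ≤ 1 := by
    rw [← ENNReal.tsum_toReal_eq fun b => measure_ne_top _ _, tsum_unif_hitSet hP]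
    exact measureReal_le_one
  have hlow : ∀ k b, lowerProb P b (pre z (m + w.length + k)) ≤ (unif (hitSet e P w z b)).toReal :=
    fun k b => (ENNReal.ofReal_le_iff_le_toReal (measure_ne_top _ _)).1
      (ofReal_lowerProb_pre_le_unif_hitSet hP hsum hm b k)
  have hlimit := tendsto_tsum_lowerProb_pre hP hsum hm
  have hP_limit := tendsto_of_le_of_tendsto_tsum (fun k => summable_lowerProb hP _)
    (hP.hasSum_one z).summable (hP.hasSum_one z).tsum_eq.le
    (fun k b => lowerProb_pre_le hP b z _) hlimit a
  have hunif_limit := tendsto_of_le_of_tendsto_tsum (fun k => summable_lowerProb hP _)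
    (ENNReal.summable_toReal htop) hone hlow hlimit a
  rw [tendsto_nhds_unique hP_limit hunif_limit, ENNReal.ofReal_toReal (measure_ne_top _ _)]

lemma ae_exists_mem_hitSet [Nonempty A] (hP : IsKernel P)
    (hsum : Summable fun k : ℕ => 1 - alphaW P w k) {z : ℕ → A} (hz : HasWord w z) :
    ∀ᵐ u ∂unif, ∃ a, u ∈ hitSet e P w z a := by
  have hone : unif (⋃ a, hitSet e P w z a) = 1 := by
    simp_rw [← tsum_unif_hitSet hP, unif_hitSet hP hsum hz]
    rw [← ENNReal.ofReal_tsum_of_nonneg (fun a => hP.nonneg a z) (hP.hasSum_one z).summable,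
      (hP.hasSum_one z).tsum_eq, ENNReal.ofReal_one]
  have hae := (mem_ae_iff_prob_eq_one (.iUnion fun a => measurableSet_hitSet z a)).2 hone
  filter_upwards [hae] with u hu using Set.mem_iUnion.1 hu

lemma unif_nextSymbol_eq [Nonempty A] (hP : IsKernel P)
    (hsum : Summable fun k : ℕ => 1 - alphaW P w k) {z : ℕ → A} (hz : HasWord w z) (a : A) :
    unif {u | nextSymbol e P w z u = a} = ENNReal.ofReal (P a z) := by
  rw [← unif_hitSet (e := e) hP hsum hz a]
  refine measure_congr ?_
  filter_upwards [ae_exists_mem_hitSet (e := e) hP hsum hz] with u ⟨b, hb⟩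
  refine propext ⟨fun (h : nextSymbol e P w z u = a) => ?_, fun h => nextSymbol_eq hP h⟩
  rw [nextSymbol_eq hP hb] at h
  exact h ▸ hb

/-! ### Measurability of the next symbol -/

variable [MeasurableSpace A]

lemma measurable_epsilon [Nonempty A] {Ω : Type*} [MeasurableSpace Ω] {R : Ω → A → Prop}
    (hR : ∀ a, MeasurableSet {x | R x a}) (huniq : ∀ x a b, R x a → R x b → a = b) :
    Measurable fun x => Classical.epsilon (R x) := by
  refine measurable_to_countable' fun a => ?_
  have hpreimage : (fun x => Classical.epsilon (R x)) ⁻¹' {a} =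
      {x | R x a} ∪ ({x | ∃ b, R x b}ᶜ ∩ {_x | Classical.epsilon (fun _ : A => False) = a}) := by
    ext x
    by_cases hx : ∃ b, R x b
    · have hspec := Classical.epsilon_spec hx
      have hiff : Classical.epsilon (R x) = a ↔ R x a :=
        ⟨fun h => h ▸ hspec, fun h => huniq x _ _ hspec h⟩
      simp [hiff, hx]
    · have hfalse : R x = fun _ => False := funext fun b => eq_false fun hb => hx ⟨b, hb⟩
      simp [hfalse]
  rw [hpreimage]
  have hexists : MeasurableSet {x | ∃ b, R x b} := by
    simp only [Set.ofPred_exists]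
    exact .iUnion hR
  exact (hR a).union (hexists.compl.inter (MeasurableSet.const _))

variable [DiscreteMeasurableSpace A]

instance : DiscreteMeasurableSpace (List A) := ⟨fun _ => trivial⟩

lemma measurable_pre (n : ℕ) : Measurable fun z : ℕ → A => pre z n := by
  induction n with
  | zero => exact measurable_const
  | succ n ih =>
    simp only [pre_succ]
    exact (Measurable.of_discrete (f := fun p : List A × A => p.1 ++ [p.2])).comp
      (ih.prodMk (measurable_pi_apply n))

lemma measurableSet_mem_hitSet (a : A) :
    MeasurableSet {p : (ℕ → A) × ℝ | p.2 ∈ hitSet e P w p.1 a} := by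
  have hunion : {p : (ℕ → A) × ℝ | p.2 ∈ hitSet e P w p.1 a} =
      ⋃ n : ℕ, ⋃ v : List A, {z : ℕ → A | pre z n = v} ×ˢ {u | Determines e P w u v a} := by
    ext ⟨z, u⟩; simp [hitSet]
  rw [hunion]
  exact .iUnion fun n => .iUnion fun v =>
    ((measurable_pre n) (measurableSet_singleton v)).prod (measurableSet_determines _ _)

lemma measurable_nextSymbol [Nonempty A] (hP : IsKernel P) :
    Measurable fun p : (ℕ → A) × ℝ => nextSymbol e P w p.1 p.2 :=
  measurable_epsilon measurableSet_mem_hitSet fun _ _ _ => eq_of_mem_hitSet hP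

lemma measurableSet_hasWord : MeasurableSet {z : ℕ → A | HasWord w z} := by
  simp only [HasWord, Set.ofPred_exists]
  exact .iUnion fun k => ((measurable_pre w.length).comp
    (measurable_pi_lambda _ fun n => measurable_pi_apply (n + k))) (measurableSet_singleton w)

end Pasts

section Construction

variable {e : A ↪ ℕ} {P : A → (ℕ → A) → ℝ} {w : List A}

/-! ### The construction from a given time on -/

/-- The past of time `t`. -/
def pastAt (x : ℤ → A) (t : ℤ) : ℕ → A := fun n => x (t - 1 - n)

/-- The shift of a two-sided sequence by `k`. -/
def shift {S : Type*} (k : ℤ) (x : ℤ → S) : ℤ → S := fun i => x (i + k)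

lemma pastAt_add_one (x : ℤ → A) (t : ℤ) : pastAt x (t + 1) = extend (x t) (pastAt x t) := by
  funext n
  cases n with
  | zero => exact congrArg x (by rw [Nat.cast_zero, sub_zero, add_sub_cancel_right])
  | succ n => exact congrArg x (by push_cast; ring)

lemma pre_pastAt_succ (x : ℤ → A) (t : ℤ) (n : ℕ) :
    pre (pastAt x (t + 1)) (n + 1) = x t :: pre (pastAt x t) n := by
  rw [pastAt_add_one, pre_extend_succ]

/-- The string constructed at the `n` sites from `s` on, when nothing is known before `s`;
`none` if the construction gets stuck. -/
noncomputable def run (e : A ↪ ℕ) (P : A → (ℕ → A) → ℝ) (w : List A) (U : ℤ → ℝ) (s : ℤ) :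
    ℕ → Option (List A)
  | 0 => some []
  | n + 1 => (run e P w U s n).bind fun v => (update e P w (U (s + n)) v).map fun a => a :: v

@[simp] lemma run_zero (U : ℤ → ℝ) (s : ℤ) : run e P w U s 0 = some [] := rfl

lemma run_ne_none_of_le {U : ℤ → ℝ} {s : ℤ} {n k : ℕ} (hnk : n ≤ k)
    (hk : run e P w U s k ≠ none) : run e P w U s n ≠ none := by
  induction hnk with
  | refl => exact hk
  | step _ ih => exact ih fun hnone => hk (by rw [run, hnone]; rfl)

lemma run_congr {U U' : ℤ → ℝ} {s : ℤ} {n : ℕ} (h : ∀ i ∈ Set.Ico s (s + n), U i = U' i) :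
    run e P w U s n = run e P w U' s n := by
  induction n with
  | zero => rfl
  | succ n ih =>
    rw [run, run, ih fun i hi => h i ⟨hi.1, hi.2.trans (by lia)⟩, h (s + n) ⟨by lia, by lia⟩]

lemma run_shift (U : ℤ → ℝ) (s k : ℤ) (n : ℕ) :
    run e P w (shift k U) s n = run e P w U (s + k) n := by
  induction n with
  | zero => rfl
  | succ n ih =>
    rw [run, run, ih]
    simp only [shift, add_right_comm s (n : ℤ) k]

/-- The construction that starts at `s` never gets stuck. -/
def IsRegeneration (e : A ↪ ℕ) (P : A → (ℕ → A) → ℝ) (w : List A) (U : ℤ → ℝ) (s : ℤ) : Prop :=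
  ∀ n, run e P w U s n ≠ none

lemma isRegeneration_congr {U U' : ℤ → ℝ} {s : ℤ} (h : ∀ i ∈ Set.Ici s, U i = U' i) :
    IsRegeneration e P w U s ↔ IsRegeneration e P w U' s :=
  forall_congr' fun _ => by rw [run_congr fun i hi => h i hi.1]

lemma isRegeneration_shift (U : ℤ → ℝ) (s k : ℤ) :
    IsRegeneration e P w (shift k U) s ↔ IsRegeneration e P w U (s + k) :=
  forall_congr' fun _ => by rw [run_shift]

/-- The symbol `a` is constructed at the site `j` when the construction starts at a suitable
earlier site. -/
def Constructs (e : A ↪ ℕ) (P : A → (ℕ → A) → ℝ) (w : List A) (U : ℤ → ℝ) (j : ℤ) (a : A) : Prop :=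
  ∃ (n : ℕ) (v : List A), run e P w U (j - n) (n + 1) = some (a :: v)

lemma constructs_shift (U : ℤ → ℝ) (j k : ℤ) (a : A) :
    Constructs e P w (shift k U) j a ↔ Constructs e P w U (j + k) a := by
  simp only [Constructs, run_shift, sub_add_eq_add_sub]

lemma constructs_congr {U U' : ℤ → ℝ} {j : ℤ} (h : ∀ i ≤ j, U i = U' i) (a : A) :
    Constructs e P w U j a ↔ Constructs e P w U' j a := by
  refine exists_congr fun n => exists_congr fun v => ?_
  rw [run_congr fun i hi => h i (by have := hi.2; lia)]

variable [Nonempty A]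

/-- The symbol that is constructed at the site `j`; it is arbitrary if the construction gets stuck
there from every earlier site. -/
noncomputable def chain (e : A ↪ ℕ) (P : A → (ℕ → A) → ℝ) (w : List A)
    (U : ℤ → ℝ) (j : ℤ) : A :=
  Classical.epsilon (Constructs e P w U j)

lemma chain_shift (U : ℤ → ℝ) (k : ℤ) :
    chain e P w (shift k U) = shift k (chain e P w U) :=
  funext fun j => congrArg Classical.epsilon (funext fun a => propext (constructs_shift U j k a))

lemma chain_congr {U U' : ℤ → ℝ} {j : ℤ} (h : ∀ i ≤ j, U i = U' i) :
    chain e P w U j = chain e P w U' j :=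
  congrArg Classical.epsilon (funext fun a => propext (constructs_congr h a))

lemma run_succ_eq_some_iff (hP : IsKernel P) {U : ℤ → ℝ} {s : ℤ} {n : ℕ} {V : List A} :
    run e P w U s (n + 1) = some V ↔
      ∃ v a, run e P w U s n = some v ∧ Determines e P w (U (s + n)) v a ∧ V = a :: v := by
  simp only [run, Option.bind_eq_some_iff, Option.map_eq_some_iff, update_eq_some_iff hP]
  constructor
  · rintro ⟨v, hv, a, ha, rfl⟩; exact ⟨v, a, hv, ha, rfl⟩
  · rintro ⟨v, a, hv, ha, rfl⟩; exact ⟨v, hv, a, ha, rfl⟩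

lemma length_of_run_eq_some (hP : IsKernel P) {U : ℤ → ℝ} {s : ℤ} {n : ℕ} {v : List A}
    (h : run e P w U s n = some v) : v.length = n := by
  induction n generalizing v with
  | zero => rw [← Option.some.inj h, List.length_nil]
  | succ n ih =>
    obtain ⟨v', a, hv', -, rfl⟩ := (run_succ_eq_some_iff hP).1 h
    rw [List.length_cons, ih hv']

lemma run_append (hP : IsKernel P) {U : ℤ → ℝ} {s : ℤ} {n k : ℕ} {v v' : List A}
    (h : run e P w U s n = some v) (h' : run e P w U (s + n) k = some v') :
    run e P w U s (n + k) = some (v' ++ v) := by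
  induction k generalizing v' with
  | zero => rw [← Option.some.inj h', List.nil_append, add_zero, h]
  | succ k ih =>
    obtain ⟨v'', a, hv'', ha, rfl⟩ := (run_succ_eq_some_iff hP).1 h'
    refine (run_succ_eq_some_iff hP).2 ⟨v'' ++ v, a, ih hv'', ?_, rfl⟩
    rw [Nat.add_eq, Nat.cast_add, ← add_assoc]
    exact ha.of_isPrefix (List.prefix_append _ _)

lemma IsRegeneration.of_run_ne_none (hP : IsKernel P) {U : ℤ → ℝ} {s : ℤ} {n : ℕ}
    (h : IsRegeneration e P w U (s + n)) (hn : run e P w U s n ≠ none) :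
    IsRegeneration e P w U s := by
  intro k
  rcases le_total k n with hk | hk
  · exact run_ne_none_of_le hk hn
  · obtain ⟨j, rfl⟩ := Nat.exists_eq_add_of_le hk
    obtain ⟨v, hv⟩ := Option.ne_none_iff_exists'.1 hn
    obtain ⟨v', hv'⟩ := Option.ne_none_iff_exists'.1 (h j)
    exact Option.ne_none_iff_exists'.2 ⟨_, run_append hP hv hv'⟩

lemma Constructs.unique (hP : IsKernel P) {U : ℤ → ℝ} {j : ℤ} {a b : A}
    (ha : Constructs e P w U j a) (hb : Constructs e P w U j b) : a = b := by
  obtain ⟨n, v, hv⟩ := ha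
  obtain ⟨k, v', hv'⟩ := hb
  wlog hnk : n ≤ k generalizing a b n k v v'
  · exact (this k v' hv' n v hv (le_of_not_ge hnk)).symm
  obtain ⟨i, rfl⟩ := Nat.exists_eq_add_of_le' hnk
  rw [add_assoc] at hv'
  obtain ⟨v'', hv''⟩ := Option.ne_none_iff_exists'.1
    (run_ne_none_of_le (Nat.le_add_right i (n + 1)) (Option.ne_none_iff_exists'.2 ⟨_, hv'⟩))
  have hstart : j - ((i + n : ℕ) : ℤ) + i = j - n := by push_cast; ring
  rw [run_append hP hv'' (by rw [hstart]; exact hv), Option.some_inj, List.cons_append] at hv'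
  exact (List.cons.inj hv').1

lemma chain_eq (hP : IsKernel P) {U : ℤ → ℝ} {j : ℤ} {a : A}
    (h : Constructs e P w U j a) : chain e P w U j = a :=
  Constructs.unique hP (Classical.epsilon_spec ⟨a, h⟩) h

lemma run_eq_pre (hP : IsKernel P) {U : ℤ → ℝ} {s : ℤ} {n : ℕ} (h : run e P w U s n ≠ none) :
    run e P w U s n = some (pre (pastAt (chain e P w U) (s + n)) n) := by
  induction n with
  | zero => rfl
  | succ n ih =>
    obtain ⟨V, hV⟩ := Option.ne_none_iff_exists'.1 h
    obtain ⟨v, a, hv, -, rfl⟩ := (run_succ_eq_some_iff hP).1 hV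
    have hpre := ih (run_ne_none_of_le n.le_succ h)
    rw [hv, Option.some_inj] at hpre
    have hchain : chain e P w U (s + n) = a :=
      chain_eq hP ⟨n, v, by rw [add_sub_cancel_right]; exact hV⟩
    rw [hV, Nat.cast_succ, ← add_assoc, pre_pastAt_succ, hchain, hpre]

lemma determines_of_run_ne_none (hP : IsKernel P) {U : ℤ → ℝ} {s : ℤ} {n : ℕ}
    (h : run e P w U s (n + 1) ≠ none) :
    Determines e P w (U (s + n)) (pre (pastAt (chain e P w U) (s + n)) n)
      (chain e P w U (s + n)) := by
  obtain ⟨v, a, -, ha, hva⟩ := (run_succ_eq_some_iff hP).1 (run_eq_pre hP h)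
  rw [Nat.cast_succ, ← add_assoc, pre_pastAt_succ] at hva
  obtain ⟨hsymbol, hpast⟩ := List.cons.inj hva
  rwa [hsymbol, hpast]

lemma IsRegeneration.determines (hP : IsKernel P) {U : ℤ → ℝ} {s : ℤ}
    (h : IsRegeneration e P w U s) (n : ℕ) :
    Determines e P w (U (s + n)) (pre (pastAt (chain e P w U) (s + n)) n)
      (chain e P w U (s + n)) :=
  determines_of_run_ne_none hP (h (n + 1))

lemma IsRegeneration.mem_hitSet (hP : IsKernel P) {U : ℤ → ℝ} {s t : ℤ}
    (h : IsRegeneration e P w U s) (hst : s ≤ t) :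
    U t ∈ hitSet e P w (pastAt (chain e P w U) t) (chain e P w U t) := by
  obtain ⟨n, rfl⟩ := Int.exists_add_of_le hst
  exact ⟨n, h.determines hP n⟩

end Construction

section Algorithm

variable {e : A ↪ ℕ} {P : A → (ℕ → A) → ℝ} {w : List A}

/-! ### The algorithm stops -/

lemma minB_mem {B : Finset ℤ} (h : B.Nonempty) : minB B ∈ B := by
  rw [minB, ← Finset.coe_min' h]
  exact B.min'_mem h

lemma minB_le {B : Finset ℤ} {j : ℤ} (hj : j ∈ B) : minB B ≤ j := by
  rw [minB, ← Finset.coe_min' ⟨j, hj⟩]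
  exact B.min'_le j hj

/- In `segment` and `block`, whose functions take integers, the list of naturals is coerced by a
monadic bind. -/
lemma bind_range_natCast (n : ℕ) :
    (do let a ← List.range n; pure (a : ℤ)) = (List.range n).map fun a : ℕ => (a : ℤ) := by
  simp [List.map_eq_flatMap]

lemma segment_eq_pre {X : ℤ → Option A} {x : ℤ → A} {i t : ℤ}
    (h : ∀ j ∈ Set.Ico i t, X j = some (x j)) :
    segment X i t = pre (pastAt x t) (t - i).toNat := by
  rw [segment, bind_range_natCast, List.filterMap_map, pre, ← List.filterMap_eq_map]
  refine List.filterMap_congr fun j hj => ?_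
  rw [List.mem_range] at hj
  exact h (t - 1 - (j : ℤ)) ⟨by lia, by lia⟩

/-- The uniform variables all lie in `[0, 1[`, and there are arbitrarily small and arbitrarily large
times `s` such that the construction that starts at `s` never gets stuck. -/
structure IsTypical (e : A ↪ ℕ) (P : A → (ℕ → A) → ℝ) (w : List A) (U : ℤ → ℝ) : Prop where
  mem_Ico : ∀ i, U i ∈ Set.Ico (0 : ℝ) 1
  exists_le : ∀ i, ∃ s ≤ i, IsRegeneration e P w U s
  exists_ge : ∀ i, ∃ s ≥ i, IsRegeneration e P w U s

/-- The algorithm leads from the state `s` to the state `s'`. -/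
def Reaches (e : A ↪ ℕ) (P : A → (ℕ → A) → ℝ) (w : List A) (U : ℤ → ℝ) (m : ℤ)
    (s s' : State A) : Prop :=
  ∃ N : ℕ, (step e P w U m)^[N] s = s'

lemma Reaches.trans {U : ℤ → ℝ} {m : ℤ} {s s' s'' : State A} (h : Reaches e P w U m s s')
    (h' : Reaches e P w U m s' s'') : Reaches e P w U m s s'' := by
  obtain ⟨N, rfl⟩ := h
  obtain ⟨N', rfl⟩ := h'
  exact ⟨N' + N, Function.iterate_add_apply _ _ _ _⟩

lemma reaches_of_step {U : ℤ → ℝ} {m : ℤ} {s s' : State A} (h : step e P w U m s = s') :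
    Reaches e P w U m s s' := ⟨1, h⟩

/-- The loop invariant: `B` contains the sites of `[i, n]` that are still to be constructed, and at
the other sites of `[i, n]` the array `X` agrees with `x`. -/
structure Correct (x : ℤ → A) (i n : ℤ) (B : Finset ℤ) (X : ℤ → Option A) : Prop where
  subset_Icc : B ⊆ Finset.Icc i n
  eq_some : ∀ j ∈ Set.Icc i n, j ∉ B → X j = some (x j)

section Correct

variable {x : ℤ → A} {i n t : ℤ} {B : Finset ℤ} {X : ℤ → Option A}

lemma Correct.insert (hs : Correct x i n B X) (hin : i ≤ n) :
    Correct x (i - 1) n (insert (i - 1) B) X where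
  subset_Icc := Finset.insert_subset (Finset.mem_Icc.2 ⟨le_rfl, by lia⟩)
    (hs.subset_Icc.trans (Finset.Icc_subset_Icc_left (by lia)))
  eq_some j hj hjB := by
    rw [Finset.mem_insert, not_or] at hjB
    have hij := hj.1.lt_of_ne' hjB.1
    exact hs.eq_some j ⟨by lia, hj.2⟩ hjB.2

lemma Correct.erase (hs : Correct x i n B X) (t : ℤ) :
    Correct x i n (B.erase t) (Function.update X t (some (x t))) where
  subset_Icc := (Finset.erase_subset _ _).trans hs.subset_Icc
  eq_some j hj hjB := by
    rcases eq_or_ne j t with rfl | hjt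
    · rw [Function.update_self]
    · rw [Function.update_of_ne hjt]
      exact hs.eq_some j hj fun h => hjB (Finset.mem_erase.2 ⟨hjt, h⟩)

lemma Correct.segment_eq_pre (hs : Correct x i n B X) (htn : t ≤ n) (hmin : ∀ j ∈ B, t ≤ j) :
    segment X i t = pre (pastAt x t) (t - i).toNat :=
  InfiniteMemory.segment_eq_pre fun j hj =>
    hs.eq_some j ⟨hj.1, hj.2.le.trans htn⟩ fun hjB => hj.2.not_ge (hmin j hjB)

end Correct

variable [Nonempty A] {U : ℤ → ℝ} {i m n r t θ : ℤ} {B : Finset ℤ} {X : ℤ → Option A}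

lemma IsTypical.eq_chain (hP : IsKernel P) (hU : IsTypical e P w U) {k : ℕ}
    {a : A} (h : Determines e P w (U t) (pre (pastAt (chain e P w U) t) k) a) :
    a = chain e P w U t := by
  obtain ⟨s, hs, hregen⟩ := hU.exists_le t
  exact eq_of_mem_hitSet hP ⟨k, h⟩ (hregen.mem_hitSet hP hs)

lemma IsTypical.update_segment (hP : IsKernel P) (hU : IsTypical e P w U)
    (hs : Correct (chain e P w U) i n B X) (htn : t ≤ n) (hmin : ∀ j ∈ B, t ≤ j)
    (h : update e P w (U t) (segment X i t) ≠ none) :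
    update e P w (U t) (segment X i t) = some (chain e P w U t) := by
  rw [hs.segment_eq_pre htn hmin] at h ⊢
  obtain ⟨a, ha⟩ := Option.ne_none_iff_exists'.1 h
  rw [ha, hU.eq_chain hP ((update_eq_some_iff hP).1 ha)]

lemma exists_reaches_outer_of_forward (hP : IsKernel P) (hU : IsTypical e P w U)
    (hs : Correct (chain e P w U) m n (Finset.Icc i n) X) :
    ∃ B' X', Reaches e P w U m ⟨.forward, i, t, Finset.Icc i n, X, θ⟩ ⟨.outer, m, t, B', X', θ⟩ ∧
      Correct (chain e P w U) m n B' X' := by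
  induction hk : (n + 1 - i).toNat using Nat.strong_induction_on generalizing i X with
  | _ k ih =>
  by_cases hloop : update e P w (U i) (segment X m i) ≠ none ∧ (Finset.Icc i n).Nonempty
  · have hin : i ≤ n := Finset.nonempty_Icc.1 hloop.2
    have hupdate := hU.update_segment hP hs hin (fun j hj => (Finset.mem_Icc.1 hj).1) hloop.1
    have herase : (Finset.Icc i n).erase i = Finset.Icc (i + 1) n := by
      rw [Finset.Icc_erase_left, Finset.Icc_add_one_left_eq_Ioc]
    obtain ⟨B', X', hreach, hs'⟩ :=
      ih (n + 1 - (i + 1)).toNat (by lia) (herase ▸ hs.erase i) rfl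
    refine ⟨B', X', (reaches_of_step ?_).trans hreach, hs'⟩
    simp only [step]
    rw [if_pos hloop, herase, hupdate]
  · exact ⟨_, X, reaches_of_step (by simp only [step, if_neg hloop]), hs⟩

lemma IsRegeneration.lt_threshold_zero (hP : IsKernel P) {s : ℤ}
    (h : IsRegeneration e P w U s) : U s < threshold P w 0 := by
  have hdet := h.determines hP 0
  rw [Nat.cast_zero, add_zero, pre_zero] at hdet
  exact (hdet.mem_Ico_of_nil hP).2

lemma IsRegeneration.update_ne_none (hP : IsKernel P) (hi : IsRegeneration e P w U i)
    (hit : i ≤ t) :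
    update e P w (U t) (pre (pastAt (chain e P w U) t) (t - i).toNat) ≠ none := by
  obtain ⟨k, rfl⟩ := Int.exists_add_of_le hit
  rw [update_ne_none_iff hP, add_sub_cancel_left, Int.toNat_natCast]
  exact ⟨_, hi.determines hP k⟩

lemma exists_reaches_outer_of_fill (hP : IsKernel P) (hU : IsTypical e P w U)
    (hs : Correct (chain e P w U) i n B X) :
    ∃ t' B' X', Reaches e P w U m ⟨.fill, i, minB B, B, X, θ⟩ ⟨.outer, i, t', B', X', θ⟩ ∧
      Correct (chain e P w U) i n B' X' ∧ (IsRegeneration e P w U i → B' = ∅) := by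
  induction hk : B.card using Nat.strong_induction_on generalizing B X with
  | _ k ih =>
  have hmin : ∀ j ∈ B, minB B ≤ j := fun j hj => minB_le hj
  by_cases hloop : update e P w (U (minB B)) (segment X i (minB B)) ≠ none ∧ B.Nonempty
  · have hmem := minB_mem hloop.2
    have hupdate :=
      hU.update_segment hP hs (Finset.mem_Icc.1 (hs.subset_Icc hmem)).2 hmin hloop.1
    obtain ⟨t', B', X', hreach, hs'⟩ :=
      ih _ (hk ▸ Finset.card_erase_lt_of_mem hmem) (hs.erase (minB B)) rfl
    refine ⟨t', B', X', (reaches_of_step ?_).trans hreach, hs'⟩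
    simp only [step]
    rw [if_pos hloop, hupdate]
  · refine ⟨minB B, B, X, reaches_of_step (by simp only [step, if_neg hloop]), hs, fun hi => ?_⟩
    by_contra hne
    have hB := Finset.nonempty_iff_ne_empty.2 hne
    obtain ⟨himin, hminn⟩ := Finset.mem_Icc.1 (hs.subset_Icc (minB_mem hB))
    refine hloop ⟨?_, hB⟩
    rw [hs.segment_eq_pre hminn hmin]
    exact hi.update_ne_none hP himin

lemma exists_reaches_fill_of_search (hP : IsKernel P) (hU : IsTypical e P w U)
    (hr : IsRegeneration e P w U r) (hri : r ≤ i) (hin : i ≤ n)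
    (hs : Correct (chain e P w U) i n B X) :
    ∃ i' ∈ Set.Icc r i, ∃ B' X',
      Reaches e P w U m ⟨.search, i, t, B, X, θ⟩ ⟨.fill, i', minB B', B', X', θ⟩ ∧
      Correct (chain e P w U) i' n B' X' := by
  induction hk : (i - r).toNat using Nat.strong_induction_on generalizing i B with
  | _ k ih =>
  by_cases hloop : U i ∈ Set.Ico (threshold P w 0) 1
  · have hne : r ≠ i := by
      rintro rfl
      exact hloop.1.not_gt (hr.lt_threshold_zero hP)
    obtain ⟨i', hi', B', X', hreach, hs'⟩ :=
      ih (i - 1 - r).toNat (by lia) (by lia) (by lia) (hs.insert hin) rfl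
    refine ⟨i', ⟨hi'.1, hi'.2.trans (by lia)⟩, B', X', (reaches_of_step ?_).trans hreach, hs'⟩
    simp only [step, if_pos hloop]
  · have hlt : U i < threshold P w 0 := by
      by_contra! hge
      exact hloop ⟨hge, (hU.mem_Ico i).2⟩
    obtain ⟨a, ha⟩ := exists_determines_of_lt_threshold_zero (e := e) hP (hU.mem_Ico i).1 hlt []
    obtain rfl : a = chain e P w U i := hU.eq_chain (k := 0) hP ha
    refine ⟨i, ⟨hri, le_rfl⟩, _, _, reaches_of_step ?_, hs.erase i⟩
    simp only [step, if_neg hloop, (update_eq_some_iff hP).2 ha]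

lemma exists_reaches_halted_of_outer (hP : IsKernel P) (hU : IsTypical e P w U)
    (hr : IsRegeneration e P w U r) (hri : r ≤ i) (hin : i ≤ n)
    (hs : Correct (chain e P w U) i n B X) (hrB : i = r → B = ∅) :
    ∃ i' ≤ i, ∃ t' X',
      Reaches e P w U m ⟨.outer, i, t, B, X, θ⟩ ⟨.halted, i', t', ∅, X', i'⟩ ∧
      Correct (chain e P w U) i' n ∅ X' := by
  induction hk : (i - r).toNat using Nat.strong_induction_on generalizing i t B X with
  | _ k ih =>
  rcases B.eq_empty_or_nonempty with rfl | hB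
  · exact ⟨i, le_rfl, t, X,
      reaches_of_step (by simp only [step, Finset.not_nonempty_empty, if_false]), hs⟩
  have hne : i ≠ r := fun h => hB.ne_empty (hrB h)
  obtain ⟨i₁, hi₁, B₁, X₁, hfill, hs₁⟩ := exists_reaches_fill_of_search (m := m) (t := t) (θ := θ)
    hP hU hr (by lia) (by lia) (hs.insert hin)
  obtain ⟨t₂, B₂, X₂, houter, hs₂, hB₂⟩ := exists_reaches_outer_of_fill (m := m) (θ := θ) hP hU hs₁
  obtain ⟨hri₁, hi₁i⟩ := hi₁
  obtain ⟨i', hi', t', X', hhalted, hs'⟩ := ih (i₁ - r).toNat (by lia) (t := t₂) hri₁ (by lia) hs₂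
    (fun h => hB₂ (h ▸ hr)) rfl
  refine ⟨i', by lia, t', X', (reaches_of_step ?_).trans (hfill.trans (houter.trans hhalted)), hs'⟩
  simp only [step, if_pos hB]

lemma IsTypical.outputs (hP : IsKernel P) (hU : IsTypical e P w U) (hmn : m ≤ n) :
    ∃ θ ≤ m, Outputs e P w U m n θ (chain e P w U) := by
  have hinit : Correct (chain e P w U) m n (Finset.Icc m n) fun _ => none :=
    ⟨subset_rfl, fun j hj hjB => absurd (Finset.mem_Icc.2 hj) hjB⟩
  obtain ⟨B₁, X₁, houter, hs₁⟩ :=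
    exists_reaches_outer_of_forward (t := m) (θ := m) hP hU hinit
  obtain ⟨r, hrm, hr⟩ := hU.exists_le (m - 1)
  obtain ⟨i, him, t, X, hhalted, hs⟩ := exists_reaches_halted_of_outer (m := m) (t := m) (θ := m)
    hP hU hr (by lia) hmn hs₁ fun h => by lia
  obtain ⟨N, hN⟩ := houter.trans hhalted
  refine ⟨i, him, N, ?_⟩
  rw [initState, hN]
  exact ⟨rfl, rfl, fun j hj => hs.eq_some j hj (Finset.notMem_empty j)⟩

end Algorithm

section Sites

variable {ι : Type*} {X : ι → Type*} {E F : Set (∀ i, X i)} {S T : Set ι}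

/-! ### Dependence on disjoint sites -/

lemma dependsOn_mem_compl (hE : DependsOn (· ∈ E) S) : DependsOn (· ∈ Eᶜ) S :=
  fun _ _ hxy => congrArg Not (hE hxy)

lemma dependsOn_mem_inter (hE : DependsOn (· ∈ E) S) (hF : DependsOn (· ∈ F) S) :
    DependsOn (· ∈ E ∩ F) S :=
  fun _ _ hxy => congrArg₂ And (hE hxy) (hF hxy)

lemma dependsOn_mem_union (hE : DependsOn (· ∈ E) S) (hF : DependsOn (· ∈ F) S) :
    DependsOn (· ∈ E ∪ F) S :=
  fun _ _ hxy => congrArg₂ Or (hE hxy) (hF hxy)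

lemma dependsOn_mem_iUnion {κ : Sort*} {E : κ → Set (∀ i, X i)}
    (hE : ∀ k, DependsOn (· ∈ E k) S) : DependsOn (· ∈ ⋃ k, E k) S := fun _ _ hxy => by
  simp only [Set.mem_iUnion, fun k => hE k hxy]

variable [∀ i, MeasurableSpace (X i)]

lemma measurableSet_cylinderEvents_of_dependsOn (hE : DependsOn (· ∈ E) S)
    (hm : MeasurableSet E) : MeasurableSet[cylinderEvents S] E := by
  classical
  rcases E.eq_empty_or_nonempty with rfl | ⟨x₀, -⟩
  · exact @MeasurableSet.empty _ (cylinderEvents S)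
  let resample : (∀ i, X i) → ∀ i, X i := fun x i => if i ∈ S then x i else x₀ i
  have h_meas : Measurable[cylinderEvents S] resample := by
    refine @measurable_pi_lambda _ _ _ (cylinderEvents S) _ _ fun i => ?_
    by_cases hi : i ∈ S
    · simpa only [resample, if_pos hi] using measurable_cylinderEvent_apply hi
    · simpa only [resample, if_neg hi] using measurable_const
  have h_preimage : resample ⁻¹' E = E :=
    Set.ext fun x => (hE fun i hi => by simp only [resample, if_pos hi]).to_iff
  rw [← h_preimage]
  exact h_meas hm

lemma infinitePi_inter_of_dependsOn (μ : ∀ i, Measure (X i)) [∀ i, IsProbabilityMeasure (μ i)]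
    (hE : MeasurableSet E) (hF : MeasurableSet F) (hES : DependsOn (· ∈ E) S)
    (hFT : DependsOn (· ∈ F) T) (hST : Disjoint S T) :
    Measure.infinitePi μ (E ∩ F) = Measure.infinitePi μ E * Measure.infinitePi μ F := by
  have h_indep : Indep (cylinderEvents S) (cylinderEvents T) (Measure.infinitePi μ) :=
    indep_iSup_of_disjoint (fun i => (measurable_pi_apply i).comap_le)
      (iIndepFun_infinitePi (X := fun _ x => x) fun _ => measurable_id) hST
  exact (Indep_iff _ _ _).1 h_indep E F (measurableSet_cylinderEvents_of_dependsOn hES hE)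
    (measurableSet_cylinderEvents_of_dependsOn hFT hF)

lemma indepFun_infinitePi_of_dependsOn {β γ : Type*} [MeasurableSpace β] [MeasurableSpace γ]
    (μ : ∀ i, Measure (X i)) [∀ i, IsProbabilityMeasure (μ i)] {f : (∀ i, X i) → β}
    {g : (∀ i, X i) → γ} (hf : Measurable f) (hg : Measurable g) (hfS : DependsOn f S)
    (hgT : DependsOn g T) (hST : Disjoint S T) : IndepFun f g (Measure.infinitePi μ) :=
  indepFun_iff_measure_inter_preimage_eq_mul.2 fun s t hs ht =>
    infinitePi_inter_of_dependsOn μ (hf hs) (hg ht) (fun _ _ h => congrArg (· ∈ s) (hfS h))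
      (fun _ _ h => congrArg (· ∈ t) (hgT h)) hST

lemma infinitePi_eq_zero_or_one_of_dependsOn_Ici [SemilatticeSup ι] [NoMaxOrder ι] [Nonempty ι]
    (μ : ∀ i, Measure (X i)) [∀ i, IsProbabilityMeasure (μ i)] (hm : MeasurableSet E)
    (hE : ∀ i, DependsOn (· ∈ E) (Set.Ici i)) :
    Measure.infinitePi μ E = 0 ∨ Measure.infinitePi μ E = 1 := by
  refine measure_zero_or_one_of_measurableSet_limsup_atTop
    (fun i => (measurable_pi_apply i).comap_le)
    (iIndepFun_infinitePi (P := μ) (X := fun _ x => x) fun _ => measurable_id) ?_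
  rw [Filter.atTop_basis.limsup_eq_iInf_iSup]
  simp only [MeasurableSpace.measurableSet_iInf]
  exact fun i _ => measurableSet_cylinderEvents_of_dependsOn (hE i) hm

instance : IsProbabilityMeasure lawU := by unfold lawU; infer_instance

lemma lawU_eval (i : ℤ) {D : Set ℝ} (hD : MeasurableSet D) : lawU {U | U i ∈ D} = unif D := by
  rw [← Measure.infinitePi_map_eval (fun _ : ℤ => unif) i,
    Measure.map_apply (measurable_pi_apply i) hD]
  rfl

lemma measurable_shift {R : Type*} [MeasurableSpace R] (k : ℤ) :
    Measurable (shift k : (ℤ → R) → ℤ → R) :=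
  measurable_pi_lambda _ fun i => measurable_pi_apply (i + k)

lemma measurePreserving_shift (k : ℤ) : MeasurePreserving (shift k) lawU lawU := by
  have h_shift : (shift k : (ℤ → ℝ) → ℤ → ℝ) =
      MeasurableEquiv.piCongrLeft (fun _ => ℝ) (Equiv.subRight k) := by
    ext U i
    have h_apply := Equiv.piCongrLeft_apply_apply (fun _ => ℝ) (Equiv.subRight k) U (i + k)
    simp only [Equiv.subRight_apply, add_sub_cancel_right] at h_apply
    exact h_apply.symm
  refine ⟨measurable_shift k, ?_⟩
  rw [h_shift]
  exact Measure.infinitePi_map_piCongrLeft (fun _ : ℤ => unif) (Equiv.subRight k)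

lemma lawU_preimage_shift {E : Set (ℤ → ℝ)} (hE : MeasurableSet E) (k : ℤ) :
    lawU (shift k ⁻¹' E) = lawU E :=
  (measurePreserving_shift k).measure_preimage hE.nullMeasurableSet

lemma ae_mem_Ico : ∀ᵐ U ∂lawU, ∀ i, U i ∈ Set.Ico (0 : ℝ) 1 := by
  refine ae_all_iff.2 fun i => ?_
  rw [ae_iff]
  exact (lawU_eval i measurableSet_Ico.compl).trans
    (by simp [unif, Measure.restrict_apply measurableSet_Ico.compl])

end Sites

section Measurability

variable {e : A ↪ ℕ} {P : A → (ℕ → A) → ℝ} {w : List A}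

lemma dependsOn_isRegeneration (s : ℤ) :
    DependsOn (· ∈ {U | IsRegeneration e P w U s}) (Set.Ici s) :=
  fun _ _ hU => propext (isRegeneration_congr hU)

variable [Nonempty A] [Countable A]

lemma measurableSet_run_eq (hP : IsKernel P) (s : ℤ) (n : ℕ) (v : List A) :
    MeasurableSet {U | run e P w U s n = some v} := by
  induction n generalizing v with
  | zero => simp only [run_zero]; exact MeasurableSet.const _
  | succ n ih =>
    simp only [run_succ_eq_some_iff hP, Set.ofPred_exists]
    have h_determines (v' : List A) (a : A) :
        MeasurableSet {U : ℤ → ℝ | Determines e P w (U (s + n)) v' a} :=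
      (measurableSet_determines v' a).preimage (measurable_pi_apply (s + (n : ℤ)))
    exact .iUnion fun v' => .iUnion fun a =>
      (ih v').inter ((h_determines v' a).inter (MeasurableSet.const _))

lemma measurableSet_run_ne_none (hP : IsKernel P) (s : ℤ) (n : ℕ) :
    MeasurableSet {U | run e P w U s n ≠ none} := by
  simp only [Option.ne_none_iff_exists', Set.ofPred_exists]
  exact .iUnion fun v => measurableSet_run_eq hP s n v

lemma measurableSet_isRegeneration (hP : IsKernel P) (s : ℤ) :
    MeasurableSet {U | IsRegeneration e P w U s} := by
  simp only [IsRegeneration, Set.ofPred_forall]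
  exact .iInter fun n => measurableSet_run_ne_none hP s n

lemma measurableSet_constructs (hP : IsKernel P) (j : ℤ) (a : A) :
    MeasurableSet {U | Constructs e P w U j a} := by
  simp only [Constructs, Set.ofPred_exists]
  exact .iUnion fun n => .iUnion fun v => measurableSet_run_eq hP _ _ _

lemma measurable_chain [MeasurableSpace A] (hP : IsKernel P) :
    Measurable (chain e P w) :=
  measurable_pi_lambda _ fun j =>
    measurable_epsilon (fun a => measurableSet_constructs hP j a) fun _ _ _ => Constructs.unique hP

end Measurability

section Spells

variable {e : A ↪ ℕ} {P : A → (ℕ → A) → ℝ} {w : List A}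

/-! ### Spontaneous words -/

/-- The uniform variables from `s` on spontaneously produce the symbols of `c`, in the order of
time: the most recent symbol is the last one. -/
def Spells (e : A ↪ ℕ) (P : A → (ℕ → A) → ℝ) (U : ℤ → ℝ) : ℤ → List A → Prop
  | _, [] => True
  | s, a :: c => U s ∈ intervalI e P a ∧ Spells e P U (s + 1) c

lemma spells_shift (U : ℤ → ℝ) (s k : ℤ) (c : List A) :
    Spells e P (shift k U) s c ↔ Spells e P U (s + k) c := by
  induction c generalizing s with
  | nil => rfl
  | cons a c ih => rw [Spells, Spells, ih, add_right_comm]; rfl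

lemma dependsOn_spells (s : ℤ) (c : List A) :
    DependsOn (· ∈ {U | Spells e P U s c}) (Set.Ico s (s + c.length)) := by
  induction c generalizing s with
  | nil => exact fun _ _ _ => rfl
  | cons a c ih =>
    intro U U' hU
    rw [List.length_cons] at hU
    have h_head : U s = U' s := hU s ⟨le_rfl, by lia⟩
    have h_tail : Spells e P U (s + 1) c = Spells e P U' (s + 1) c :=
      ih (s + 1) fun i hi => hU i ⟨by grind, by grind⟩
    simp only [Set.mem_ofPred_eq, Spells, h_head, h_tail]

lemma measurableSet_intervalI (a : A) : MeasurableSet (intervalI e P a) := measurableSet_Ico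

lemma measurableSet_spells (s : ℤ) (c : List A) : MeasurableSet {U | Spells e P U s c} := by
  induction c generalizing s with
  | nil => exact MeasurableSet.univ
  | cons a c ih =>
    have h_head : MeasurableSet {U : ℤ → ℝ | U s ∈ intervalI e P a} :=
      (measurableSet_intervalI a).preimage (measurable_pi_apply s)
    exact h_head.inter (ih (s + 1))

lemma run_of_spells [Nonempty A] (hP : IsKernel P) {U : ℤ → ℝ} {s : ℤ} {c : List A}
    (h : Spells e P U s c) : run e P w U s c.length = some c.reverse := by
  induction c generalizing s with
  | nil => rfl
  | cons a c ih =>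
    have h_head : run e P w U s 1 = some [a] :=
      (run_succ_eq_some_iff hP).2 ⟨[], a, rfl, Or.inl (by simpa using h.1), rfl⟩
    rw [List.length_cons, add_comm, List.reverse_cons]
    exact run_append hP h_head (ih (by exact_mod_cast h.2))

lemma unif_intervalI [Nonempty A] (hP : IsKernel P) (a : A) :
    unif (intervalI e P a) = ENNReal.ofReal (lowerProb P a []) := by
  have h_sub : intervalI e P a ⊆ Set.Ico 0 1 := (intervalI_subset_Ico (w := []) hP a).trans
    (Set.Ico_subset_Ico_right (tsum_lowerProb_le_one hP []))
  rw [unif, Measure.restrict_apply (measurableSet_intervalI a), Set.inter_eq_left.2 h_sub,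
    intervalI, volume_glued]

lemma lawU_spells_pos [Nonempty A] (hP : IsKernel P) (s : ℤ) {c : List A}
    (hc : ∀ a ∈ c, a ∈ spontaneousSymbols P) : 0 < lawU {U | Spells e P U s c} := by
  induction c generalizing s with
  | nil => simp [Spells]
  | cons a c ih =>
    have h_head : MeasurableSet {U : ℤ → ℝ | U s ∈ intervalI e P a} :=
      (measurableSet_intervalI a).preimage (measurable_pi_apply s)
    have h_dep : DependsOn (· ∈ {U : ℤ → ℝ | U s ∈ intervalI e P a}) {s} :=
      fun U U' hU => congrArg (· ∈ intervalI e P a) (hU s rfl)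
    have h_disj : Disjoint {s} (Set.Ico (s + 1) (s + 1 + c.length)) := by simp
    calc 0 < ENNReal.ofReal (lowerProb P a []) * lawU {U | Spells e P U (s + 1) c} :=
          ENNReal.mul_pos (ENNReal.ofReal_pos.2 (hc a List.mem_cons_self)).ne'
            (ih (s + 1) fun b hb => hc b (List.mem_cons_of_mem _ hb)).ne'
      _ = lawU {U | U s ∈ intervalI e P a} * lawU {U | Spells e P U (s + 1) c} := by
          rw [lawU_eval s (measurableSet_intervalI a), ← unif_intervalI (e := e) hP]
      _ = lawU {U | Spells e P U s (a :: c)} :=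
          (infinitePi_inter_of_dependsOn _ h_head (measurableSet_spells _ _) h_dep
            (dependsOn_spells _ _) h_disj).symm

lemma lawU_spells_eq (s : ℤ) (c : List A) :
    lawU {U | Spells e P U s c} = lawU {U | Spells e P U 0 c} := by
  rw [← lawU_preimage_shift (measurableSet_spells 0 c) s]
  simp only [Set.preimage_ofPred_eq, spells_shift, zero_add]

end Spells

section NeverStuck

variable {e : A ↪ ℕ} {P : A → (ℕ → A) → ℝ} {w : List A}

/-- The length of the windows in which spontaneous occurrences of the word are looked for. -/
def spacing (w : List A) : ℕ := w.length + 1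

/-- No spontaneous occurrence of the word starts at one of `k` consecutive multiples of
`spacing w`, the first of which is the `n`-th. -/
def noWord (e : A ↪ ℕ) (P : A → (ℕ → A) → ℝ) (w : List A) (n k : ℕ) : Set (ℤ → ℝ) :=
  {U | ∀ j < k, ¬ Spells e P U (((n + j) * spacing w : ℕ) : ℤ) w.reverse}

/-- The uniform variable at one of the sites of `S` requires more than `k` symbols before the
word. -/
def largeContext (P : A → (ℕ → A) → ℝ) (w : List A) (S : Finset ℕ) (k : ℕ) : Set (ℤ → ℝ) :=
  ⋃ t ∈ S, {U | alphaW P w k ≤ U (t : ℤ)}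

/-- One of the sites of the `n`-th window of length `2 * spacing w` needs a context that is
larger than `n`, or no spontaneous occurrence of the word starts between the windows `n` and
`2 * n` of length `spacing w`. -/
def badWindow (e : A ↪ ℕ) (P : A → (ℕ → A) → ℝ) (w : List A) (n : ℕ) : Set (ℤ → ℝ) :=
  largeContext P w (Finset.Ico (2 * spacing w * n) (2 * spacing w * (n + 1))) n ∪ noWord e P w n n

/-- The uniform variables from `0` on may prevent the construction from going on, if it starts
from an occurrence of the word that is preceded by `K` symbols: the occurrence at the start is
relied upon before the `N`-th window, and more recent ones from there on. -/
def stuck (e : A ↪ ℕ) (P : A → (ℕ → A) → ℝ) (w : List A) (K N : ℕ) : Set (ℤ → ℝ) :=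
  largeContext P w (Finset.range (2 * spacing w * N)) K ∪ ⋃ n, badWindow e P w (n + N)

lemma run_drop [Nonempty A] (hP : IsKernel P) {U : ℤ → ℝ} {s : ℤ} {n k : ℕ} {v : List A}
    (h : run e P w U s (n + k) = some v) : run e P w U s n = some (v.drop k) := by
  induction k generalizing v with
  | zero => simpa using h
  | succ k ih =>
    obtain ⟨v', a, hv', -, rfl⟩ := (run_succ_eq_some_iff hP).1 h
    simpa using ih hv'

lemma isPrefix_drop_of_spells [Nonempty A] (hP : IsKernel P) {U : ℤ → ℝ} {s : ℤ} {n k : ℕ}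
    {c v : List A} (hv : run e P w U s (n + c.length + k) = some v)
    (hc : Spells e P U (s + n) c) : c.reverse <+: v.drop k := by
  have h_upto : run e P w U s (n + c.length) = some (v.drop k) := run_drop hP hv
  have h_append := run_append hP (run_drop hP h_upto) (run_of_spells hP hc)
  rw [h_upto, Option.some_inj] at h_append
  exact h_append ▸ List.prefix_append _ _

lemma exists_determines_of_isPrefix_drop [Nonempty A] (hP : IsKernel P) {u : ℝ} (h0 : 0 ≤ u)
    {v : List A} {k l : ℕ} (hw : w <+: v.drop k) (hl : k + w.length + l ≤ v.length)
    (hu : u < alphaW P w l) : ∃ a, Determines e P w u v a := by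
  have h_dist : distOcc w v ≤ k := sInf_le ⟨k, hw, rfl⟩
  obtain ⟨m, hm⟩ := ENat.ne_top_iff_exists.1 (ne_top_of_le_ne_top (ENat.natCast_ne_top k) h_dist)
  have hmk : m ≤ k := by rw [← hm] at h_dist; exact_mod_cast h_dist
  exact exists_determines hP h0 hm.symm (by lia) hu

lemma exists_spells_of_notMem_noWord {U : ℤ → ℝ} {n t : ℕ} (hU : U ∉ noWord e P w n n)
    (ht : 2 * spacing w * n ≤ t) :
    ∃ p k : ℕ, p + w.length + k = t ∧ n ≤ p ∧ Spells e P U p w.reverse := by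
  simp only [noWord, Set.mem_ofPred_eq, not_forall, not_not] at hU
  obtain ⟨j, hj, h_spells⟩ := hU
  have h_spacing : spacing w = w.length + 1 := rfl
  have h_start : n ≤ (n + j) * spacing w := by
    rw [h_spacing]
    exact (Nat.le_add_right n j).trans (Nat.le_mul_of_pos_right _ (Nat.succ_pos _))
  have h_end : (n + j) * spacing w + spacing w ≤ t := calc
    (n + j) * spacing w + spacing w = (n + j + 1) * spacing w := by ring
    _ ≤ 2 * n * spacing w := Nat.mul_le_mul_right _ (by lia)
    _ = 2 * spacing w * n := by ring
    _ ≤ t := ht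
  exact ⟨(n + j) * spacing w, t - ((n + j) * spacing w + w.length), by lia, h_start, h_spells⟩

lemma exists_window_of_notMem_stuck {U : ℤ → ℝ} {K N t : ℕ} (hU : U ∉ stuck e P w K N)
    (ht : 2 * spacing w * N ≤ t) :
    ∃ n, 2 * spacing w * n ≤ t ∧ U t < alphaW P w n ∧ U ∉ noWord e P w n n := by
  have h_pos : 0 < 2 * spacing w := by simp [spacing]
  have h_window : U ∉ badWindow e P w (t / (2 * spacing w)) := by
    obtain ⟨j, hj⟩ := Nat.exists_eq_add_of_le'
      ((Nat.le_div_iff_mul_le h_pos).2 (mul_comm N _ ▸ ht))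
    exact hj ▸ fun h => hU (Or.inr (Set.mem_iUnion.2 ⟨j, h⟩))
  refine ⟨t / (2 * spacing w), Nat.mul_div_le _ _, ?_, fun h => h_window (Or.inr h)⟩
  by_contra! h_large
  refine h_window (Or.inl (Set.mem_biUnion (Finset.mem_Ico.2 ⟨Nat.mul_div_le _ _, ?_⟩) h_large))
  exact Nat.lt_mul_div_succ t h_pos

lemma exists_determines_of_notMem_stuck [Nonempty A] (hP : IsKernel P) {U : ℤ → ℝ}
    {M K N t : ℕ} {c v : List A} (hc : K ≤ c.length)
    (h_start : run e P w U (-M) M = some (w ++ c)) (hU : U ∉ stuck e P w K N) (h0 : 0 ≤ U t)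
    (hv : run e P w U (-M) (M + t) = some v) : ∃ a, Determines e P w (U t) v a := by
  have h_length : w.length + c.length = M := by
    simpa using length_of_run_eq_some hP h_start
  have hv_length : v.length = M + t := length_of_run_eq_some hP hv
  rcases lt_or_ge t (2 * spacing w * N) with ht | ht
  · have h_lt : U t < alphaW P w K := by
      by_contra! h_large
      exact hU (Or.inl (Set.mem_biUnion (Finset.mem_range.2 ht) h_large))
    have h_drop : w ++ c = v.drop t := Option.some.inj (h_start.symm.trans (run_drop hP hv))
    exact exists_determines_of_isPrefix_drop hP h0 (k := t) (h_drop ▸ List.prefix_append _ _)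
      (by lia) h_lt
  · obtain ⟨n, hnt, h_lt, h_word⟩ := exists_window_of_notMem_stuck hU ht
    obtain ⟨p, k, rfl, hnp, h_spells⟩ := exists_spells_of_notMem_noWord h_word hnt
    have hw_drop : w <+: v.drop k := by
      rw [← w.reverse_reverse]
      refine isPrefix_drop_of_spells (e := e) (w := w) (U := U) (s := -M) (n := M + p) hP ?_ ?_
      · rw [← hv, List.length_reverse, add_assoc, add_assoc, add_assoc]
      · rwa [Nat.cast_add, neg_add_cancel_left]
    exact exists_determines_of_isPrefix_drop hP h0 hw_drop (by lia) h_lt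

lemma isRegeneration_of_notMem_stuck [Nonempty A] (hP : IsKernel P) {U : ℤ → ℝ} {M K N : ℕ}
    {c : List A} (hc : K ≤ c.length) (h_start : run e P w U (-M) M = some (w ++ c))
    (hU : U ∉ stuck e P w K N) (h0 : ∀ t : ℕ, 0 ≤ U t) : IsRegeneration e P w U (-M) := by
  have h_run (t : ℕ) : run e P w U (-M) (M + t) ≠ none := by
    induction t with
    | zero => simp [h_start]
    | succ t ih =>
      obtain ⟨v, hv⟩ := Option.ne_none_iff_exists'.1 ih
      obtain ⟨a, ha⟩ := exists_determines_of_notMem_stuck hP hc h_start hU (h0 t) hv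
      rw [← neg_add_cancel_left (M : ℤ) t, ← Nat.cast_add] at ha
      exact Option.ne_none_iff_exists'.2 ⟨_, (run_succ_eq_some_iff hP).2 ⟨v, a, hv, ha, rfl⟩⟩
  exact fun n => run_ne_none_of_le (Nat.le_add_left n M) (h_run n)

end NeverStuck

section Recurrence

variable {e : A ↪ ℕ} {P : A → (ℕ → A) → ℝ} {w : List A}

/-! ### Recurrence of regenerations -/

lemma dependsOn_noWord (n k : ℕ) :
    DependsOn (· ∈ noWord e P w n k)
      (Set.Ico ((n * spacing w : ℕ) : ℤ) (((n + k) * spacing w : ℕ) : ℤ)) := by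
  intro U U' hU
  have h_spells : ∀ j < k, (Spells e P U (((n + j) * spacing w : ℕ) : ℤ) w.reverse ↔
      Spells e P U' (((n + j) * spacing w : ℕ) : ℤ) w.reverse) := by
    refine fun j hj => (dependsOn_spells _ _ fun i hi => hU i ?_).to_iff
    have h_left : n * spacing w ≤ (n + j) * spacing w := Nat.mul_le_mul_right _ (by lia)
    have h_right : (n + j) * spacing w + spacing w ≤ (n + k) * spacing w :=
      (Nat.succ_mul _ _).symm.le.trans (Nat.mul_le_mul_right _ (by lia))
    have h_spacing : spacing w = w.length + 1 := rfl
    have h_lt := hi.2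
    rw [List.length_reverse] at h_lt
    exact ⟨(Int.ofNat_le.2 h_left).trans hi.1, by lia⟩
  exact propext (forall₂_congr fun j hj => not_congr (h_spells j hj))

lemma dependsOn_largeContext (S : Finset ℕ) (k : ℕ) :
    DependsOn (· ∈ largeContext P w S k) (Set.Ici 0) :=
  dependsOn_mem_iUnion fun t => dependsOn_mem_iUnion fun _ => fun _ _ hU =>
    congrArg (alphaW P w k ≤ ·) (hU t (Int.natCast_nonneg t))

lemma dependsOn_stuck (K N : ℕ) : DependsOn (· ∈ stuck e P w K N) (Set.Ici 0) := by
  have h_noWord (n k : ℕ) : DependsOn (· ∈ noWord e P w n k) (Set.Ici 0) :=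
    (dependsOn_noWord n k).mono fun i hi => (Int.natCast_nonneg _).trans hi.1
  exact dependsOn_mem_union (dependsOn_largeContext _ _) (dependsOn_mem_iUnion fun n =>
    dependsOn_mem_union (dependsOn_largeContext _ _) (h_noWord _ _))

lemma measurableSet_noWord (n k : ℕ) : MeasurableSet (noWord e P w n k) := by
  simp only [noWord, Set.ofPred_forall]
  exact .iInter fun j => .iInter fun _ => (measurableSet_spells _ _).compl

lemma measurableSet_largeContext (S : Finset ℕ) (k : ℕ) :
    MeasurableSet (largeContext P w S k) :=
  Finset.measurableSet_biUnion _ fun t _ => measurableSet_Ici.preimage (measurable_pi_apply (t : ℤ))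

lemma measurableSet_stuck (K N : ℕ) : MeasurableSet (stuck e P w K N) :=
  (measurableSet_largeContext _ _).union <| .iUnion fun _ =>
    (measurableSet_largeContext _ _).union (measurableSet_noWord _ _)

lemma lawU_noWord (n k : ℕ) :
    lawU (noWord e P w n k) = (1 - lawU {U | Spells e P U 0 w.reverse}) ^ k := by
  induction k with
  | zero => simp [noWord]
  | succ k ih =>
    have h_succ : noWord e P w n (k + 1) = noWord e P w n k ∩
        {U | Spells e P U (((n + k) * spacing w : ℕ) : ℤ) w.reverse}ᶜ :=
      Set.ext fun U => Nat.forall_lt_succ_right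
    have h_disj : Disjoint
        (Set.Ico ((n * spacing w : ℕ) : ℤ) (((n + k) * spacing w : ℕ) : ℤ))
        (Set.Ico (((n + k) * spacing w : ℕ) : ℤ)
          ((((n + k) * spacing w : ℕ) : ℤ) + w.reverse.length)) :=
      Set.Ico_disjoint_Ico_same
    rw [h_succ, lawU, infinitePi_inter_of_dependsOn _ (measurableSet_noWord n k)
      (measurableSet_spells _ _).compl (dependsOn_noWord n k)
      (dependsOn_mem_compl (dependsOn_spells _ _)) h_disj, ← lawU, ih,
      prob_compl_eq_one_sub (measurableSet_spells _ _),
      lawU_spells_eq (((n + k) * spacing w : ℕ) : ℤ), pow_succ]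

lemma lawU_largeContext_le (S : Finset ℕ) (k : ℕ) :
    lawU (largeContext P w S k) ≤ S.card * ENNReal.ofReal (1 - alphaW P w k) := by
  have h_unif : unif (Set.Ici (alphaW P w k)) ≤ ENNReal.ofReal (1 - alphaW P w k) := by
    rw [unif, Measure.restrict_apply measurableSet_Ici, ← Real.volume_Ico]
    exact measure_mono fun u hu => ⟨hu.1, hu.2.2⟩
  calc lawU (largeContext P w S k)
      ≤ ∑ t ∈ S, lawU {U | U (t : ℤ) ∈ Set.Ici (alphaW P w k)} := measure_biUnion_finset_le _ _
    _ ≤ S.card • ENNReal.ofReal (1 - alphaW P w k) :=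
        Finset.sum_le_card_nsmul _ _ _ fun t _ => (lawU_eval t measurableSet_Ici).trans_le h_unif
    _ = S.card * ENNReal.ofReal (1 - alphaW P w k) := nsmul_eq_mul _ _

lemma lawU_badWindow_le (n : ℕ) : lawU (badWindow e P w n) ≤
    (2 * spacing w : ℕ) * ENNReal.ofReal (1 - alphaW P w n) +
      (1 - lawU {U | Spells e P U 0 w.reverse}) ^ n := by
  refine (measure_union_le _ _).trans (add_le_add ?_ (lawU_noWord n n).le)
  refine (lawU_largeContext_le _ _).trans_eq ?_
  rw [Nat.card_Ico, mul_add_one, Nat.add_sub_cancel_left]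

lemma tsum_lawU_badWindow_ne_top [Nonempty A] (hP : IsKernel P)
    (hw : ∀ a ∈ w, a ∈ spontaneousSymbols P)
    (hsum : Summable fun k : ℕ => 1 - alphaW P w k) :
    ∑' n, lawU (badWindow e P w n) ≠ ⊤ := by
  refine ne_top_of_le_ne_top ?_ (ENNReal.tsum_le_tsum lawU_badWindow_le)
  have h_spells : lawU {U | Spells e P U 0 w.reverse} ≠ 0 :=
    (lawU_spells_pos hP 0 fun a ha => hw a (List.mem_reverse.1 ha)).ne'
  rw [ENNReal.tsum_add, ENNReal.tsum_mul_left, ENNReal.tsum_geometric,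
    ENNReal.sub_sub_cancel ENNReal.one_ne_top prob_le_one]
  exact ENNReal.add_ne_top.2 ⟨ENNReal.mul_ne_top (ENNReal.natCast_ne_top _)
    hsum.tsum_ofReal_ne_top, ENNReal.inv_ne_top.2 h_spells⟩

lemma exists_lawU_compl_stuck_pos [Nonempty A] (hP : IsKernel P)
    (hw : ∀ a ∈ w, a ∈ spontaneousSymbols P)
    (hsum : Summable fun k : ℕ => 1 - alphaW P w k) :
    ∃ K N, 0 < lawU (stuck e P w K N)ᶜ := by
  have h_half : (0 : ℝ≥0∞) < 2⁻¹ := by norm_num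
  obtain ⟨N, hN⟩ := ((ENNReal.tendsto_sum_nat_add (fun n => lawU (badWindow e P w n))
    (tsum_lawU_badWindow_ne_top hP hw hsum)).eventually (gt_mem_nhds h_half)).exists
  have h_tendsto : Filter.Tendsto (fun K => (2 * spacing w * N : ℕ) *
      ENNReal.ofReal (1 - alphaW P w K)) Filter.atTop (nhds 0) := by
    have h_alpha := ENNReal.tendsto_ofReal hsum.tendsto_atTop_zero
    rw [ENNReal.ofReal_zero] at h_alpha
    simpa only [mul_zero] using
      ENNReal.Tendsto.const_mul h_alpha (Or.inr (ENNReal.natCast_ne_top (2 * spacing w * N)))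
  obtain ⟨K, hK⟩ := (h_tendsto.eventually (gt_mem_nhds h_half)).exists
  have h_large := lawU_largeContext_le (P := P) (w := w) (Finset.range (2 * spacing w * N)) K
  rw [Finset.card_range] at h_large
  have h_stuck : lawU (stuck e P w K N) < 1 := calc
    lawU (stuck e P w K N) ≤ (2 * spacing w * N : ℕ) * ENNReal.ofReal (1 - alphaW P w K) +
        ∑' n, lawU (badWindow e P w (n + N)) :=
      (measure_union_le _ _).trans (add_le_add h_large (measure_iUnion_le _))
    _ < 2⁻¹ + 2⁻¹ := ENNReal.add_lt_add hK hN
    _ = 1 := ENNReal.inv_two_add_inv_two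
  refine ⟨K, N, ?_⟩
  rw [prob_compl_eq_one_sub (measurableSet_stuck K N)]
  exact tsub_pos_of_lt h_stuck

variable [Nonempty A] [Countable A]

lemma lawU_isRegeneration_eq (hP : IsKernel P) (s : ℤ) :
    lawU {U | IsRegeneration e P w U s} = lawU {U | IsRegeneration e P w U 0} := by
  rw [← lawU_preimage_shift (measurableSet_isRegeneration hP 0) s]
  simp only [Set.preimage_ofPred_eq, isRegeneration_shift, zero_add]

lemma lawU_isRegeneration_pos (hP : IsKernel P) (hE : (spontaneousSymbols P).Nonempty)
    (hw : ∀ a ∈ w, a ∈ spontaneousSymbols P) (hsum : Summable fun k : ℕ => 1 - alphaW P w k) :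
    0 < lawU {U | IsRegeneration e P w U 0} := by
  obtain ⟨a, ha⟩ := hE
  obtain ⟨K, N, h_stuck⟩ := exists_lawU_compl_stuck_pos (e := e) hP hw hsum
  set c := List.replicate K a ++ w.reverse with hc
  have hcE : ∀ b ∈ c, b ∈ spontaneousSymbols P := by
    intro b hb
    rcases List.mem_append.1 hb with hb | hb
    · exact (List.eq_of_mem_replicate hb) ▸ ha
    · exact hw b (List.mem_reverse.1 hb)
  have h_disj : Disjoint (Set.Ico (-(c.length : ℤ)) (-c.length + c.length)) (Set.Ici 0) := by
    rw [neg_add_cancel]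
    exact (Set.Iio_disjoint_Ici le_rfl).mono_left Set.Ico_subset_Iio_self
  rw [← lawU_isRegeneration_eq hP (-c.length)]
  calc 0 < lawU {U | Spells e P U (-c.length) c} * lawU (stuck e P w K N)ᶜ :=
        ENNReal.mul_pos (lawU_spells_pos hP _ hcE).ne' h_stuck.ne'
    _ = lawU ({U | Spells e P U (-c.length) c} ∩ (stuck e P w K N)ᶜ) :=
        (infinitePi_inter_of_dependsOn _ (measurableSet_spells _ c) (measurableSet_stuck K N).compl
          (dependsOn_spells _ c) (dependsOn_mem_compl (dependsOn_stuck K N)) h_disj).symm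
    _ ≤ lawU {U | IsRegeneration e P w U (-c.length)} := by
        refine measure_mono_ae ?_
        filter_upwards [ae_mem_Ico] with U hU
        rintro ⟨h_spells, h_notMem⟩
        refine isRegeneration_of_notMem_stuck (c := List.replicate K a) hP (by simp) ?_ h_notMem
          fun t => (hU t).1
        rw [run_of_spells hP h_spells, hc, List.reverse_append, List.reverse_reverse,
          List.reverse_replicate]

lemma ae_exists_ge (hP : IsKernel P) (hE : (spontaneousSymbols P).Nonempty)
    (hw : ∀ a ∈ w, a ∈ spontaneousSymbols P) (hsum : Summable fun k : ℕ => 1 - alphaW P w k) :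
    ∀ᵐ U ∂lawU, ∀ N : ℤ, ∃ s ≥ N, IsRegeneration e P w U s := by
  set E : ℤ → Set (ℤ → ℝ) := fun N => ⋃ s ∈ Set.Ici N, {U | IsRegeneration e P w U s}
  have h_meas (N : ℤ) : MeasurableSet (E N) :=
    .biUnion (Set.to_countable _) fun s _ => measurableSet_isRegeneration hP s
  have h_anti : Antitone E := fun M N hMN =>
    Set.biUnion_subset_biUnion_left (Set.Ici_subset_Ici.2 hMN)
  have h_dep (N : ℤ) : DependsOn (· ∈ E N) (Set.Ici N) :=
    dependsOn_mem_iUnion fun s => dependsOn_mem_iUnion fun hs =>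
      (dependsOn_isRegeneration s).mono (Set.Ici_subset_Ici.2 hs)
  have h_tail (k : ℤ) : DependsOn (· ∈ ⋂ N, E N) (Set.Ici k) := by
    have h_eq : ⋂ N, E N = ⋂ N, E (max N k) :=
      le_antisymm (Set.iInter_mono' fun N => ⟨max N k, le_rfl⟩)
        (Set.iInter_mono fun N => h_anti (le_max_left N k))
    intro U U' hU
    simp only [h_eq, Set.mem_iInter]
    exact propext <| forall_congr' fun N =>
      ((h_dep (max N k)).mono (Set.Ici_subset_Ici.2 (le_max_right N k)) hU).to_iff
  have h_pos : lawU (⋂ N, E N) ≠ 0 := by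
    have h_le : lawU {U | IsRegeneration e P w U 0} ≤ lawU (⋂ N, E N) := by
      refine ge_of_tendsto' (tendsto_measure_iInter_atTop
        (fun N => (h_meas N).nullMeasurableSet) h_anti ⟨0, measure_ne_top _ _⟩) fun N => ?_
      rw [← lawU_isRegeneration_eq hP N]
      exact measure_mono fun U hU => Set.mem_biUnion (Set.mem_Ici.2 le_rfl) hU
    exact ((lawU_isRegeneration_pos hP hE hw hsum).trans_le h_le).ne'
  have h_one : lawU (⋂ N, E N) = 1 :=
    (infinitePi_eq_zero_or_one_of_dependsOn_Ici _ (.iInter h_meas) h_tail).resolve_left h_pos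
  filter_upwards [(prob_compl_eq_zero_iff (.iInter h_meas)).2 h_one] with U hU N
  obtain ⟨s, hs, h_reg⟩ := Set.mem_iUnion₂.1 (Set.mem_iInter.1 hU N)
  exact ⟨s, hs, h_reg⟩

/-- None of the sites `0, …, k` is a regeneration. -/
def noRegeneration (e : A ↪ ℕ) (P : A → (ℕ → A) → ℝ) (w : List A) (k : ℕ) : Set (ℤ → ℝ) :=
  ⋂ s ∈ Set.Icc (0 : ℤ) k, {U | IsRegeneration e P w U s}ᶜ

lemma measurableSet_noRegeneration (hP : IsKernel P) (k : ℕ) :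
    MeasurableSet (noRegeneration e P w k) :=
  .biInter (Set.to_countable _) fun s _ => (measurableSet_isRegeneration hP s).compl

lemma tendsto_lawU_noRegeneration (hP : IsKernel P) (hE : (spontaneousSymbols P).Nonempty)
    (hw : ∀ a ∈ w, a ∈ spontaneousSymbols P) (hsum : Summable fun k : ℕ => 1 - alphaW P w k) :
    Filter.Tendsto (fun k => lawU (noRegeneration e P w k)) Filter.atTop (nhds 0) := by
  have h_anti : Antitone (noRegeneration e P w) := fun i j hij =>
    Set.biInter_subset_biInter_left (Set.Icc_subset_Icc_right (by exact_mod_cast hij))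
  have h_null : lawU (⋂ k, noRegeneration e P w k) = 0 := by
    refine measure_mono_null ?_ (ae_iff.1 (ae_exists_ge (e := e) hP hE hw hsum))
    intro U hU h_exists
    obtain ⟨s, hs, h_reg⟩ := h_exists 0
    obtain ⟨k, rfl⟩ := Int.eq_ofNat_of_zero_le hs
    exact Set.mem_iInter₂.1 (Set.mem_iInter.1 hU k) k ⟨hs, le_rfl⟩ h_reg
  rw [← h_null]
  exact tendsto_measure_iInter_atTop
    (fun k => (measurableSet_noRegeneration hP k).nullMeasurableSet) h_anti ⟨0, measure_ne_top _ _⟩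

lemma ae_exists_le (hP : IsKernel P) (hE : (spontaneousSymbols P).Nonempty)
    (hw : ∀ a ∈ w, a ∈ spontaneousSymbols P) (hsum : Summable fun k : ℕ => 1 - alphaW P w k) :
    ∀ᵐ U ∂lawU, ∀ N : ℤ, ∃ s ≤ N, IsRegeneration e P w U s := by
  refine ae_all_iff.2 fun N => ae_iff.2 <| le_antisymm
    (ge_of_tendsto' (tendsto_lawU_noRegeneration (e := e) hP hE hw hsum) fun k => ?_) zero_le
  rw [← lawU_preimage_shift (measurableSet_noRegeneration hP k) (N - k)]
  refine measure_mono fun U hU => Set.mem_iInter₂.2 fun s hs h_reg => hU ⟨s + (N - k), ?_, ?_⟩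
  · linarith [hs.2]
  · exact (isRegeneration_shift U s _).1 h_reg

lemma ae_isTypical (hP : IsKernel P) (hE : (spontaneousSymbols P).Nonempty)
    (hw : ∀ a ∈ w, a ∈ spontaneousSymbols P) (hsum : Summable fun k : ℕ => 1 - alphaW P w k) :
    ∀ᵐ U ∂lawU, IsTypical e P w U := by
  filter_upwards [ae_mem_Ico, ae_exists_le (e := e) hP hE hw hsum,
    ae_exists_ge (e := e) hP hE hw hsum] with U h_unif h_le h_ge
  exact ⟨h_unif, h_le, h_ge⟩

end Recurrence

section Compatibility

variable {e : A ↪ ℕ} {P : A → (ℕ → A) → ℝ} {w : List A}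

/-! ### Chains driven by the update function -/

lemma pastOf_eq (x : ℤ → A) : pastOf x = pastAt x 0 :=
  funext fun n => congrArg x (by ring)

lemma pastOf_shift (x : ℤ → A) (k : ℤ) : pastOf (shift k x) = pastAt x k :=
  funext fun n => congrArg x (by ring)

lemma pastOf_shift_one (x : ℤ → A) : pastOf (shift 1 x) = extend (x 0) (pastOf x) := by
  rw [pastOf_shift, pastOf_eq, ← pastAt_add_one, zero_add]

lemma pastOf_shift_apply_add (x : ℤ → A) (k n : ℕ) : pastOf (shift k x) (n + k) = pastOf x n :=
  congrArg x (by push_cast; ring)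

/-- The pasts whose most recent symbols are those of `c`, preceded by a past in `B`. -/
def prepend (B : Set (ℕ → A)) (c : List A) : Set (ℕ → A) :=
  {z | pre z c.length = c ∧ (fun n => z (n + c.length)) ∈ B}

lemma extend_mem_prepend_cons {B : Set (ℕ → A)} {a b : A} {c : List A} {z : ℕ → A} :
    extend b z ∈ prepend B (a :: c) ↔ b = a ∧ z ∈ prepend B c := by
  simp only [prepend, Set.mem_ofPred_eq, List.length_cons, pre_extend_succ, List.cons.injEq,
    and_assoc]
  rfl

section Chain

variable [Nonempty A]

lemma dependsOn_pastOf_chain : DependsOn (fun U => pastOf (chain e P w U)) (Set.Iio 0) :=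
  fun U U' hU => funext fun n => chain_congr fun i hi => hU i (by simp only [Set.mem_Iio]; lia)

lemma IsTypical.nextSymbol_eq (hP : IsKernel P) {U : ℤ → ℝ} (hU : IsTypical e P w U) (t : ℤ) :
    nextSymbol e P w (pastAt (chain e P w U) t) (U t) = chain e P w U t := by
  obtain ⟨s, hs, hR⟩ := hU.exists_le t
  exact InfiniteMemory.nextSymbol_eq hP (hR.mem_hitSet hP hs)

end Chain

variable [MeasurableSpace A]

lemma measurable_pastOf : Measurable (pastOf (A := A)) :=
  measurable_pi_lambda _ fun _ => measurable_pi_apply _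

lemma measurable_pastAt (t : ℤ) : Measurable fun x : ℤ → A => pastAt x t :=
  measurable_pi_lambda _ fun _ => measurable_pi_apply _

lemma measurable_tail (k : ℕ) : Measurable fun (z : ℕ → A) (n : ℕ) => z (n + k) :=
  measurable_pi_lambda _ fun _ => measurable_pi_apply _

lemma measurePreserving_shift_natCast {ν : Measure (ℤ → A)}
    (hν : MeasurePreserving (shift 1) ν ν) (k : ℕ) : MeasurePreserving (shift (k : ℤ)) ν ν := by
  induction k with
  | zero =>
    convert MeasurePreserving.id ν
    exact funext fun x => funext fun i => congrArg x (add_zero i)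
  | succ k ih =>
    convert hν.comp ih using 1
    exact funext fun x => funext fun i => congrArg x (by push_cast; ring)

lemma measure_pastOf_tail {ν : Measure (ℤ → A)} (hν : MeasurePreserving (shift 1) ν ν)
    {B : Set (ℕ → A)} (hB : MeasurableSet B) (k : ℕ) :
    ν (pastOf ⁻¹' ((fun (z : ℕ → A) (n : ℕ) => z (n + k)) ⁻¹' B)) = ν (pastOf ⁻¹' B) := by
  rw [← (measurePreserving_shift_natCast hν k).measure_preimage
    (measurable_pastOf (measurable_tail k hB)).nullMeasurableSet]
  congr 1
  ext x
  simp only [Set.mem_preimage, pastOf_shift_apply_add]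

/-- Given the past, each symbol `a` comes next with probability at least `α(a)`. -/
def Minorized (P : A → (ℕ → A) → ℝ) (ν : Measure (ℤ → A)) : Prop :=
  ∀ B : Set (ℕ → A), MeasurableSet B → ∀ a : A,
    ENNReal.ofReal (lowerProb P a []) * ν (pastOf ⁻¹' B) ≤ ν (pastOf ⁻¹' B ∩ {x | x 0 = a})

/-- With the chain `ν`, the symbol after the past is obtained from the past and an independent
uniform variable by means of the update function. -/
def FollowsUpdate [Nonempty A] (e : A ↪ ℕ) (P : A → (ℕ → A) → ℝ) (w : List A)
    (ν : Measure (ℤ → A)) : Prop :=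
  ν.map (fun x => (pastOf x, x 0)) =
    ((ν.map pastOf).prod unif).map fun p => (p.1, nextSymbol e P w p.1 p.2)

variable [Countable A] [DiscreteMeasurableSpace A]

lemma ext_of_prod_singleton {X : Type*} [MeasurableSpace X] {μ ν : Measure (X × A)}
    (h : ∀ B : Set X, MeasurableSet B → ∀ a, μ (B ×ˢ {a}) = ν (B ×ˢ {a})) : μ = ν := by
  ext S hS
  have h_section (a : A) : MeasurableSet {x | (x, a) ∈ S} := measurable_prodMk_right hS
  have h_union : S = ⋃ a, {x | (x, a) ∈ S} ×ˢ {a} := by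
    ext ⟨x, a⟩
    simp
  have h_disjoint : Pairwise (Function.onFun Disjoint fun a => {x | (x, a) ∈ S} ×ˢ {a}) :=
    fun a b hab => Set.disjoint_prod.2 (Or.inr (Set.disjoint_singleton.2 hab))
  rw [h_union, measure_iUnion h_disjoint fun a => (h_section a).prod (measurableSet_singleton a),
    measure_iUnion h_disjoint fun a => (h_section a).prod (measurableSet_singleton a)]
  exact tsum_congr fun a => h _ (h_section a) a

lemma measurableSet_coord_eq (t : ℤ) (a : A) : MeasurableSet {x : ℤ → A | x t = a} :=
  (measurable_pi_apply t : Measurable fun x : ℤ → A => x t) (measurableSet_singleton a)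

lemma integrable_indicator_coord_eq (ν : Measure (ℤ → A)) [IsFiniteMeasure ν] (t : ℤ) (a : A) :
    Integrable (Set.indicator {x : ℤ → A | x t = a} fun _ => (1 : ℝ)) ν :=
  (integrable_const 1).indicator (measurableSet_coord_eq t a)

lemma setIntegral_indicator_coord_eq (ν : Measure (ℤ → A)) (E : Set (ℤ → A)) (t : ℤ) (a : A) :
    ∫ x in E, Set.indicator {x : ℤ → A | x t = a} (fun _ => (1 : ℝ)) x ∂ν =
      ν.real (E ∩ {x | x t = a}) := by
  rw [setIntegral_indicator (measurableSet_coord_eq t a), setIntegral_const, smul_eq_mul, mul_one]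

lemma measurableSet_prepend {B : Set (ℕ → A)} (hB : MeasurableSet B) (c : List A) :
    MeasurableSet (prepend B c) :=
  (measurable_pre _ (measurableSet_singleton c)).inter (measurable_tail _ hB)

lemma measure_prepend_cons {ν : Measure (ℤ → A)} (hν : MeasurePreserving (shift 1) ν ν)
    {B : Set (ℕ → A)} (hB : MeasurableSet B) (a : A) (c : List A) :
    ν (pastOf ⁻¹' prepend B (a :: c)) = ν (pastOf ⁻¹' prepend B c ∩ {x | x 0 = a}) := by
  rw [← hν.measure_preimage (measurable_pastOf (measurableSet_prepend hB _)).nullMeasurableSet]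
  congr 1
  ext x
  rw [Set.mem_preimage, Set.mem_preimage, pastOf_shift_one, extend_mem_prepend_cons, and_comm]
  rfl

lemma exists_le_measure_prepend {ν : Measure (ℤ → A)} (hν : MeasurePreserving (shift 1) ν ν)
    (hmin : Minorized P ν) {B : Set (ℕ → A)} (hB : MeasurableSet B) {c : List A}
    (hc : ∀ a ∈ c, a ∈ spontaneousSymbols P) :
    ∃ δ : ℝ≥0∞, δ ≠ 0 ∧ δ * ν (pastOf ⁻¹' B) ≤ ν (pastOf ⁻¹' prepend B c) := by
  induction c with
  | nil => exact ⟨1, one_ne_zero, by simp [prepend, Set.preimage]⟩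
  | cons a c ih =>
    obtain ⟨δ, hδ, hle⟩ := ih fun b hb => hc b (List.mem_cons_of_mem _ hb)
    refine ⟨ENNReal.ofReal (lowerProb P a []) * δ,
      mul_ne_zero (ENNReal.ofReal_pos.2 (hc a List.mem_cons_self)).ne' hδ, ?_⟩
    calc ENNReal.ofReal (lowerProb P a []) * δ * ν (pastOf ⁻¹' B)
        ≤ ENNReal.ofReal (lowerProb P a []) * ν (pastOf ⁻¹' prepend B c) := by
          rw [mul_assoc]; gcongr
      _ ≤ ν (pastOf ⁻¹' prepend B c ∩ {x | x 0 = a}) := hmin _ (measurableSet_prepend hB c) a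
      _ = ν (pastOf ⁻¹' prepend B (a :: c)) := (measure_prepend_cons hν hB a c).symm

lemma ae_hasWord {ν : Measure (ℤ → A)} [IsFiniteMeasure ν] (hν : MeasurePreserving (shift 1) ν ν)
    (hmin : Minorized P ν) (hw : ∀ a ∈ w, a ∈ spontaneousSymbols P) :
    ∀ᵐ x ∂ν, HasWord w (pastOf x) := by
  set B : Set (ℕ → A) := {z | HasWord w z}ᶜ
  have hB : MeasurableSet B := measurableSet_hasWord.compl
  have h_subset : pastOf ⁻¹' B ∪ pastOf ⁻¹' prepend B w ⊆
      pastOf ⁻¹' ((fun (z : ℕ → A) (n : ℕ) => z (n + w.length)) ⁻¹' B) :=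
    Set.union_subset (fun x hx h => hx h.of_tail) fun x hx => hx.2
  have h_disjoint : Disjoint (pastOf ⁻¹' B) (pastOf ⁻¹' prepend B w) :=
    Set.disjoint_left.2 fun x hx hx' => hx ⟨0, hx'.1⟩
  have h_prepend : ν (pastOf ⁻¹' prepend B w) = 0 := by
    have h_le := measure_mono (μ := ν) h_subset
    rw [measure_union h_disjoint (measurable_pastOf (measurableSet_prepend hB w)),
      measure_pastOf_tail hν hB] at h_le
    exact nonpos_iff_eq_zero.1
      ((ENNReal.add_le_add_iff_left (measure_ne_top ν (pastOf ⁻¹' B))).1 (by rwa [add_zero]))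
  obtain ⟨δ, hδ, hle⟩ := exists_le_measure_prepend hν hmin hB hw
  rw [h_prepend, nonpos_iff_eq_zero, mul_eq_zero] at hle
  exact hle.resolve_left hδ

lemma IsStationaryCompatible.measure_eq (hP : IsKernel P) {ν : Measure (ℤ → A)}
    (hν : IsStationaryCompatible P ν) {B : Set (ℕ → A)} (hB : MeasurableSet B) (a : A) :
    ν (pastOf ⁻¹' B ∩ {x | x 0 = a}) =
      ∫⁻ x in pastOf ⁻¹' B, ENNReal.ofReal (P a (pastOf x)) ∂ν := by
  have := hν.isProbabilityMeasure
  have h_integral : ∫ x in pastOf ⁻¹' B, P a (pastOf x) ∂ν =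
      ν.real (pastOf ⁻¹' B ∩ {x | x 0 = a}) := by
    rw [← setIntegral_indicator_coord_eq, ← setIntegral_condExp measurable_pastOf.comap_le
      (integrable_indicator_coord_eq ν 0 a) ⟨B, hB, rfl⟩]
    exact setIntegral_congr_ae (measurable_pastOf hB)
      ((hν.compatible a).mono fun x hx _ => hx.symm)
  rw [← ofReal_integral_eq_lintegral_ofReal
    (integrable_condExp.congr (hν.compatible a)).integrableOn (.of_forall fun x => hP.nonneg _ _),
    h_integral, ofReal_measureReal]

lemma IsStationaryCompatible.minorized (hP : IsKernel P) {ν : Measure (ℤ → A)}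
    (hν : IsStationaryCompatible P ν) : Minorized P ν := by
  intro B hB a
  rw [hν.measure_eq hP hB, ← setLIntegral_const]
  exact lintegral_mono fun x => ENNReal.ofReal_le_ofReal (lowerProb_pre_le hP a _ 0)

lemma map_pastOf_prodMk_prod_singleton (ν : Measure (ℤ → A)) {B : Set (ℕ → A)}
    (hB : MeasurableSet B) (a : A) :
    ν.map (fun x => (pastOf x, x 0)) (B ×ˢ {a}) = ν (pastOf ⁻¹' B ∩ {x | x 0 = a}) :=
  Measure.map_apply (measurable_pastOf.prodMk (measurable_pi_apply 0))
    (hB.prod (measurableSet_singleton a))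

variable [Nonempty A]

lemma measurable_unif_nextSymbol (hP : IsKernel P) (a : A) :
    Measurable fun z => unif {u | nextSymbol e P w z u = a} :=
  measurable_measure_prodMk_left (ν := unif)
    (s := {p : (ℕ → A) × ℝ | nextSymbol e P w p.1 p.2 = a})
    (measurable_nextSymbol hP (measurableSet_singleton a))

lemma measurable_pair_nextSymbol (hP : IsKernel P) :
    Measurable fun p : (ℕ → A) × ℝ => (p.1, nextSymbol e P w p.1 p.2) :=
  measurable_fst.prodMk (measurable_nextSymbol hP)

lemma map_pair_nextSymbol_prod_singleton (hP : IsKernel P) (ρ : Measure (ℕ → A))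
    {B : Set (ℕ → A)} (hB : MeasurableSet B) (a : A) :
    (ρ.prod unif).map (fun p => (p.1, nextSymbol e P w p.1 p.2)) (B ×ˢ {a}) =
      ∫⁻ z in B, unif {u | nextSymbol e P w z u = a} ∂ρ := by
  have h_set := hB.prod (measurableSet_singleton a)
  rw [Measure.map_apply (measurable_pair_nextSymbol hP) h_set,
    Measure.prod_apply (measurable_pair_nextSymbol hP h_set), ← lintegral_indicator hB]
  refine lintegral_congr fun z => ?_
  by_cases hz : z ∈ B <;> simp [hz, Set.preimage]

lemma followsUpdate_iff (hP : IsKernel P) {ν : Measure (ℤ → A)} :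
    FollowsUpdate e P w ν ↔ ∀ B : Set (ℕ → A), MeasurableSet B → ∀ a : A,
      ν (pastOf ⁻¹' B ∩ {x | x 0 = a}) =
        ∫⁻ z in B, unif {u | nextSymbol e P w z u = a} ∂(ν.map pastOf) := by
  refine ⟨fun hν B hB a => ?_, fun h => ext_of_prod_singleton fun B hB a => ?_⟩
  · rw [← map_pastOf_prodMk_prod_singleton ν hB, hν, map_pair_nextSymbol_prod_singleton hP _ hB]
  · rw [map_pastOf_prodMk_prod_singleton ν hB, h B hB, map_pair_nextSymbol_prod_singleton hP _ hB]

lemma FollowsUpdate.minorized (hP : IsKernel P) {ν : Measure (ℤ → A)}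
    (hν : FollowsUpdate e P w ν) : Minorized P ν := by
  intro B hB a
  rw [(followsUpdate_iff hP).1 hν B hB, ← Measure.map_apply measurable_pastOf hB,
    ← setLIntegral_const, ← unif_intervalI (e := e) hP]
  exact lintegral_mono fun z => measure_mono fun u hu => nextSymbol_eq hP ⟨0, Or.inl hu⟩

lemma FollowsUpdate.condExp_ae_eq (hP : IsKernel P) {ν : Measure (ℤ → A)} [IsFiniteMeasure ν]
    (hν : FollowsUpdate e P w ν) (a : A) :
    ν[Set.indicator {x : ℤ → A | x 0 = a} (fun _ => (1 : ℝ)) |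
      MeasurableSpace.comap (pastOf (A := A)) MeasurableSpace.pi] =ᵐ[ν]
        fun x => unif.real {u | nextSymbol e P w (pastOf x) u = a} := by
  set q : (ℕ → A) → ℝ := fun z => unif.real {u | nextSymbol e P w z u = a}
  have hq_meas : Measurable q := (measurable_unif_nextSymbol hP a).ennreal_toReal
  have hq_int : Integrable (fun x => q (pastOf x)) ν :=
    Integrable.of_bound (hq_meas.comp measurable_pastOf).aestronglyMeasurable 1
      (.of_forall fun x => (Real.norm_of_nonneg measureReal_nonneg).trans_le measureReal_le_one)
  refine (ae_eq_condExp_of_forall_setIntegral_eq measurable_pastOf.comap_le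
    (integrable_indicator_coord_eq ν 0 a) (fun _ _ _ => hq_int.integrableOn) ?_
    (hq_meas.comp (comap_measurable _)).aestronglyMeasurable).symm
  rintro _ ⟨B, hB, rfl⟩ -
  rw [setIntegral_indicator_coord_eq, Measure.real, (followsUpdate_iff hP).1 hν B hB a,
    ← setIntegral_map (f := q) (g := pastOf) hB hq_meas.aestronglyMeasurable
      measurable_pastOf.aemeasurable]
  exact integral_toReal (measurable_unif_nextSymbol hP a).aemeasurable
    (.of_forall fun z => measure_lt_top _ _)

lemma FollowsUpdate.isStationaryCompatible (hP : IsKernel P)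
    (hsum : Summable fun k : ℕ => 1 - alphaW P w k) {ν : Measure (ℤ → A)}
    [IsProbabilityMeasure ν] (hν : FollowsUpdate e P w ν)
    (hstat : MeasurePreserving (shift 1) ν ν) (hw : ∀ a ∈ w, a ∈ spontaneousSymbols P) :
    IsStationaryCompatible P ν where
  isProbabilityMeasure := inferInstance
  stationary := hstat
  compatible a := (hν.condExp_ae_eq hP a).trans <| by
    filter_upwards [ae_hasWord hstat (hν.minorized hP) hw] with x hx
    rw [Measure.real, unif_nextSymbol_eq hP hsum hx, ENNReal.toReal_ofReal (hP.nonneg _ _)]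

lemma IsStationaryCompatible.followsUpdate (hP : IsKernel P)
    (hsum : Summable fun k : ℕ => 1 - alphaW P w k) {ν : Measure (ℤ → A)}
    (hν : IsStationaryCompatible P ν) (hw : ∀ a ∈ w, a ∈ spontaneousSymbols P) :
    FollowsUpdate e P w ν := by
  have := hν.isProbabilityMeasure
  refine (followsUpdate_iff hP).2 fun B hB a => ?_
  rw [hν.measure_eq hP hB, setLIntegral_map hB (measurable_unif_nextSymbol hP a) measurable_pastOf]
  refine lintegral_congr_ae (ae_restrict_of_ae ?_)
  filter_upwards [ae_hasWord hν.stationary (hν.minorized hP) hw] with x hx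
  exact (unif_nextSymbol_eq hP hsum hx a).symm

end Compatibility

section ChainLaw

variable {e : A ↪ ℕ} {P : A → (ℕ → A) → ℝ} {w : List A}
variable [Nonempty A] [MeasurableSpace A] [Countable A]

/-! ### The law of the constructed chain -/

lemma isProbabilityMeasure_map_chain (hP : IsKernel P) :
    IsProbabilityMeasure (lawU.map (chain e P w)) :=
  Measure.isProbabilityMeasure_map (measurable_chain hP).aemeasurable

lemma measurePreserving_shift_map_chain (hP : IsKernel P) :
    MeasurePreserving (shift 1) (lawU.map (chain e P w)) (lawU.map (chain e P w)) := by
  refine ⟨measurable_shift 1, ?_⟩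
  have h_comm : shift 1 ∘ chain e P w = chain e P w ∘ shift 1 :=
    funext fun U => (chain_shift U 1).symm
  rw [Measure.map_map (measurable_shift 1) (measurable_chain hP), h_comm,
    ← Measure.map_map (measurable_chain hP) (measurable_shift 1),
    (measurePreserving_shift 1).map_eq]

lemma map_pastOf_chain_prodMk (hP : IsKernel P) :
    lawU.map (fun U => (pastOf (chain e P w U), U 0)) =
      ((lawU.map (chain e P w)).map pastOf).prod unif := by
  have h_meas : Measurable fun U => pastOf (chain e P w U) :=
    measurable_pastOf.comp (measurable_chain hP)
  have h_indep : IndepFun (fun U => pastOf (chain e P w U)) (fun U => U 0) lawU :=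
    indepFun_infinitePi_of_dependsOn _ h_meas (measurable_pi_apply 0) dependsOn_pastOf_chain
      (T := {0}) (fun U U' hU => hU 0 rfl) (Set.disjoint_singleton_right.2 Set.self_notMem_Iio)
  rw [(indepFun_iff_map_prod_eq_prod_map_map h_meas.aemeasurable
    (measurable_pi_apply 0).aemeasurable).1 h_indep,
    Measure.map_map measurable_pastOf (measurable_chain hP)]
  congr 1
  exact Measure.infinitePi_map_eval (fun _ : ℤ => unif) 0

variable [DiscreteMeasurableSpace A]

lemma followsUpdate_map_chain (hP : IsKernel P) (hE : (spontaneousSymbols P).Nonempty)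
    (hw : ∀ a ∈ w, a ∈ spontaneousSymbols P) (hsum : Summable fun k : ℕ => 1 - alphaW P w k) :
    FollowsUpdate e P w (lawU.map (chain e P w)) := by
  have h_pair : Measurable fun x : ℤ → A => (pastOf x, x 0) :=
    measurable_pastOf.prodMk (measurable_pi_apply 0)
  have h_input : Measurable fun U => (pastOf (chain e P w U), U 0) :=
    (measurable_pastOf.comp (measurable_chain hP)).prodMk (measurable_pi_apply 0)
  rw [FollowsUpdate, Measure.map_map h_pair (measurable_chain hP), ← map_pastOf_chain_prodMk hP,
    Measure.map_map (measurable_pair_nextSymbol hP) h_input]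
  refine Measure.map_congr ?_
  filter_upwards [ae_isTypical (e := e) hP hE hw hsum] with U hU
  exact Prod.ext rfl (by simp only [Function.comp_apply, pastOf_eq, hU.nextSymbol_eq hP])

lemma isStationaryCompatible_map_chain (hP : IsKernel P) (hE : (spontaneousSymbols P).Nonempty)
    (hw : ∀ a ∈ w, a ∈ spontaneousSymbols P) (hsum : Summable fun k : ℕ => 1 - alphaW P w k) :
    IsStationaryCompatible P (lawU.map (chain e P w)) :=
  have := isProbabilityMeasure_map_chain (e := e) (w := w) hP
  (followsUpdate_map_chain hP hE hw hsum).isStationaryCompatible hP hsum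
    (measurePreserving_shift_map_chain hP) hw

end ChainLaw

section Uniqueness

variable {e : A ↪ ℕ} {P : A → (ℕ → A) → ℝ} {w : List A}

/-! ### Uniqueness -/

lemma pre_eq_of_le {z z' : ℕ → A} {n j : ℕ} (h : pre z n = pre z' n) (hj : j ≤ n) :
    pre z j = pre z' j := by
  rw [← take_pre z hj, h, take_pre z' hj]

variable [Nonempty A]

/-- The past of time `k` that results from the past `z` of time `0` when the update function is
applied at the sites `0, …, k - 1`. -/
noncomputable def evolve (e : A ↪ ℕ) (P : A → (ℕ → A) → ℝ) (w : List A) (z : ℕ → A)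
    (U : ℤ → ℝ) : ℕ → ℕ → A
  | 0 => z
  | k + 1 => extend (nextSymbol e P w (evolve e P w z U k) (U k)) (evolve e P w z U k)

lemma dependsOn_evolve (z : ℕ → A) (k : ℕ) :
    DependsOn (fun U => evolve e P w z U k) (Set.Iio (k : ℤ)) := by
  intro U U' hU
  induction k with
  | zero => rfl
  | succ k ih =>
    have hk := ih fun i hi => hU i (lt_trans (Set.mem_Iio.1 hi) (by push_cast; lia))
    simp only [evolve, hk, hU k (Set.mem_Iio.2 (by push_cast; lia))]

lemma pre_evolve (hP : IsKernel P) (z : ℕ → A) {U : ℤ → ℝ} {s : ℕ}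
    (hs : IsRegeneration e P w U s) (n : ℕ) :
    pre (evolve e P w z U (s + n)) n = pre (pastAt (chain e P w U) ((s + n : ℕ) : ℤ)) n := by
  induction n with
  | zero => rfl
  | succ n ih =>
    have h_next : nextSymbol e P w (evolve e P w z U (s + n)) (U ((s + n : ℕ) : ℤ)) =
        chain e P w U ((s + n : ℕ) : ℤ) := by
      refine nextSymbol_eq hP ⟨n, ?_⟩
      rw [ih]
      exact_mod_cast hs.determines hP n
    rw [← add_assoc, evolve, pre_extend_succ, h_next, ih, Nat.cast_succ, pre_pastAt_succ]

lemma pre_evolve_of_notMem_noRegeneration (hP : IsKernel P) (z : ℕ → A) {U : ℤ → ℝ} {k : ℕ}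
    (hU : U ∉ noRegeneration e P w k) (j : ℕ) :
    pre (evolve e P w z U (k + j)) j = pre (pastAt (chain e P w U) ((k + j : ℕ) : ℤ)) j := by
  simp only [noRegeneration, Set.mem_iInter, not_forall, Set.mem_compl_iff, not_not] at hU
  obtain ⟨s, hs, hR⟩ := hU
  obtain ⟨s, rfl⟩ := Int.eq_ofNat_of_zero_le hs.1
  obtain ⟨i, rfl⟩ := Nat.exists_eq_add_of_le (Nat.cast_le.1 hs.2)
  have h_pre := pre_evolve hP z hR (i + j)
  rw [← add_assoc] at h_pre
  exact pre_eq_of_le h_pre (Nat.le_add_left j i)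

variable [MeasurableSpace A] [Countable A] [DiscreteMeasurableSpace A]

lemma measurable_evolve (hP : IsKernel P) (k : ℕ) :
    Measurable fun p : (ℕ → A) × (ℤ → ℝ) => evolve e P w p.1 p.2 k := by
  induction k with
  | zero => exact measurable_fst
  | succ k ih =>
    exact measurable_extend.comp (((measurable_nextSymbol hP).comp
      (ih.prodMk ((measurable_pi_apply (k : ℤ)).comp measurable_snd))).prodMk ih)

lemma measurable_extend_nextSymbol (hP : IsKernel P) :
    Measurable fun p : (ℕ → A) × ℝ => extend (nextSymbol e P w p.1 p.2) p.1 :=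
  measurable_extend.comp ((measurable_nextSymbol hP).prodMk measurable_fst)

lemma map_extend_nextSymbol (hP : IsKernel P) {ν : Measure (ℤ → A)}
    (hν : MeasurePreserving (shift 1) ν ν) (hF : FollowsUpdate e P w ν) :
    ((ν.map pastOf).prod unif).map (fun p => extend (nextSymbol e P w p.1 p.2) p.1) =
      ν.map pastOf := by
  have h_extend : Measurable fun p : (ℕ → A) × A => extend p.2 p.1 :=
    measurable_extend.comp measurable_swap
  calc ((ν.map pastOf).prod unif).map (fun p => extend (nextSymbol e P w p.1 p.2) p.1)
      = (((ν.map pastOf).prod unif).map fun p => (p.1, nextSymbol e P w p.1 p.2)).map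
          fun p => extend p.2 p.1 :=
        (Measure.map_map h_extend (measurable_pair_nextSymbol hP)).symm
    _ = ν.map fun x => extend (x 0) (pastOf x) := by
        rw [← hF, Measure.map_map h_extend (measurable_pastOf.prodMk (measurable_pi_apply 0))]
        rfl
    _ = (ν.map (shift 1)).map pastOf := by
        rw [Measure.map_map measurable_pastOf hν.measurable]
        exact congrArg (ν.map ·) (funext fun x => (pastOf_shift_one x).symm)
    _ = ν.map pastOf := by rw [hν.map_eq]

lemma map_evolve_prodMk (hP : IsKernel P) (ρ : Measure (ℕ → A)) [IsFiniteMeasure ρ] (k : ℕ) :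
    (ρ.prod lawU).map (fun p => (evolve e P w p.1 p.2 k, p.2 (k : ℤ))) =
      ((ρ.prod lawU).map fun p => evolve e P w p.1 p.2 k).prod unif := by
  have h_evolve := measurable_evolve (e := e) (w := w) hP k
  have h_coord : Measurable fun p : (ℕ → A) × (ℤ → ℝ) => p.2 (k : ℤ) :=
    (measurable_pi_apply (k : ℤ)).comp measurable_snd
  refine (Measure.prod_eq fun s t hs ht => ?_).symm
  rw [Measure.map_apply (h_evolve.prodMk h_coord) (hs.prod ht), Measure.map_apply h_evolve hs,
    Measure.prod_apply (h_evolve hs), Measure.prod_apply ((h_evolve.prodMk h_coord) (hs.prod ht)),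
    ← lintegral_mul_const _ (measurable_measure_prodMk_left (h_evolve hs))]
  refine lintegral_congr fun z => ?_
  rw [← lawU_eval (k : ℤ) ht]
  exact (indepFun_infinitePi_of_dependsOn _ (h_evolve.comp measurable_prodMk_left)
    (measurable_pi_apply (k : ℤ)) (dependsOn_evolve z k) (T := {(k : ℤ)})
    (fun U U' hU => hU k rfl)
    (Set.disjoint_singleton_right.2 Set.self_notMem_Iio)).measure_inter_preimage_eq_mul s t hs ht

lemma map_evolve (hP : IsKernel P) {ν : Measure (ℤ → A)} [IsFiniteMeasure ν]
    (hν : MeasurePreserving (shift 1) ν ν) (hF : FollowsUpdate e P w ν) (k : ℕ) :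
    ((ν.map pastOf).prod lawU).map (fun p => evolve e P w p.1 p.2 k) = ν.map pastOf := by
  have h_coord (k : ℕ) : Measurable fun p : (ℕ → A) × (ℤ → ℝ) => p.2 (k : ℤ) :=
    (measurable_pi_apply (k : ℤ)).comp measurable_snd
  induction k with
  | zero => exact measurePreserving_fst.map_eq
  | succ k ih =>
    conv_rhs => rw [← map_extend_nextSymbol hP hν hF, ← ih, ← map_evolve_prodMk hP,
      Measure.map_map (measurable_extend_nextSymbol hP)
        ((measurable_evolve hP k).prodMk (h_coord k))]
    rfl

lemma map_pre_pastOf_apply (hP : IsKernel P) {ν : Measure (ℤ → A)} [IsFiniteMeasure ν]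
    (hν : MeasurePreserving (shift 1) ν ν) (hF : FollowsUpdate e P w ν) (j k : ℕ)
    (L : Set (List A)) :
    ν.map (fun x => pre (pastOf x) j) L =
      ((ν.map pastOf).prod lawU) {p | pre (evolve e P w p.1 p.2 k) j ∈ L} := by
  rw [← Function.comp_def (fun z => pre z j),
    ← Measure.map_map (measurable_pre j) measurable_pastOf]
  conv_lhs => rw [← map_evolve hP hν hF k]
  rw [Measure.map_map (measurable_pre j) (measurable_evolve hP k),
    Measure.map_apply ((measurable_pre j).comp (measurable_evolve hP k)) (.of_discrete)]
  rfl

lemma map_pre_pastOf_chain_apply (hP : IsKernel P) (j k : ℕ) (L : Set (List A)) :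
    (lawU.map (chain e P w)).map (fun x => pre (pastOf x) j) L =
      lawU {U | pre (pastAt (chain e P w U) k) j ∈ L} := by
  have h_pre : Measurable fun x : ℤ → A => pre (pastOf x) j :=
    (measurable_pre j).comp measurable_pastOf
  have h_shift := measurePreserving_shift_natCast
    (measurePreserving_shift_map_chain (e := e) (w := w) hP) k
  conv_lhs => rw [← h_shift.map_eq]
  rw [Measure.map_map h_pre h_shift.measurable, Measure.map_map (h_pre.comp h_shift.measurable)
    (measurable_chain hP), Measure.map_apply ((h_pre.comp h_shift.measurable).comp
    (measurable_chain hP)) .of_discrete]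
  simp only [Set.preimage, Function.comp_apply, pastOf_shift]

/- Coupling: both chains are driven by the same `U`, and from the first regeneration on their
symbols agree, whatever the past of time `0`. -/
lemma map_pre_pastOf_le (hP : IsKernel P) {ν : Measure (ℤ → A)} [IsProbabilityMeasure ν]
    (hν : MeasurePreserving (shift 1) ν ν) (hF : FollowsUpdate e P w ν) (j k : ℕ)
    (L : Set (List A)) :
    ν.map (fun x => pre (pastOf x) j) L ≤
      (lawU.map (chain e P w)).map (fun x => pre (pastOf x) j) L +
        lawU (noRegeneration e P w k) := by
  have := Measure.isProbabilityMeasure_map (μ := ν) (measurable_pastOf (A := A)).aemeasurable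
  have h_subset : {p : (ℕ → A) × (ℤ → ℝ) | pre (evolve e P w p.1 p.2 (k + j)) j ∈ L} ⊆
      Set.univ ×ˢ ({U | pre (pastAt (chain e P w U) ((k + j : ℕ) : ℤ)) j ∈ L} ∪
        noRegeneration e P w k) := by
    rintro ⟨z, U⟩ h
    refine ⟨trivial, or_iff_not_imp_right.2 fun hU => ?_⟩
    rw [Set.mem_ofPred_eq, ← pre_evolve_of_notMem_noRegeneration hP z hU]
    exact h
  rw [map_pre_pastOf_apply hP hν hF j (k + j), map_pre_pastOf_chain_apply hP j (k + j)]
  refine (measure_mono h_subset).trans ?_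
  rw [Measure.prod_prod, measure_univ, one_mul]
  exact measure_union_le _ _

lemma map_pre_pastOf_eq (hP : IsKernel P) (hE : (spontaneousSymbols P).Nonempty)
    (hw : ∀ a ∈ w, a ∈ spontaneousSymbols P) (hsum : Summable fun k : ℕ => 1 - alphaW P w k)
    {ν : Measure (ℤ → A)} [IsProbabilityMeasure ν] (hν : MeasurePreserving (shift 1) ν ν)
    (hF : FollowsUpdate e P w ν) (j : ℕ) :
    ν.map (fun x => pre (pastOf x) j) =
      (lawU.map (chain e P w)).map (fun x => pre (pastOf x) j) := by
  have h_pre : AEMeasurable (fun x : ℤ → A => pre (pastOf x) j) ν :=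
    ((measurable_pre j).comp measurable_pastOf).aemeasurable
  have h_pre' : AEMeasurable (fun x : ℤ → A => pre (pastOf x) j) (lawU.map (chain e P w)) :=
    ((measurable_pre j).comp measurable_pastOf).aemeasurable
  have := isProbabilityMeasure_map_chain (e := e) (w := w) hP
  have := Measure.isProbabilityMeasure_map h_pre
  have := Measure.isProbabilityMeasure_map h_pre'
  refine Measure.eq_of_le_of_measure_univ_eq (Measure.le_iff.2 fun L _ => ?_) (by simp)
  have h_lim := (tendsto_lawU_noRegeneration (e := e) hP hE hw hsum).const_add
    ((lawU.map (chain e P w)).map (fun x => pre (pastOf x) j) L)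
  rw [add_zero] at h_lim
  exact ge_of_tendsto' h_lim fun k => map_pre_pastOf_le hP hν hF j k L

lemma eq_of_map_pre_pastOf_eq {ν μ : Measure (ℤ → A)} [IsFiniteMeasure ν]
    (hν : MeasurePreserving (shift 1) ν ν) (hμ : MeasurePreserving (shift 1) μ μ)
    (h : ∀ j, ν.map (fun x => pre (pastOf x) j) = μ.map (fun x => pre (pastOf x) j)) : ν = μ := by
  refine IsProjectiveLimit.unique (P := fun I => ν.map I.restrict) (fun I => rfl) fun I => ?_
  obtain ⟨k, hk⟩ : ∃ k : ℕ, ∀ i ∈ I, -(k : ℤ) ≤ i ∧ i < k := by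
    refine ⟨I.sup Int.natAbs + 1, fun i hi => ?_⟩
    have := Finset.le_sup (f := Int.natAbs) hi
    lia
  let read : List A → I → A := fun l i => l.getD ((k : ℤ) - 1 - i).toNat (Classical.arbitrary A)
  have h_pre : Measurable fun x : ℤ → A => pre (pastOf x) (2 * k) :=
    (measurable_pre _).comp measurable_pastOf
  have h_restrict {ρ : Measure (ℤ → A)} (hρ : MeasurePreserving (shift 1) ρ ρ) :
      ρ.map I.restrict = (ρ.map fun x => pre (pastOf x) (2 * k)).map read := by
    have h_shift := measurePreserving_shift_natCast hρ k
    conv_rhs => rw [← h_shift.map_eq]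
    rw [Measure.map_map h_pre h_shift.measurable,
      Measure.map_map .of_discrete (h_pre.comp h_shift.measurable)]
    congr 1
    ext x i
    have hi := hk i i.2
    simp only [Function.comp_apply, read, pastOf_shift, Finset.restrict]
    rw [List.getD_eq_getElem _ _ (by rw [length_pre]; lia)]
    simp only [pre, List.getElem_map, List.getElem_range, pastAt]
    congr 1
    lia
  change μ.map I.restrict = ν.map I.restrict
  rw [h_restrict hν, h_restrict hμ, h]

lemma IsStationaryCompatible.eq_map_chain (hP : IsKernel P) (hE : (spontaneousSymbols P).Nonempty)
    (hw : ∀ a ∈ w, a ∈ spontaneousSymbols P) (hsum : Summable fun k : ℕ => 1 - alphaW P w k)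
    {ν : Measure (ℤ → A)} (hν : IsStationaryCompatible P ν) : ν = lawU.map (chain e P w) := by
  have := hν.isProbabilityMeasure
  have := isProbabilityMeasure_map_chain (e := e) (w := w) hP
  exact eq_of_map_pre_pastOf_eq hν.stationary (measurePreserving_shift_map_chain hP)
    (map_pre_pastOf_eq hP hE hw hsum hν.stationary (hν.followsUpdate hP hsum hw))

end Uniqueness

section Cycles

variable {e : A ↪ ℕ} {P : A → (ℕ → A) → ℝ} {w : List A}

/-! ### Cycles between regenerations -/

lemma reverse_pre_pastAt (x : ℤ → A) (s t : ℤ) :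
    (pre (pastAt x t) (t - s).toNat).reverse = block x s t := by
  rw [block, bind_range_natCast, List.map_map]
  refine List.ext_getElem (by simp) fun i h _ => ?_
  simp only [List.length_reverse, length_pre] at h
  simp only [pre, pastAt, Function.comp_apply, List.getElem_reverse, List.getElem_map,
    List.getElem_range, List.length_map, List.length_range]
  congr 1
  lia

/-- `s` and `t` are regenerations with no regeneration strictly between them. -/
structure ConsecutiveRegenerations (e : A ↪ ℕ) (P : A → (ℕ → A) → ℝ) (w : List A) (U : ℤ → ℝ)
    (s t : ℤ) : Prop where
  lt : s < t
  left : IsRegeneration e P w U s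
  right : IsRegeneration e P w U t
  between : ∀ r ∈ Set.Ioo s t, ¬ IsRegeneration e P w U r

lemma ConsecutiveRegenerations.unique {U : ℤ → ℝ} {s t s' t' : ℤ}
    (h : ConsecutiveRegenerations e P w U s t) (h' : ConsecutiveRegenerations e P w U s' t')
    (hlt : s < t') (hlt' : s' < t) : s = s' ∧ t = t' := by
  constructor
  · refine le_antisymm (not_lt.1 fun hs => ?_) (not_lt.1 fun hs => ?_)
    · exact h'.between s ⟨hs, hlt⟩ h.left
    · exact h.between s' ⟨hs, hlt'⟩ h'.left
  · refine le_antisymm (not_lt.1 fun ht => ?_) (not_lt.1 fun ht => ?_)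
    · exact h.between t' ⟨hlt, ht⟩ h'.right
    · exact h'.between t ⟨hlt', ht⟩ h.right

/-- The event that the construction from `s` succeeds at `L` sites and yields a string in `B` (in
the order of time), while the constructions from the later sites get stuck before `s + L`. If
`s + L` is a regeneration, then so is `s`, and `s + L` is the next one. -/
def cycleEvent (e : A ↪ ℕ) (P : A → (ℕ → A) → ℝ) (w : List A) (B : Set (List A)) (s : ℤ)
    (L : ℕ) : Set (ℤ → ℝ) :=
  {U | ∃ v, run e P w U s L = some v ∧ v.reverse ∈ B} ∩
    {U | ∀ r, 0 < r → r < L → run e P w U (s + r) (L - r) = none}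

/-- The event that `k` successive cycles with strings in `B 0, B 1, …` start at `s` and that the
construction which starts after them never gets stuck. -/
def forwardEvent (e : A ↪ ℕ) (P : A → (ℕ → A) → ℝ) (w : List A) :
    (ℕ → Set (List A)) → ℕ → ℤ → Set (ℤ → ℝ)
  | _, 0, s => {U | IsRegeneration e P w U s}
  | B, k + 1, s => ⋃ l : ℕ, cycleEvent e P w (B 0) s (l + 1) ∩
      forwardEvent e P w (fun i => B (i + 1)) k (s + (l + 1 : ℕ))

/-- The event that `k` successive cycles end at `s`, with strings in `B 0, B 1, …`, the most recent
cycle first. -/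
def backwardEvent (e : A ↪ ℕ) (P : A → (ℕ → A) → ℝ) (w : List A) :
    (ℕ → Set (List A)) → ℕ → ℤ → Set (ℤ → ℝ)
  | _, 0, _ => Set.univ
  | B, k + 1, s => ⋃ l : ℕ, cycleEvent e P w (B 0) (s - (l + 1 : ℕ)) (l + 1) ∩
      backwardEvent e P w (fun i => B (i + 1)) k (s - (l + 1 : ℕ))

/-- The event that a cycle which starts at or before the time `0` and ends after it is followed by
`k` cycles with strings in `B 0, B 1, …` and then a regeneration, and preceded by `k` cycles with
strings in `B' 0, B' 1, …`. In the union, the cycle goes from `-p.1` to `p.2 + 1`. -/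
def windowEvent (e : A ↪ ℕ) (P : A → (ℕ → A) → ℝ) (w : List A) (B' B : ℕ → Set (List A))
    (k : ℕ) : Set (ℤ → ℝ) :=
  ⋃ p : ℕ × ℕ, (backwardEvent e P w B' k (-p.1) ∩
    cycleEvent e P w Set.univ (-p.1) (p.1 + p.2 + 1)) ∩ forwardEvent e P w B k (p.2 + 1)

/-- The probability that a cycle starts at `0` and has a string in `B`; as a function of `B`, it
turns out to be the law of the blocks between regenerations. -/
noncomputable def cycleLaw (e : A ↪ ℕ) (P : A → (ℕ → A) → ℝ) (w : List A) (B : Set (List A)) :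
    ℝ≥0∞ :=
  ∑' l : ℕ, lawU (cycleEvent e P w B 0 (l + 1))

lemma dependsOn_cycleEvent (B : Set (List A)) (s : ℤ) (L : ℕ) :
    DependsOn (· ∈ cycleEvent e P w B s L) (Set.Ico s (s + L)) := by
  intro U U' hU
  have h_run : run e P w U s L = run e P w U' s L := run_congr hU
  have h_later (r : ℕ) (hr : r < L) :
      run e P w U (s + r) (L - r) = run e P w U' (s + r) (L - r) :=
    run_congr fun i hi => hU i ⟨by linarith [hi.1, Int.natCast_nonneg r], by have := hi.2; lia⟩
  simp only [cycleEvent, Set.mem_inter_iff, Set.mem_ofPred_eq, h_run]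
  exact congrArg _ (propext (forall₃_congr fun r _ hr => by rw [h_later r hr]))

lemma preimage_shift_cycleEvent (B : Set (List A)) (s k : ℤ) (L : ℕ) :
    shift k ⁻¹' cycleEvent e P w B s L = cycleEvent e P w B (s + k) L := by
  ext U
  simp only [cycleEvent, Set.mem_preimage, Set.mem_inter_iff, Set.mem_ofPred_eq, run_shift,
    add_right_comm s _ k]

lemma dependsOn_forwardEvent (B : ℕ → Set (List A)) (k : ℕ) (s : ℤ) :
    DependsOn (· ∈ forwardEvent e P w B k s) (Set.Ici s) := by
  induction k generalizing B s with
  | zero => exact dependsOn_isRegeneration s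
  | succ k ih =>
    exact dependsOn_mem_iUnion fun l => dependsOn_mem_inter
      ((dependsOn_cycleEvent _ _ _).mono Set.Ico_subset_Ici_self)
      ((ih _ _).mono (Set.Ici_subset_Ici.2 (by lia)))

lemma dependsOn_backwardEvent (B : ℕ → Set (List A)) (k : ℕ) (s : ℤ) :
    DependsOn (· ∈ backwardEvent e P w B k s) (Set.Iio s) := by
  induction k generalizing B s with
  | zero => exact fun _ _ _ => rfl
  | succ k ih =>
    exact dependsOn_mem_iUnion fun l => dependsOn_mem_inter
      ((dependsOn_cycleEvent _ _ _).mono (by simpa using Set.Ico_subset_Iio_self))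
      ((ih _ _).mono (Set.Iio_subset_Iio (by lia)))

lemma not_isRegeneration_of_mem_cycleEvent {U : ℤ → ℝ} {B : Set (List A)} {s t : ℤ} {L : ℕ}
    (h : U ∈ cycleEvent e P w B s L) (ht : t ∈ Set.Ioo s (s + L)) :
    ¬ IsRegeneration e P w U t := by
  obtain ⟨r, rfl⟩ := Int.exists_add_of_le ht.1.le
  exact fun h_reg => h_reg _ (h.2 r (by have := ht.1; lia) (by have := ht.2; lia))

lemma disjoint_cycleEvent (B : Set (List A)) {s s' : ℤ} {L L' : ℕ} (hs : s' ∈ Set.Ioo s (s + L))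
    (h_end : s' + L' = s + L) :
    Disjoint (cycleEvent e P w B s L) (cycleEvent e P w B s' L') := by
  refine Set.disjoint_left.2 fun U h h' => ?_
  obtain ⟨v, hv, -⟩ := h'.1
  obtain ⟨r, rfl⟩ := Int.exists_add_of_le hs.1.le
  have h_none := h.2 r (by have := hs.1; lia) (by have := hs.2; lia)
  rw [show L - r = L' by lia, hv] at h_none
  cases h_none

lemma pairwise_disjoint_backwardEvent (B : ℕ → Set (List A)) (k : ℕ) (s : ℤ) :
    Pairwise (Function.onFun Disjoint fun l : ℕ =>
      cycleEvent e P w (B 0) (s - (l + 1 : ℕ)) (l + 1) ∩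
        backwardEvent e P w (fun i => B (i + 1)) k (s - (l + 1 : ℕ))) := by
  refine (pairwise_disjoint_on _).2 fun l l' hl => ?_
  exact (disjoint_cycleEvent (B 0) ⟨by lia, by lia⟩ (by lia)).symm.mono Set.inter_subset_left
    Set.inter_subset_left

lemma neg_add_natCast_succ (j l : ℕ) : -(j : ℤ) + ((j + l + 1 : ℕ) : ℤ) = l + 1 := by lia

variable [Nonempty A]

lemma isRegeneration_of_mem_cycleEvent (hP : IsKernel P) {U : ℤ → ℝ} {B : Set (List A)} {s : ℤ}
    {L : ℕ} (h : U ∈ cycleEvent e P w B s L) (h_end : IsRegeneration e P w U (s + L)) :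
    IsRegeneration e P w U s := by
  obtain ⟨v, hv, -⟩ := h.1
  exact h_end.of_run_ne_none hP (hv ▸ Option.some_ne_none v)

lemma run_eq_reverse_block (hP : IsKernel P) {U : ℤ → ℝ} {s : ℤ} {L : ℕ}
    (h : run e P w U s L ≠ none) :
    run e P w U s L = some (block (chain e P w U) s (s + L)).reverse := by
  rw [run_eq_pre hP h, ← reverse_pre_pastAt, List.reverse_reverse, add_sub_cancel_left,
    Int.toNat_natCast]

lemma consecutiveRegenerations_of_mem_cycleEvent (hP : IsKernel P) {U : ℤ → ℝ}
    {B : Set (List A)} {s t : ℤ} {l : ℕ} (h : U ∈ cycleEvent e P w B s (l + 1))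
    (ht : s + (l + 1 : ℕ) = t) (h_end : IsRegeneration e P w U t) :
    ConsecutiveRegenerations e P w U s t := by
  subst ht
  exact ⟨by lia, isRegeneration_of_mem_cycleEvent hP h h_end, h_end,
    fun _ => not_isRegeneration_of_mem_cycleEvent h⟩

lemma ConsecutiveRegenerations.mem_cycleEvent_iff (hP : IsKernel P) {U : ℤ → ℝ} {s t : ℤ} {L : ℕ}
    (h : ConsecutiveRegenerations e P w U s t) (ht : s + L = t) (B : Set (List A)) :
    U ∈ cycleEvent e P w B s L ↔ block (chain e P w U) s t ∈ B := by
  subst ht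
  have h_block := run_eq_reverse_block hP (h.left L)
  constructor
  · rintro ⟨⟨v, hv, hvB⟩, -⟩
    rw [hv, Option.some_inj] at h_block
    rwa [h_block, List.reverse_reverse] at hvB
  · refine fun hB => ⟨⟨_, h_block, by rwa [List.reverse_reverse]⟩, fun r h_pos hr => ?_⟩
    by_contra h_run
    refine h.between (s + r) ⟨by lia, by lia⟩ (IsRegeneration.of_run_ne_none hP ?_ h_run)
    rw [show s + (r : ℤ) + ((L - r : ℕ) : ℤ) = s + L by lia]
    exact h.right

lemma isRegeneration_of_mem_forwardEvent (hP : IsKernel P) {U : ℤ → ℝ} {B : ℕ → Set (List A)}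
    {k : ℕ} {s : ℤ} (h : U ∈ forwardEvent e P w B k s) : IsRegeneration e P w U s := by
  induction k generalizing B s with
  | zero => exact h
  | succ k ih =>
    obtain ⟨l, h_cycle, h_forward⟩ := Set.mem_iUnion.1 h
    exact isRegeneration_of_mem_cycleEvent hP h_cycle (ih h_forward)

lemma pairwise_disjoint_forwardEvent (hP : IsKernel P) (B : ℕ → Set (List A)) (k : ℕ) (s : ℤ) :
    Pairwise (Function.onFun Disjoint fun l : ℕ => cycleEvent e P w (B 0) s (l + 1) ∩
      forwardEvent e P w (fun i => B (i + 1)) k (s + (l + 1 : ℕ))) := by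
  refine (pairwise_disjoint_on _).2 fun l l' hl => ?_
  refine Set.disjoint_left.2 fun U h h' => ?_
  exact not_isRegeneration_of_mem_cycleEvent h'.1 ⟨by lia, by lia⟩
    (isRegeneration_of_mem_forwardEvent hP h.2)

lemma pairwise_disjoint_windowEvent (hP : IsKernel P) (B' B : ℕ → Set (List A)) (k : ℕ) :
    Pairwise (Function.onFun Disjoint fun p : ℕ × ℕ => (backwardEvent e P w B' k (-p.1) ∩
      cycleEvent e P w Set.univ (-p.1) (p.1 + p.2 + 1)) ∩
        forwardEvent e P w B k (p.2 + 1)) := by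
  intro p p' hp
  refine Set.disjoint_left.2 fun U h h' => hp ?_
  obtain ⟨h_fst, h_snd⟩ :=
    (consecutiveRegenerations_of_mem_cycleEvent hP h.1.2 (neg_add_natCast_succ _ _)
      (isRegeneration_of_mem_forwardEvent hP h.2)).unique
    (consecutiveRegenerations_of_mem_cycleEvent hP h'.1.2 (neg_add_natCast_succ _ _)
      (isRegeneration_of_mem_forwardEvent hP h'.2)) (by lia) (by lia)
  exact Prod.ext (by lia) (by lia)

namespace ConsecutiveRegenerations

variable {U : ℤ → ℝ} {s t : ℤ}

lemma mem_forwardEvent_succ_iff (hP : IsKernel P) (h : ConsecutiveRegenerations e P w U s t)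
    (B : ℕ → Set (List A)) (k : ℕ) :
    U ∈ forwardEvent e P w B (k + 1) s ↔
      block (chain e P w U) s t ∈ B 0 ∧ U ∈ forwardEvent e P w (fun i => B (i + 1)) k t := by
  rw [forwardEvent, Set.mem_iUnion]
  constructor
  · rintro ⟨l, h_cycle, h_forward⟩
    obtain ⟨-, ht⟩ := h.unique (consecutiveRegenerations_of_mem_cycleEvent hP h_cycle rfl
      (isRegeneration_of_mem_forwardEvent hP h_forward)) (by lia) h.lt
    exact ⟨(h.mem_cycleEvent_iff hP ht.symm _).1 h_cycle, ht ▸ h_forward⟩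
  · rintro ⟨h_block, h_forward⟩
    obtain ⟨l, ht⟩ : ∃ l : ℕ, s + (l + 1 : ℕ) = t := ⟨(t - s - 1).toNat, by have := h.lt; lia⟩
    exact ⟨l, (h.mem_cycleEvent_iff hP ht _).2 h_block, ht ▸ h_forward⟩

lemma mem_backwardEvent_succ_iff (hP : IsKernel P) (h : ConsecutiveRegenerations e P w U s t)
    (B : ℕ → Set (List A)) (k : ℕ) :
    U ∈ backwardEvent e P w B (k + 1) t ↔
      block (chain e P w U) s t ∈ B 0 ∧ U ∈ backwardEvent e P w (fun i => B (i + 1)) k s := by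
  rw [backwardEvent, Set.mem_iUnion]
  constructor
  · rintro ⟨l, h_cycle, h_backward⟩
    obtain ⟨hs, -⟩ := h.unique (consecutiveRegenerations_of_mem_cycleEvent hP h_cycle
      (sub_add_cancel _ _) h.right) h.lt (by lia)
    rw [← hs] at h_cycle h_backward
    exact ⟨(h.mem_cycleEvent_iff hP (by lia) _).1 h_cycle, h_backward⟩
  · rintro ⟨h_block, h_backward⟩
    obtain ⟨l, hs⟩ : ∃ l : ℕ, s = t - (l + 1 : ℕ) := ⟨(t - s - 1).toNat, by have := h.lt; lia⟩
    subst hs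
    exact ⟨l, (h.mem_cycleEvent_iff hP (sub_add_cancel _ _) _).2 h_block, h_backward⟩

lemma mem_windowEvent_iff (hP : IsKernel P) (h : ConsecutiveRegenerations e P w U s t)
    (hs : s ≤ 0) (ht : 0 < t) (B' B : ℕ → Set (List A)) (k : ℕ) :
    U ∈ windowEvent e P w B' B k ↔
      U ∈ backwardEvent e P w B' k s ∧ U ∈ forwardEvent e P w B k t := by
  rw [windowEvent, Set.mem_iUnion]
  constructor
  · rintro ⟨p, ⟨h_backward, h_cycle⟩, h_forward⟩
    obtain ⟨rfl, rfl⟩ := h.unique (consecutiveRegenerations_of_mem_cycleEvent hP h_cycle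
      (neg_add_natCast_succ _ _) (isRegeneration_of_mem_forwardEvent hP h_forward))
      (by lia) (by lia)
    exact ⟨h_backward, h_forward⟩
  · rintro ⟨h_backward, h_forward⟩
    obtain ⟨j, rfl⟩ : ∃ j : ℕ, s = -j := ⟨(-s).toNat, by lia⟩
    obtain ⟨l, rfl⟩ : ∃ l : ℕ, t = l + 1 := ⟨(t - 1).toNat, by lia⟩
    exact ⟨(j, l), ⟨h_backward, (h.mem_cycleEvent_iff hP (neg_add_natCast_succ _ _) _).2 trivial⟩,
      h_forward⟩

end ConsecutiveRegenerations

variable [Countable A]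

lemma measurableSet_cycleEvent (hP : IsKernel P) (B : Set (List A)) (s : ℤ) (L : ℕ) :
    MeasurableSet (cycleEvent e P w B s L) := by
  have h_run : {U | ∃ v, run e P w U s L = some v ∧ v.reverse ∈ B} =
      ⋃ v ∈ {v : List A | v.reverse ∈ B}, {U | run e P w U s L = some v} := by
    ext U
    simp [and_comm]
  refine .inter ?_ ?_
  · rw [h_run]
    exact .biUnion (Set.to_countable _) fun v _ => measurableSet_run_eq hP s L v
  · simp only [Set.ofPred_forall]
    refine .iInter fun r => .iInter fun _ => .iInter fun _ => ?_
    simpa only [Set.compl_ofPred, not_not] using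
      (measurableSet_run_ne_none (e := e) (w := w) hP (s + r) (L - r)).compl

lemma measurableSet_forwardEvent (hP : IsKernel P) (B : ℕ → Set (List A)) (k : ℕ) (s : ℤ) :
    MeasurableSet (forwardEvent e P w B k s) := by
  induction k generalizing B s with
  | zero => exact measurableSet_isRegeneration hP s
  | succ k ih => exact .iUnion fun l => (measurableSet_cycleEvent hP _ _ _).inter (ih _ _)

lemma measurableSet_backwardEvent (hP : IsKernel P) (B : ℕ → Set (List A)) (k : ℕ) (s : ℤ) :
    MeasurableSet (backwardEvent e P w B k s) := by
  induction k generalizing B s with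
  | zero => exact .univ
  | succ k ih => exact .iUnion fun l => (measurableSet_cycleEvent hP _ _ _).inter (ih _ _)

lemma lawU_cycleEvent_eq (hP : IsKernel P) (B : Set (List A)) (s : ℤ) (L : ℕ) :
    lawU (cycleEvent e P w B s L) = lawU (cycleEvent e P w B 0 L) := by
  rw [← lawU_preimage_shift (measurableSet_cycleEvent hP B 0 L) s, preimage_shift_cycleEvent,
    zero_add]

lemma lawU_cycleEvent_inter_forwardEvent (hP : IsKernel P) (B : Set (List A))
    (B' : ℕ → Set (List A)) (k : ℕ) (s : ℤ) (L : ℕ) :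
    lawU (cycleEvent e P w B s L ∩ forwardEvent e P w B' k (s + L)) =
      lawU (cycleEvent e P w B 0 L) * lawU (forwardEvent e P w B' k (s + L)) := by
  rw [← lawU_cycleEvent_eq hP B s]
  exact infinitePi_inter_of_dependsOn _ (measurableSet_cycleEvent hP _ _ _)
    (measurableSet_forwardEvent hP _ _ _) (dependsOn_cycleEvent _ _ _)
    (dependsOn_forwardEvent _ _ _)
    ((Set.Iio_disjoint_Ici le_rfl).mono_left Set.Ico_subset_Iio_self)

lemma lawU_backwardEvent_inter_cycleEvent (hP : IsKernel P) (B' : ℕ → Set (List A))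
    (B : Set (List A)) (k : ℕ) (s : ℤ) (L : ℕ) :
    lawU (backwardEvent e P w B' k s ∩ cycleEvent e P w B s L) =
      lawU (backwardEvent e P w B' k s) * lawU (cycleEvent e P w B 0 L) := by
  rw [← lawU_cycleEvent_eq hP B s]
  exact infinitePi_inter_of_dependsOn _ (measurableSet_backwardEvent hP _ _ _)
    (measurableSet_cycleEvent hP _ _ _) (dependsOn_backwardEvent _ _ _)
    (dependsOn_cycleEvent _ _ _)
    ((Set.Iio_disjoint_Ici le_rfl).mono_right Set.Ico_subset_Ici_self)

lemma lawU_forwardEvent (hP : IsKernel P) (B : ℕ → Set (List A)) (k : ℕ) (s : ℤ) :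
    lawU (forwardEvent e P w B k s) =
      (∏ i ∈ Finset.range k, cycleLaw e P w (B i)) * lawU {U | IsRegeneration e P w U 0} := by
  induction k generalizing B s with
  | zero => simpa [forwardEvent] using lawU_isRegeneration_eq hP s
  | succ k ih =>
    rw [forwardEvent, measure_iUnion (pairwise_disjoint_forwardEvent hP B k s) fun l =>
      (measurableSet_cycleEvent hP _ _ _).inter (measurableSet_forwardEvent hP _ _ _)]
    simp_rw [lawU_cycleEvent_inter_forwardEvent hP, ih]
    rw [ENNReal.tsum_mul_right, Finset.prod_range_succ', ← cycleLaw]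
    ring

lemma lawU_backwardEvent (hP : IsKernel P) (B : ℕ → Set (List A)) (k : ℕ) (s : ℤ) :
    lawU (backwardEvent e P w B k s) = ∏ i ∈ Finset.range k, cycleLaw e P w (B i) := by
  induction k generalizing B s with
  | zero => simp [backwardEvent]
  | succ k ih =>
    rw [backwardEvent, measure_iUnion (pairwise_disjoint_backwardEvent B k s) fun l =>
      (measurableSet_cycleEvent hP _ _ _).inter (measurableSet_backwardEvent hP _ _ _)]
    have h_term (l : ℕ) : lawU (cycleEvent e P w (B 0) (s - (l + 1 : ℕ)) (l + 1) ∩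
        backwardEvent e P w (fun i => B (i + 1)) k (s - (l + 1 : ℕ))) =
        (∏ i ∈ Finset.range k, cycleLaw e P w (B (i + 1))) *
          lawU (cycleEvent e P w (B 0) 0 (l + 1)) := by
      rw [Set.inter_comm, lawU_backwardEvent_inter_cycleEvent hP, ih]
    simp_rw [h_term]
    rw [ENNReal.tsum_mul_left, Finset.prod_range_succ', ← cycleLaw]

lemma lawU_backwardEvent_inter_cycleEvent_inter_forwardEvent (hP : IsKernel P)
    (B' B : ℕ → Set (List A)) (k j l : ℕ) :
    lawU ((backwardEvent e P w B' k (-j) ∩ cycleEvent e P w Set.univ (-j) (j + l + 1)) ∩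
        forwardEvent e P w B k (l + 1)) =
      lawU (cycleEvent e P w Set.univ 0 (j + l + 1)) *
        ((∏ i ∈ Finset.range k, cycleLaw e P w (B' i)) *
          (∏ i ∈ Finset.range k, cycleLaw e P w (B i)) * lawU {U | IsRegeneration e P w U 0}) := by
  have h_before : DependsOn (· ∈ backwardEvent e P w B' k (-j) ∩
      cycleEvent e P w Set.univ (-j) (j + l + 1)) (Set.Iio ((l : ℤ) + 1)) := by
    rw [← neg_add_natCast_succ j l]
    exact dependsOn_mem_inter
      ((dependsOn_backwardEvent _ _ _).mono (Set.Iio_subset_Iio (by lia)))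
      ((dependsOn_cycleEvent _ _ _).mono Set.Ico_subset_Iio_self)
  have h_inter := infinitePi_inter_of_dependsOn (fun _ : ℤ => unif)
    ((measurableSet_backwardEvent hP _ _ _).inter (measurableSet_cycleEvent hP _ _ _))
    (measurableSet_forwardEvent (e := e) (w := w) hP B k ((l : ℤ) + 1)) h_before
    (dependsOn_forwardEvent _ _ _) (Set.Iio_disjoint_Ici le_rfl)
  rw [← lawU] at h_inter
  rw [h_inter, lawU_backwardEvent_inter_cycleEvent hP, lawU_backwardEvent hP,
    lawU_forwardEvent hP]
  ring

lemma lawU_windowEvent (hP : IsKernel P) (B' B : ℕ → Set (List A)) (k : ℕ) :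
    lawU (windowEvent e P w B' B k) =
      (∏ i ∈ Finset.range k, cycleLaw e P w (B' i)) * (∏ i ∈ Finset.range k, cycleLaw e P w (B i)) *
        ((∑' p : ℕ × ℕ, lawU (cycleEvent e P w Set.univ 0 (p.1 + p.2 + 1))) *
          lawU {U | IsRegeneration e P w U 0}) := by
  rw [windowEvent, measure_iUnion (pairwise_disjoint_windowEvent hP B' B k) fun p =>
    ((measurableSet_backwardEvent hP _ _ _).inter (measurableSet_cycleEvent hP _ _ _)).inter
      (measurableSet_forwardEvent hP _ _ _)]
  simp_rw [lawU_backwardEvent_inter_cycleEvent_inter_forwardEvent hP]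
  rw [ENNReal.tsum_mul_right]
  ring

end Cycles

section RegenerationTimes

variable {e : A ↪ ℕ} {P : A → (ℕ → A) → ℝ} {w : List A}

/-! ### Regeneration times -/

/-- The first regeneration after `s`; the junk value is `s + 1` if there is none. -/
noncomputable def nextRegeneration (e : A ↪ ℕ) (P : A → (ℕ → A) → ℝ) (w : List A) (U : ℤ → ℝ)
    (s : ℤ) : ℤ :=
  s + 1 + (sInf {n : ℕ | IsRegeneration e P w U (s + 1 + n)} : ℕ)

/-- The last regeneration before `s`; the junk value is `s - 1` if there is none. -/
noncomputable def prevRegeneration (e : A ↪ ℕ) (P : A → (ℕ → A) → ℝ) (w : List A) (U : ℤ → ℝ)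
    (s : ℤ) : ℤ :=
  s - 1 - (sInf {n : ℕ | IsRegeneration e P w U (s - 1 - n)} : ℕ)

/-- The regeneration times `T i`, in increasing order and numbered so that `T 0 ≤ 0 < T 1`. -/
noncomputable def regenerationTime (e : A ↪ ℕ) (P : A → (ℕ → A) → ℝ) (w : List A) :
    ℤ → (ℤ → ℝ) → ℤ
  | Int.ofNat n, U => (nextRegeneration e P w U)^[n] (prevRegeneration e P w U 1)
  | Int.negSucc n, U => (prevRegeneration e P w U)^[n + 1] (prevRegeneration e P w U 1)

/-- The block of the chain between two successive regeneration times. -/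
noncomputable def regenerationBlock [Nonempty A] (e : A ↪ ℕ) (P : A → (ℕ → A) → ℝ) (w : List A)
    (i : ℤ) (U : ℤ → ℝ) : List A :=
  block (chain e P w U) (regenerationTime e P w i U) (regenerationTime e P w (i + 1) U)

lemma lt_nextRegeneration (U : ℤ → ℝ) (s : ℤ) : s < nextRegeneration e P w U s := by
  rw [nextRegeneration]
  lia

lemma prevRegeneration_lt (U : ℤ → ℝ) (s : ℤ) : prevRegeneration e P w U s < s := by
  rw [prevRegeneration]
  lia

lemma not_isRegeneration_of_lt_nextRegeneration {U : ℤ → ℝ} {s t : ℤ}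
    (ht : t ∈ Set.Ioo s (nextRegeneration e P w U s)) : ¬ IsRegeneration e P w U t := by
  intro h
  obtain ⟨n, rfl⟩ := Int.exists_add_of_le (Int.add_one_le_of_lt ht.1)
  have h_le : sInf {n : ℕ | IsRegeneration e P w U (s + 1 + n)} ≤ n := Nat.sInf_le h
  have h_lt := ht.2
  rw [nextRegeneration] at h_lt
  lia

lemma not_isRegeneration_of_prevRegeneration_lt {U : ℤ → ℝ} {s t : ℤ}
    (ht : t ∈ Set.Ioo (prevRegeneration e P w U s) s) : ¬ IsRegeneration e P w U t := by
  intro h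
  obtain ⟨n, rfl⟩ : ∃ n : ℕ, t = s - 1 - n := ⟨(s - 1 - t).toNat, by have := ht.2; lia⟩
  have h_le : sInf {n : ℕ | IsRegeneration e P w U (s - 1 - n)} ≤ n := Nat.sInf_le h
  have h_lt := ht.1
  rw [prevRegeneration] at h_lt
  lia

lemma regenerationTime_negSucc (U : ℤ → ℝ) (n : ℕ) :
    regenerationTime e P w (Int.negSucc n) U =
      prevRegeneration e P w U (regenerationTime e P w (Int.negSucc n + 1) U) := by
  cases n with
  | zero => rfl
  | succ n => exact Function.iterate_succ_apply' _ _ _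

lemma regenerationTime_natCast_add_one (U : ℤ → ℝ) (n : ℕ) :
    regenerationTime e P w (n + 1) U =
      nextRegeneration e P w U (regenerationTime e P w n U) :=
  Function.iterate_succ_apply' _ _ _

lemma regenerationTime_zero_le (U : ℤ → ℝ) : regenerationTime e P w 0 U ≤ 0 :=
  Int.lt_add_one_iff.1 (prevRegeneration_lt U 1)

namespace IsTypical

variable {U : ℤ → ℝ}

lemma isRegeneration_nextRegeneration (hU : IsTypical e P w U) (s : ℤ) :
    IsRegeneration e P w U (nextRegeneration e P w U s) := by
  obtain ⟨t, ht, h⟩ := hU.exists_ge (s + 1)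
  obtain ⟨n, rfl⟩ := Int.exists_add_of_le ht
  exact Nat.sInf_mem (s := {n : ℕ | IsRegeneration e P w U (s + 1 + n)}) ⟨n, h⟩

lemma isRegeneration_prevRegeneration (hU : IsTypical e P w U) (s : ℤ) :
    IsRegeneration e P w U (prevRegeneration e P w U s) := by
  obtain ⟨t, ht, h⟩ := hU.exists_le (s - 1)
  obtain ⟨n, rfl⟩ : ∃ n : ℕ, t = s - 1 - n := ⟨(s - 1 - t).toNat, by lia⟩
  exact Nat.sInf_mem (s := {n : ℕ | IsRegeneration e P w U (s - 1 - n)}) ⟨n, h⟩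

lemma isRegeneration_regenerationTime (hU : IsTypical e P w U) (i : ℤ) :
    IsRegeneration e P w U (regenerationTime e P w i U) := by
  rcases i with (_ | n) | n
  · exact hU.isRegeneration_prevRegeneration 1
  · exact regenerationTime_natCast_add_one (e := e) U n ▸ hU.isRegeneration_nextRegeneration _
  · exact regenerationTime_negSucc (e := e) U n ▸ hU.isRegeneration_prevRegeneration _

lemma consecutiveRegenerations_regenerationTime (hU : IsTypical e P w U) (i : ℤ) :
    ConsecutiveRegenerations e P w U (regenerationTime e P w i U)
      (regenerationTime e P w (i + 1) U) := by
  rcases i with n | n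
  · refine ⟨?_, hU.isRegeneration_regenerationTime _, hU.isRegeneration_regenerationTime _, ?_⟩
    all_goals rw [Int.ofNat_eq_natCast, regenerationTime_natCast_add_one]
    · exact lt_nextRegeneration _ _
    · exact fun _ => not_isRegeneration_of_lt_nextRegeneration
  · refine ⟨?_, hU.isRegeneration_regenerationTime _, hU.isRegeneration_regenerationTime _, ?_⟩
    all_goals rw [regenerationTime_negSucc]
    · exact prevRegeneration_lt _ _
    · exact fun _ => not_isRegeneration_of_prevRegeneration_lt

lemma regenerationTime_one_pos (hU : IsTypical e P w U) : 0 < regenerationTime e P w 1 U := by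
  have h := hU.consecutiveRegenerations_regenerationTime 0
  by_contra! h_le
  exact not_isRegeneration_of_prevRegeneration_lt ⟨h.lt, by lia⟩ h.right

variable [Nonempty A]

lemma mem_forwardEvent_iff (hP : IsKernel P) (hU : IsTypical e P w U) (B : ℕ → Set (List A))
    (k : ℕ) (i : ℤ) :
    U ∈ forwardEvent e P w B k (regenerationTime e P w i U) ↔
      ∀ j < k, regenerationBlock e P w (i + j) U ∈ B j := by
  induction k generalizing B i with
  | zero => simpa [forwardEvent] using hU.isRegeneration_regenerationTime i
  | succ k ih =>
    rw [(hU.consecutiveRegenerations_regenerationTime i).mem_forwardEvent_succ_iff hP, ih,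
      Nat.forall_lt_succ_left]
    simp only [regenerationBlock, Nat.cast_add, Nat.cast_one, Nat.cast_zero, add_zero, add_assoc,
      add_comm (1 : ℤ)]

lemma mem_backwardEvent_iff (hP : IsKernel P) (hU : IsTypical e P w U) (B : ℕ → Set (List A))
    (k : ℕ) (i : ℤ) :
    U ∈ backwardEvent e P w B k (regenerationTime e P w i U) ↔
      ∀ j < k, regenerationBlock e P w (i - (j + 1)) U ∈ B j := by
  induction k generalizing B i with
  | zero => simp [backwardEvent]
  | succ k ih =>
    have h := hU.consecutiveRegenerations_regenerationTime (i - 1)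
    rw [sub_add_cancel] at h
    rw [h.mem_backwardEvent_succ_iff hP, ih, Nat.forall_lt_succ_left]
    simp only [regenerationBlock, Nat.cast_add, Nat.cast_one, Nat.cast_zero, zero_add,
      sub_add_cancel, sub_sub, add_comm (1 : ℤ)]

lemma mem_windowEvent_iff (hP : IsKernel P) (hU : IsTypical e P w U) (B' B : ℕ → Set (List A))
    (k : ℕ) :
    U ∈ windowEvent e P w B' B k ↔
      (∀ j < k, regenerationBlock e P w (-(j + 1)) U ∈ B' j) ∧
        ∀ j < k, regenerationBlock e P w (j + 1) U ∈ B j := by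
  have h := hU.consecutiveRegenerations_regenerationTime 0
  rw [zero_add] at h
  rw [h.mem_windowEvent_iff hP (regenerationTime_zero_le U) hU.regenerationTime_one_pos,
    hU.mem_backwardEvent_iff hP, hU.mem_forwardEvent_iff hP]
  simp only [zero_sub, add_comm (1 : ℤ)]

end IsTypical

end RegenerationTimes

section RegenerationMeasurability

/-! ### Measurability of the regeneration times -/

lemma measurable_sInf_nat {α : Type*} [MeasurableSpace α] {p : α → ℕ → Prop}
    (hp : ∀ n, MeasurableSet {x | p x n}) : Measurable fun x => sInf {n | p x n} := by
  classical
  let q (x : α) (n : ℕ) : Prop := p x n ∨ ∀ m, ¬ p x m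
  have hq (x : α) : ∃ n, q x n := by
    by_cases h : ∃ n, p x n
    · exact h.imp fun _ => Or.inl
    · exact ⟨0, Or.inr (not_exists.1 h)⟩
  have h_find (x : α) : sInf {n | p x n} = Nat.find (hq x) := by
    by_cases h : ∃ n, p x n
    · rw [Nat.sInf_def (s := {n | p x n}) h]
      exact Nat.find_congr' fun {n} => ⟨Or.inl, (Or.resolve_right · (not_forall_not.2 h))⟩
    · have h_none := not_exists.1 h
      rw [(Nat.find_eq_zero _).2 (Or.inr h_none)]
      simp [h_none]
  simp_rw [h_find]
  have h_none : MeasurableSet {x | ∀ m, ¬ p x m} := by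
    rw [Set.ofPred_forall]
    exact .iInter fun m => (hp m).compl
  exact measurable_find hq fun n => (hp n).union h_none

lemma measurable_apply_of_countable {α ι β : Type*} [MeasurableSpace α] [MeasurableSpace ι]
    [MeasurableSpace β] [Countable ι] [MeasurableSingletonClass ι] {g : α → ι → β} {f : α → ι}
    (hg : ∀ i, Measurable fun x => g x i) (hf : Measurable f) : Measurable fun x => g x (f x) :=
  (measurable_from_prod_countable_left (f := fun p : α × ι => g p.1 p.2) hg).comp
    (measurable_id.prodMk hf)

variable {e : A ↪ ℕ} {P : A → (ℕ → A) → ℝ} {w : List A} [Nonempty A] [Countable A]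

lemma measurable_nextRegeneration (hP : IsKernel P) (s : ℤ) :
    Measurable fun U => nextRegeneration e P w U s :=
  (Measurable.of_discrete (f := fun n : ℕ => s + 1 + (n : ℤ))).comp
    (measurable_sInf_nat fun _ => measurableSet_isRegeneration hP _)

lemma measurable_prevRegeneration (hP : IsKernel P) (s : ℤ) :
    Measurable fun U => prevRegeneration e P w U s :=
  (Measurable.of_discrete (f := fun n : ℕ => s - 1 - (n : ℤ))).comp
    (measurable_sInf_nat fun _ => measurableSet_isRegeneration hP _)

lemma measurable_regenerationTime (hP : IsKernel P) (i : ℤ) :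
    Measurable (regenerationTime e P w i) := by
  induction i with
  | zero => exact measurable_prevRegeneration hP 1
  | succ n ih =>
    rw [funext fun U => regenerationTime_natCast_add_one (e := e) (P := P) (w := w) U n]
    exact measurable_apply_of_countable (measurable_nextRegeneration hP) ih
  | pred n ih =>
    rw [show -(n : ℤ) - 1 = Int.negSucc n by lia,
      funext fun U => regenerationTime_negSucc (e := e) (P := P) (w := w) U n,
      show Int.negSucc n + 1 = -n by lia]
    exact measurable_apply_of_countable (measurable_prevRegeneration hP) ih

lemma measurable_regenerationBlock [MeasurableSpace A] [DiscreteMeasurableSpace A]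
    (hP : IsKernel P) (i : ℤ) : Measurable (regenerationBlock e P w i) := by
  have h_block (s t : ℤ) : Measurable fun U => block (chain e P w U) s t := by
    simp only [← reverse_pre_pastAt]
    exact (Measurable.of_discrete (f := List.reverse)).comp
      ((measurable_pre _).comp ((measurable_pastAt t).comp (measurable_chain hP)))
  exact measurable_apply_of_countable
    (g := fun U t => block (chain e P w U) (regenerationTime e P w i U) t)
    (fun t => measurable_apply_of_countable (g := fun U s => block (chain e P w U) s t)
      (h_block · t) (measurable_regenerationTime hP i))
    (measurable_regenerationTime hP (i + 1))

end RegenerationMeasurability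

section BlockLaw

/-! ### The law of the blocks -/

lemma prod_Icc_neg_eq_prod_range_mul {M : Type*} [CommMonoid M] {f : ℤ → M} (h0 : f 0 = 1)
    (k : ℕ) : ∏ i ∈ Finset.Icc (-k : ℤ) k, f i =
      (∏ j ∈ Finset.range k, f (-(j + 1))) * ∏ j ∈ Finset.range k, f (j + 1) := by
  induction k with
  | zero => simp [h0]
  | succ k ih =>
    have h_Icc : Finset.Icc (-(k + 1 : ℕ) : ℤ) (k + 1 : ℕ) =
        insert (-(k + 1) : ℤ) (insert (k + 1 : ℤ) (Finset.Icc (-k : ℤ) k)) := by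
      ext i
      simp only [Finset.mem_Icc, Finset.mem_insert]
      lia
    rw [h_Icc, Finset.prod_insert (by simp; lia), Finset.prod_insert (by simp), ih,
      Finset.prod_range_succ, Finset.prod_range_succ]
    ac_rfl

lemma forall_mem_Icc_neg_iff {p : ℤ → Prop} (h0 : p 0) (k : ℕ) :
    (∀ i ∈ Finset.Icc (-k : ℤ) k, p i) ↔ (∀ j < k, p (-(j + 1))) ∧ ∀ j < k, p (j + 1) := by
  simp only [Finset.mem_Icc]
  refine ⟨fun h => ⟨fun j hj => h _ (by lia), fun j hj => h _ (by lia)⟩, ?_⟩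
  rintro ⟨h_neg, h_pos⟩ i hi
  rcases lt_trichotomy i 0 with h | rfl | h
  · obtain ⟨j, rfl⟩ : ∃ j : ℕ, i = -(j + 1) := ⟨(-i - 1).toNat, by lia⟩
    exact h_neg j (by lia)
  · exact h0
  · obtain ⟨j, rfl⟩ : ∃ j : ℕ, i = j + 1 := ⟨(i - 1).toNat, by lia⟩
    exact h_pos j (by lia)

lemma lintegral_natCast_eq_tsum {α : Type*} [MeasurableSpace α] (μ : Measure α) {f : α → ℕ}
    (hf : Measurable f) : ∫⁻ x, (f x : ℝ≥0∞) ∂μ = ∑' n : ℕ, μ {x | n < f x} := by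
  have h_meas (n : ℕ) : MeasurableSet {x | n < f x} := measurableSet_lt measurable_const hf
  have h_tsum (x : α) :
      (f x : ℝ≥0∞) = ∑' n : ℕ, {x | n < f x}.indicator (1 : α → ℝ≥0∞) x := by
    calc (f x : ℝ≥0∞) = ∑ n ∈ Finset.range (f x), 1 := by simp
      _ = ∑ n ∈ Finset.range (f x), {x | n < f x}.indicator 1 x :=
        Finset.sum_congr rfl fun n hn =>
          (Set.indicator_of_mem (s := {x | n < f x}) (Finset.mem_range.1 hn) 1).symm
      _ = ∑' n : ℕ, {x | n < f x}.indicator 1 x :=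
        (tsum_eq_sum fun n hn =>
          Set.indicator_of_notMem (s := {x | n < f x}) (mt Finset.mem_range.2 hn) 1).symm
  simp_rw [h_tsum]
  rw [lintegral_tsum fun n => (measurable_one.indicator (h_meas n)).aemeasurable]
  simp_rw [lintegral_indicator_one (h_meas _)]

variable {e : A ↪ ℕ} {P : A → (ℕ → A) → ℝ} {w : List A}

lemma cycleEvent_lt_length_eq [Nonempty A] (hP : IsKernel P) (n : ℕ) (s : ℤ) (L : ℕ) :
    cycleEvent e P w {v | n < v.length} s L =
      if n < L then cycleEvent e P w Set.univ s L else ∅ := by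
  ext U
  have h_length : (∃ v, run e P w U s L = some v ∧ n < v.length) ↔
      n < L ∧ ∃ v, run e P w U s L = some v := by
    rw [← exists_and_left]
    refine exists_congr fun v => ?_
    rw [and_comm]
    exact and_congr_left fun hv => by rw [length_of_run_eq_some hP hv]
  split_ifs with h <;> simp [cycleEvent, h_length, h]

lemma cycleLaw_lt_length [Nonempty A] (hP : IsKernel P) (n : ℕ) :
    cycleLaw e P w {v | n < v.length} =
      ∑' l : ℕ, lawU (cycleEvent e P w Set.univ 0 (n + l + 1)) := by
  have h_short : ∑ l ∈ Finset.range n, lawU (cycleEvent e P w {v | n < v.length} 0 (l + 1)) = 0 :=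
    Finset.sum_eq_zero fun l hl => by
      rw [cycleEvent_lt_length_eq hP, if_neg (not_lt.2 (Finset.mem_range.1 hl)), measure_empty]
  rw [cycleLaw, ← Summable.sum_add_tsum_nat_add' (k := n) ENNReal.summable, h_short, zero_add]
  refine tsum_congr fun l => ?_
  rw [cycleEvent_lt_length_eq hP, if_pos (by lia), Nat.add_comm l n]

variable [Countable A]

lemma lawU_windowEvent_univ (hP : IsKernel P) (hE : (spontaneousSymbols P).Nonempty)
    (hw : ∀ a ∈ w, a ∈ spontaneousSymbols P) (hsum : Summable fun k : ℕ => 1 - alphaW P w k)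
    (k : ℕ) : lawU (windowEvent e P w (fun _ => Set.univ) (fun _ => Set.univ) k) = 1 := by
  have : Nonempty A := ⟨hE.some⟩
  refine (measure_congr (Filter.eventuallyEq_univ.2 ?_)).trans measure_univ
  filter_upwards [ae_isTypical (e := e) hP hE hw hsum] with U hU
  simp [hU.mem_windowEvent_iff hP]

lemma tsum_lawU_cycleEvent_mul (hP : IsKernel P) (hE : (spontaneousSymbols P).Nonempty)
    (hw : ∀ a ∈ w, a ∈ spontaneousSymbols P) (hsum : Summable fun k : ℕ => 1 - alphaW P w k) :
    (∑' p : ℕ × ℕ, lawU (cycleEvent e P w Set.univ 0 (p.1 + p.2 + 1))) *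
      lawU {U | IsRegeneration e P w U 0} = 1 := by
  have : Nonempty A := ⟨hE.some⟩
  simpa [lawU_windowEvent hP] using lawU_windowEvent_univ (e := e) hP hE hw hsum 0

lemma cycleLaw_univ (hP : IsKernel P) (hE : (spontaneousSymbols P).Nonempty)
    (hw : ∀ a ∈ w, a ∈ spontaneousSymbols P) (hsum : Summable fun k : ℕ => 1 - alphaW P w k) :
    cycleLaw e P w Set.univ = 1 := by
  have : Nonempty A := ⟨hE.some⟩
  have h := lawU_windowEvent_univ (e := e) hP hE hw hsum 1
  rw [lawU_windowEvent hP, tsum_lawU_cycleEvent_mul hP hE hw hsum, mul_one,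
    Finset.prod_range_one, ← sq] at h
  exact (ENNReal.pow_right_strictMono two_ne_zero).injective (h.trans (one_pow 2).symm)

variable [Nonempty A]

lemma lawU_iInter_Icc_regenerationBlock (hP : IsKernel P) (hE : (spontaneousSymbols P).Nonempty)
    (hw : ∀ a ∈ w, a ∈ spontaneousSymbols P) (hsum : Summable fun k : ℕ => 1 - alphaW P w k)
    {B : ℤ → Set (List A)} (h0 : B 0 = Set.univ) (k : ℕ) :
    lawU (⋂ i ∈ Finset.Icc (-k : ℤ) k, regenerationBlock e P w i ⁻¹' B i) =
      ∏ i ∈ Finset.Icc (-k : ℤ) k, cycleLaw e P w (B i) := by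
  have h_window : (⋂ i ∈ Finset.Icc (-k : ℤ) k, regenerationBlock e P w i ⁻¹' B i) =ᵐ[lawU]
      windowEvent e P w (fun j => B (-(j + 1))) (fun j => B (j + 1)) k := by
    filter_upwards [ae_isTypical (e := e) hP hE hw hsum] with U hU
    refine propext (Iff.trans ?_ (hU.mem_windowEvent_iff hP _ _ k).symm)
    rw [← forall_mem_Icc_neg_iff (p := fun i => regenerationBlock e P w i U ∈ B i)
      (h0 ▸ Set.mem_univ _)]
    exact Set.mem_iInter₂
  rw [measure_congr h_window, lawU_windowEvent hP, tsum_lawU_cycleEvent_mul hP hE hw hsum,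
    mul_one, prod_Icc_neg_eq_prod_range_mul (h0 ▸ cycleLaw_univ hP hE hw hsum)]

lemma lawU_iInter_regenerationBlock (hP : IsKernel P) (hE : (spontaneousSymbols P).Nonempty)
    (hw : ∀ a ∈ w, a ∈ spontaneousSymbols P) (hsum : Summable fun k : ℕ => 1 - alphaW P w k)
    {S : Finset ℤ} (h0 : (0 : ℤ) ∉ S) (B : ℤ → Set (List A)) :
    lawU (⋂ i ∈ S, regenerationBlock e P w i ⁻¹' B i) = ∏ i ∈ S, cycleLaw e P w (B i) := by
  classical
  let C : ℤ → Set (List A) := fun i => if i ∈ S then B i else Set.univ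
  obtain ⟨k, hk⟩ : ∃ k : ℕ, S ⊆ Finset.Icc (-k : ℤ) k :=
    ⟨S.sup Int.natAbs, fun i hi => by
      have h_le : i.natAbs ≤ S.sup Int.natAbs := Finset.le_sup (f := Int.natAbs) hi
      rw [Finset.mem_Icc]
      lia⟩
  calc lawU (⋂ i ∈ S, regenerationBlock e P w i ⁻¹' B i)
      = lawU (⋂ i ∈ Finset.Icc (-k : ℤ) k, regenerationBlock e P w i ⁻¹' C i) := by
        congr 1
        ext U
        simp only [Set.mem_iInter, Set.mem_preimage, C]
        refine ⟨fun h i _ => ?_, fun h i hi => by simpa [hi] using h i (hk hi)⟩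
        split_ifs with hi
        · exact h i hi
        · trivial
    _ = ∏ i ∈ Finset.Icc (-k : ℤ) k, cycleLaw e P w (C i) :=
        lawU_iInter_Icc_regenerationBlock hP hE hw hsum (if_neg h0) k
    _ = ∏ i ∈ S, cycleLaw e P w (C i) :=
        (Finset.prod_subset hk fun i _ hi => by
          simp only [C, if_neg hi, cycleLaw_univ hP hE hw hsum]).symm
    _ = ∏ i ∈ S, cycleLaw e P w (B i) :=
        Finset.prod_congr rfl fun i hi => by simp only [C, if_pos hi]

lemma lawU_preimage_regenerationBlock (hP : IsKernel P) (hE : (spontaneousSymbols P).Nonempty)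
    (hw : ∀ a ∈ w, a ∈ spontaneousSymbols P) (hsum : Summable fun k : ℕ => 1 - alphaW P w k)
    {i : ℤ} (hi : i ≠ 0) (B : Set (List A)) :
    lawU (regenerationBlock e P w i ⁻¹' B) = cycleLaw e P w B := by
  simpa using lawU_iInter_regenerationBlock (e := e) hP hE hw hsum
    (Finset.notMem_singleton.2 hi.symm) fun _ => B

lemma iIndepFun_regenerationBlock (hP : IsKernel P) (hE : (spontaneousSymbols P).Nonempty)
    (hw : ∀ a ∈ w, a ∈ spontaneousSymbols P) (hsum : Summable fun k : ℕ => 1 - alphaW P w k) :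
    iIndepFun (fun i : {i : ℤ // i ≠ 0} => regenerationBlock e P w i) lawU := by
  classical
  refine iIndepFun_iff_measure_inter_preimage_eq_mul.2 fun S B _ => ?_
  let C : ℤ → Set (List A) := fun i => if h : i ≠ 0 then B ⟨i, h⟩ else Set.univ
  have hC (i : {i : ℤ // i ≠ 0}) : C i = B i := dif_pos i.2
  have h := lawU_iInter_regenerationBlock (e := e) hP hE hw hsum
    (S := S.image Subtype.val) (by simp) C
  rw [Finset.prod_image Subtype.val_injective.injOn, Finset.set_biInter_finset_image] at h
  simp only [hC] at h
  rw [h]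
  exact Finset.prod_congr rfl fun i _ =>
    (lawU_preimage_regenerationBlock hP hE hw hsum i.2 (B i)).symm

variable [MeasurableSpace A] [DiscreteMeasurableSpace A]

lemma identDistrib_regenerationBlock (hP : IsKernel P) (hE : (spontaneousSymbols P).Nonempty)
    (hw : ∀ a ∈ w, a ∈ spontaneousSymbols P) (hsum : Summable fun k : ℕ => 1 - alphaW P w k)
    {i j : ℤ} (hi : i ≠ 0) (hj : j ≠ 0) :
    IdentDistrib (regenerationBlock e P w i) (regenerationBlock e P w j) lawU lawU where
  aemeasurable_fst := (measurable_regenerationBlock hP i).aemeasurable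
  aemeasurable_snd := (measurable_regenerationBlock hP j).aemeasurable
  map_eq := by
    ext B hB
    rw [Measure.map_apply (measurable_regenerationBlock hP i) hB,
      Measure.map_apply (measurable_regenerationBlock hP j) hB,
      lawU_preimage_regenerationBlock hP hE hw hsum hi,
      lawU_preimage_regenerationBlock hP hE hw hsum hj]

lemma lintegral_length_regenerationBlock (hP : IsKernel P) (hE : (spontaneousSymbols P).Nonempty)
    (hw : ∀ a ∈ w, a ∈ spontaneousSymbols P) (hsum : Summable fun k : ℕ => 1 - alphaW P w k)
    {i : ℤ} (hi : i ≠ 0) :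
    ∫⁻ U, ((regenerationBlock e P w i U).length : ℝ≥0∞) ∂lawU =
      ∑' p : ℕ × ℕ, lawU (cycleEvent e P w Set.univ 0 (p.1 + p.2 + 1)) := by
  have h_length : Measurable fun U => (regenerationBlock e P w i U).length :=
    (Measurable.of_discrete (f := List.length)).comp (measurable_regenerationBlock hP i)
  have h_tail (n : ℕ) : lawU {U | n < (regenerationBlock e P w i U).length} =
      ∑' l : ℕ, lawU (cycleEvent e P w Set.univ 0 (n + l + 1)) := by
    rw [← cycleLaw_lt_length hP, ← lawU_preimage_regenerationBlock hP hE hw hsum hi]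
    rfl
  rw [lintegral_natCast_eq_tsum _ h_length, tsum_congr h_tail]
  exact ENNReal.tsum_prod.symm

lemma integrable_length_regenerationBlock (hP : IsKernel P)
    (hE : (spontaneousSymbols P).Nonempty) (hw : ∀ a ∈ w, a ∈ spontaneousSymbols P)
    (hsum : Summable fun k : ℕ => 1 - alphaW P w k) {i : ℤ} (hi : i ≠ 0) :
    Integrable (fun U => ((regenerationBlock e P w i U).length : ℝ)) lawU := by
  have h_length : Measurable fun U => ((regenerationBlock e P w i U).length : ℝ) :=
    (Measurable.of_discrete (f := fun v : List A => (v.length : ℝ))).comp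
      (measurable_regenerationBlock hP i)
  refine ⟨h_length.aestronglyMeasurable, lt_top_iff_ne_top.2 fun h_top => ?_⟩
  simp only [Real.enorm_natCast, lintegral_length_regenerationBlock hP hE hw hsum hi] at h_top
  have h_one := tsum_lawU_cycleEvent_mul (e := e) hP hE hw hsum
  rw [h_top, ENNReal.top_mul (lawU_isRegeneration_pos hP hE hw hsum).ne'] at h_one
  exact ENNReal.top_ne_one h_one

end BlockLaw

end InfiniteMemory

theorem corollary2 {A : Type*} [Countable A] [MeasurableSpace A] [DiscreteMeasurableSpace A]
    (e : A ↪ ℕ) (P : A → (ℕ → A) → ℝ) (hP : InfiniteMemory.IsKernel P)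
    (hE : (InfiniteMemory.spontaneousSymbols P).Nonempty)
    (w : List A) (hw : ∀ a ∈ w, a ∈ InfiniteMemory.spontaneousSymbols P)
    (hsum : Summable fun k : ℕ => 1 - InfiniteMemory.alphaW P w k) :
    ∃ X : (ℤ → ℝ) → ℤ → A, Measurable X ∧
      InfiniteMemory.IsStationaryCompatible P (InfiniteMemory.lawU.map X) ∧
      (∀ ν : Measure (ℤ → A), InfiniteMemory.IsStationaryCompatible P ν →
        ν = InfiniteMemory.lawU.map X) ∧
      (∀ m n : ℤ, m ≤ n → ∀ᵐ U ∂InfiniteMemory.lawU,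
        ∃ θ ≤ m, InfiniteMemory.Outputs e P w U m n θ (X U)) ∧
      ∃ T : ℤ → (ℤ → ℝ) → ℤ,
        (∀ i, Measurable (T i)) ∧
        (∀ᵐ U ∂InfiniteMemory.lawU, (∀ i, T i U < T (i + 1) U) ∧ T 0 U ≤ 0 ∧ 0 < T 1 U) ∧
        iIndepFun (fun (i : {i : ℤ // i ≠ 0}) (U : ℤ → ℝ) =>
          InfiniteMemory.block (X U) (T i U) (T (i + 1) U)) InfiniteMemory.lawU ∧
        (∀ i j : ℤ, i ≠ 0 → j ≠ 0 →
          IdentDistrib (fun U => InfiniteMemory.block (X U) (T i U) (T (i + 1) U))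
            (fun U => InfiniteMemory.block (X U) (T j U) (T (j + 1) U))
            InfiniteMemory.lawU InfiniteMemory.lawU) ∧
        ∀ i : ℤ, i ≠ 0 →
          Integrable (fun U => ((InfiniteMemory.block (X U) (T i U) (T (i + 1) U)).length : ℝ))
            InfiniteMemory.lawU := by
  have : Nonempty A := ⟨hE.some⟩
  have h_typical := InfiniteMemory.ae_isTypical (e := e) hP hE hw hsum
  refine ⟨InfiniteMemory.chain e P w, InfiniteMemory.measurable_chain hP,
    InfiniteMemory.isStationaryCompatible_map_chain hP hE hw hsum,
    fun ν hν => hν.eq_map_chain hP hE hw hsum, fun m n hmn => ?_,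
    InfiniteMemory.regenerationTime e P w, InfiniteMemory.measurable_regenerationTime hP, ?_,
    InfiniteMemory.iIndepFun_regenerationBlock hP hE hw hsum,
    fun i j hi hj => InfiniteMemory.identDistrib_regenerationBlock hP hE hw hsum hi hj,
    fun i hi => InfiniteMemory.integrable_length_regenerationBlock hP hE hw hsum hi⟩
  · filter_upwards [h_typical] with U hU
    exact hU.outputs hP hmn
  · filter_upwards [h_typical] with U hU
    exact ⟨fun i => (hU.consecutiveRegenerations_regenerationTime i).lt,
      InfiniteMemory.regenerationTime_zero_le U, hU.regenerationTime_one_pos⟩
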